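/- A subgroup $\Lambda$ of a countable group $\Gamma$ is called a \emph{measure free-factor} of $\Gamma$ if $\Gamma$ admits an (essentially) free probability measure preserving action on a standard probability space $(X,\mu)$ whose orbit equivalence relation $\mathcal R_\Gamma$ is a free product $\mathcal R_\Gamma=\mathcal R_\Lambda * \mathcal S$ of the orbit equivalence relation $\mathcal R_\Lambda$ of $\Lambda$ and some measurable subrelation $\mathcal S\subset\mathcal R_\Gamma$. That is, up to null sets, $\mathcal R_\Gamma$ is the smallest equivalence relation containing $\mathcal R_\Lambda$ and $\mathcal S$, and for almost every cyclic sequence $u_0,v_0,u_1,v_1,\dots,u_n,v_n$ (with $n\ge 0$ and $u_{n+1}:=u_0$) such that $u_i\,\mathcal R_\Lambda\, v_i$ and $v_i\,\mathcal S\,u_{i+1}$ for all $i$, two consecutive terms are equal. Let $\Sigma$ be a compact connected oriented surface of genus $p\ge 0$ with $r>0$ boundary components, i.e. a space homeomorphic to the quotient of a polygon with $4p+3r$ sides, reading in cyclic order $$a_1b_1a_1^{-1}b_1^{-1}\cdots a_pb_pa_p^{-1}b_p^{-1}\;c_1d_1c_1^{-1}\cdots c_rd_rc_r^{-1},$$ obtained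 by gluing the two sides labelled $a_i$, the two sides labelled $b_i$ and the two sides labelled $c_j$, with opposite orientations. The unglued sides $d_1,\dots,d_r$ become the boundary circles of $\Sigma$, and the $c_j$ become arcs from a common point $*$ to these circles, pairwise disjoint except at $*$. Let $x\in\Sigma$, let $\gamma$ be any path from $x$ to $*$, let $\kappa_j\in\pi_1(\Sigma,x)$ be the class of the loop $\gamma\, c_j\, d_j\, c_j^{-1}\gamma^{-1}$ around the $j$-th boundary component, and let $\Lambda\le\pi_1(\Sigma,x)$ be the subgroup generated by $\kappa_1,\dots,\kappa_r$. Then: 1. $\pi_1(\Sigma,x)$ is isomorphic to the free group $\mathbf F_q$ with $q=2p+r-1$; 2. if $p\ge 1$, then $\kappa_1,\dots,\kappa_r$ freely generate $\Lambda$, so $\Lambda\cong\mathbf F_r$; 3. $\Lambda$ is a measure free-factor of $\pi_1(\Sigma,x)\cong\mathbf F_q$. -/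

import Mathlib

open MeasureTheory

/-! ### Measured equivalence relations and measure free-factors -/

/-- `R` splits as the free product `R = R₁ * R₂` of two subrelations, modulo `μ`-null sets:
`R₁` and `R₂` generate `R`, and in almost every cyclic sequence
`u 0, v 0, u 1, v 1, …, u n, v n` (indices of `Fin (n + 1)` are added modulo `n + 1`) whose terms
are successively `R₁`- and `R₂`-equivalent, two consecutive terms coincide. Since all the terms lie
in the (countable) class of the first one, "almost every sequence" means: every sequence starting
at `x`, for almost every `x`. -/
def IsFreeProductRel {X : Type*} [MeasurableSpace X] (μ : Measure X)
    (R R₁ R₂ : Setoid X) : Prop :=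
  R₁ ≤ R ∧ R₂ ≤ R ∧
  (∀ᵐ x ∂μ, ∀ y : X, R x y → (R₁ ⊔ R₂) x y) ∧
  (∀ᵐ x ∂μ, ∀ (n : ℕ) (u v : Fin (n + 1) → X), u 0 = x →
    (∀ i, R₁ (u i) (v i) ∧ R₂ (v i) (u (i + 1))) →
    ∃ i, u i = v i ∨ v i = u (i + 1))

/-- The action of `Γ` on the measure space `X` is measure preserving and essentially free. -/
def IsFreePMPAction (Γ : Type*) [Group Γ] {X : Type*} [MeasurableSpace X] [MulAction Γ X]
    (μ : Measure X) : Prop :=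
  (∀ g : Γ, MeasurePreserving (fun x : X => g • x) μ μ) ∧
  (∀ᵐ x ∂μ, ∀ g : Γ, g • x = x → g = 1)

/-- A subgroup `Λ` of a (countable) group `Γ` is a measure free-factor of `Γ` if `Γ` admits an
essentially free probability measure preserving action on a standard probability space `(X, μ)`
such that the orbit equivalence relation of `Γ` is the free product of the orbit equivalence
relation of `Λ` and of some measurable subrelation `S`. -/
def IsMeasureFreeFactor {Γ : Type*} [Group Γ] (Λ : Subgroup Γ) : Prop :=
  ∃ (X : Type) (_ : MeasurableSpace X) (_ : StandardBorelSpace X) (μ : Measure X)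
    (_ : IsProbabilityMeasure μ) (_ : MulAction Γ X),
    IsFreePMPAction Γ μ ∧
    ∃ S : Setoid X, MeasurableSet {q : X × X | S q.1 q.2} ∧
      IsFreeProductRel μ (MulAction.orbitRel Γ X) (MulAction.orbitRel Λ X) S

/-! ### The oriented surface of genus `p` with `r` boundary components

It is obtained from a polygon with `4 * p + 3 * r` sides, which read, in cyclic order,
`a₁ b₁ a₁⁻¹ b₁⁻¹ ⋯ a_p b_p a_p⁻¹ b_p⁻¹ c₁ d₁ c₁⁻¹ ⋯ c_r d_r c_r⁻¹`,
by gluing, with the opposite orientation, the two sides labelled `aᵢ`, the two sides labelled `bᵢ`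
and the two sides labelled `cⱼ`. The sides `dⱼ` are left unglued: they become the `r` boundary
circles, and `cⱼ` becomes an arc from the base point to the `j`-th boundary circle. -/

/-- The polygon, as the closed unit disc of the complex plane. -/
abbrev PolygonDisc : Type := {z : ℂ // ‖z‖ ≤ 1}

/-- The parametrization of the boundary of the polygon with `N = 4 * p + 3 * r` sides: as `t` runs
through `[k, k + 1]`, the point `polygonBoundary p r t` runs through the side number `k`. -/
noncomputable def polygonBoundary (p r : ℕ) (t : ℝ) : PolygonDisc :=
  ⟨Complex.exp ((2 * Real.pi * t / ((4 * p + 3 * r : ℕ) : ℝ) : ℝ) * Complex.I),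
    (Complex.norm_exp_ofReal_mul_I _).le⟩

/-- The gluing of the sides of the polygon. -/
inductive SurfaceGluing (p r : ℕ) : PolygonDisc → PolygonDisc → Prop
  | a (i : Fin p) (t : ℝ) (h0 : 0 ≤ t) (h1 : t ≤ 1) :
      SurfaceGluing p r (polygonBoundary p r (4 * (i : ℕ) + t))
        (polygonBoundary p r (4 * (i : ℕ) + 3 - t))
  | b (i : Fin p) (t : ℝ) (h0 : 0 ≤ t) (h1 : t ≤ 1) :
      SurfaceGluing p r (polygonBoundary p r (4 * (i : ℕ) + 1 + t))
        (polygonBoundary p r (4 * (i : ℕ) + 4 - t))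
  | c (j : Fin r) (t : ℝ) (h0 : 0 ≤ t) (h1 : t ≤ 1) :
      SurfaceGluing p r (polygonBoundary p r (4 * p + 3 * (j : ℕ) + t))
        (polygonBoundary p r (4 * p + 3 * (j : ℕ) + 3 - t))

/-- The compact connected oriented surface of genus `p` with `r` boundary components (`r > 0`),
with the quotient topology. -/
def OrientedSurface (p r : ℕ) : Type := Quot (SurfaceGluing p r)

instance instTopologicalSpaceOrientedSurface (p r : ℕ) :
    TopologicalSpace (OrientedSurface p r) :=
  inferInstanceAs (TopologicalSpace (Quot (SurfaceGluing p r)))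

namespace OrientedSurface

/-- The image in the surface of the boundary of the polygon. -/
noncomputable def bd (p r : ℕ) (t : ℝ) : OrientedSurface p r :=
  Quot.mk (SurfaceGluing p r) (polygonBoundary p r t)

theorem continuous_bd (p r : ℕ) : Continuous (bd p r) := by
  refine continuous_quot_mk.comp (Continuous.subtype_mk ?_ _)
  fun_prop

/-- The base point: the image of the vertex number `0` of the polygon. -/
noncomputable def basePoint (p r : ℕ) : OrientedSurface p r := bd p r 0

theorem bd_four_mul (p r k : ℕ) (hk : k ≤ p) : bd p r (4 * (k : ℝ)) = basePoint p r := by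
  induction k with
  | zero => simp [basePoint]
  | succ k ih =>
    rw [← ih (by omega)]
    have e1 : bd p r (4 * (k : ℝ) + 0) = bd p r (4 * (k : ℝ) + 3 - 0) :=
      Quot.sound (SurfaceGluing.a ⟨k, hk⟩ 0 le_rfl zero_le_one)
    have e2 : bd p r (4 * (k : ℝ) + 1 + 1) = bd p r (4 * (k : ℝ) + 4 - 1) :=
      Quot.sound (SurfaceGluing.b ⟨k, hk⟩ 1 zero_le_one le_rfl)
    have e3 : bd p r (4 * (k : ℝ) + 1) = bd p r (4 * (k : ℝ) + 3 - 1) :=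
      Quot.sound (SurfaceGluing.a ⟨k, hk⟩ 1 zero_le_one le_rfl)
    have e4 : bd p r (4 * (k : ℝ) + 1 + 0) = bd p r (4 * (k : ℝ) + 4 - 0) :=
      Quot.sound (SurfaceGluing.b ⟨k, hk⟩ 0 le_rfl zero_le_one)
    have n1 : 4 * (k : ℝ) + 1 + 1 = 4 * k + 3 - 1 := by ring
    have n2 : 4 * (k : ℝ) + 4 - 1 = 4 * k + 3 := by ring
    have n3 : 4 * ((k + 1 : ℕ) : ℝ) = 4 * k + 4 := by push_cast; ring
    rw [n3]
    rw [add_zero, sub_zero] at e1 e4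
    rw [n1, n2] at e2
    rw [← e4, e3, e2, e1]

theorem bd_four_mul_add (p r k : ℕ) (hk : k ≤ r) :
    bd p r (4 * (p : ℝ) + 3 * (k : ℝ)) = basePoint p r := by
  induction k with
  | zero => simpa using bd_four_mul p r p le_rfl
  | succ k ih =>
    rw [← ih (by omega)]
    have e1 : bd p r (4 * (p : ℝ) + 3 * (k : ℝ) + 0) = bd p r (4 * (p : ℝ) + 3 * (k : ℝ) + 3 - 0) :=
      Quot.sound (SurfaceGluing.c ⟨k, hk⟩ 0 le_rfl zero_le_one)
    have n3 : 4 * (p : ℝ) + 3 * ((k + 1 : ℕ) : ℝ) = 4 * p + 3 * k + 3 := by push_cast; ring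
    rw [add_zero, sub_zero] at e1
    rw [n3, e1]

/-- The loop `cⱼ dⱼ cⱼ⁻¹` based at the base point: it runs along the arc `cⱼ`, around the `j`-th
boundary circle `dⱼ`, and back along `cⱼ`. -/
noncomputable def boundaryLoop (p r : ℕ) (j : Fin r) : Path (basePoint p r) (basePoint p r) where
  toFun t := bd p r (4 * (p : ℝ) + 3 * ((j : ℕ) : ℝ) + 3 * (t : ℝ))
  continuous_toFun := (continuous_bd p r).comp (by fun_prop)
  source' := by simpa using bd_four_mul_add p r j j.2.le
  target' := by
    have h := bd_four_mul_add p r (j + 1) j.2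
    have n : 4 * (p : ℝ) + 3 * ((j + 1 : ℕ) : ℝ) = 4 * p + 3 * ((j : ℕ) : ℝ) + 3 * 1 := by
      push_cast; ring
    rw [n] at h
    simpa using h

end OrientedSurface

/-- Let `h` identify `M` with the standard surface of genus `p` with `r` boundary components, and
let `γ` be a path from a point `x` of `M` to the base point. This is the class, in the fundamental
group of `M` at `x`, of the loop that runs along `γ`, then along the image of the arc `cⱼ`, around
the `j`-th boundary circle of `M`, and back the same way. -/
noncomputable def boundaryClass {p r : ℕ} {M : Type*} [TopologicalSpace M]
    (h : OrientedSurface p r ≃ₜ M) {x : M} (γ : Path x (h (OrientedSurface.basePoint p r)))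
    (j : Fin r) : FundamentalGroup M x :=
  FundamentalGroup.fromPath (Path.Homotopic.Quotient.mk
    (γ.trans (((OrientedSurface.boundaryLoop p r j).map h.continuous).trans γ.symm)))

/-! The core is a statement on free groups: if a basis consists of a, b, a set K and further
elements, and w is a word in the further ones, then W = [a,b]w and K generate a measure free-factor
Λ of Γ, although Λ need not be a free factor (for instance ⟨[a,b]⟩ in F₂). Γ acts on its Bernoulli
shift X, and one builds a measurable cocycle σ from Γ × X to Γ * Γ with σ(g, ·) = inl g for g in Λ,
almost everywhere. Let x S gx mean σ(g, x) = inr g. A cyclic sequence that alternates between the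
orbits of Λ and S without repetition would give a nonempty reduced word in Γ * Γ equal, by freeness
of the action, to σ(1, x) = 1. As Γ is free, σ may be prescribed on the basis: inl on K, inr on the
further elements, and A, B on a, b. The condition σ(W, ·) = inl W becomes A(bx)B(x) = ω B(ax)A(x)
with ω = inl W · inr w⁻¹. A fair coin at x decides which of A(bx) = inr a (heads) and B(ax) = inr b
(tails) is imposed, and the equation gives the other value. To compute A and B at x one needs their
values at a⁻¹x if the coin there shows heads, and at b⁻¹x if the coin there shows tails. This is a
critical branching process, so it dies out almost surely: its survival probabilities satisfy q' = q
- q²/4. Induction on the depth of this recursion also shows that the orbits of Λ and S generate the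
orbit relation: in the square with sides x–ax, x–bx, ax–bax, bx–abx, the points bax and abx are
always related, one of the last two sides lies in S, and the remaining side follows from the first
two. On the topological side, the polygon retracts onto its boundary minus the last free side.
Collapsing the arcs c_j then gives a wedge of circles, whose fundamental group is shown to be free
by coverings with prescribed monodromy and by a covering argument on paths. The boundary of the disc
is null-homotopic, so the last boundary loop is expressed by the handles and the other boundary
loops. If p = 0, Λ is the whole group. If p ≥ 1, the first handle provides the commutator [a,b];
freeness of the κ_j follows because every group element becomes a commutator in a larger group. -/

/-! ### The Bernoulli shift -/

namespace Bernoulli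

open ProbabilityTheory

/-- The space of the Bernoulli shift of `Γ` with base `[0, 1]`. -/
def Space (Γ : Type) : Type := Γ → unitInterval

variable {Γ : Type}

instance : MeasurableSpace (Space Γ) := inferInstanceAs (MeasurableSpace (Γ → unitInterval))

instance [Countable Γ] : StandardBorelSpace (Space Γ) :=
  inferInstanceAs (StandardBorelSpace (Γ → unitInterval))

/-- The product measure on the space of the Bernoulli shift. -/
noncomputable def measure (Γ : Type) : Measure (Space Γ) :=
  Measure.infinitePi fun _ : Γ => (volume : Measure unitInterval)

instance : IsProbabilityMeasure (measure Γ) :=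
  inferInstanceAs (IsProbabilityMeasure (Measure.infinitePi _))

/-- Right translation of the index makes this a left action. Coordinate 1 of g • x is x g, so x g is
the label attached to the point g • x of the orbit. -/
instance [Group Γ] : MulAction Γ (Space Γ) where
  smul g x := fun h => x (h * g)
  one_smul x := funext fun h => congrArg x (mul_one h)
  mul_smul g g' x := funext fun h => congrArg x (mul_assoc h g g').symm

theorem smul_apply [Group Γ] (g : Γ) (x : Space Γ) (h : Γ) : (g • x) h = x (h * g) := rfl

theorem measurable_eval (h : Γ) : Measurable fun x : Space Γ => x h := measurable_pi_apply h

theorem measurePreserving_smul [Group Γ] (g : Γ) :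
    MeasurePreserving (fun x : Space Γ => g • x) (measure Γ) (measure Γ) := by
  refine ⟨measurable_pi_lambda _ fun h => measurable_eval (h * g), ?_⟩
  exact Measure.map_infinitePi_infinitePi_of_inj (P := fun _ : Γ => (volume : Measure unitInterval))
    (mul_left_injective g)

theorem iIndepFun_eval : iIndepFun (fun (h : Γ) (x : Space Γ) => x h) (measure Γ) :=
  iIndepFun_infinitePi (X := fun _ => id) fun _ => measurable_id

theorem measure_eval_preimage (h : Γ) {s : Set unitInterval} (hs : MeasurableSet s) :
    measure Γ {x | x h ∈ s} = volume s :=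
  (measurePreserving_eval_infinitePi (fun _ : Γ => (volume : Measure unitInterval)) h
    ).measure_preimage hs.nullMeasurableSet

/-- Two coordinates are independent with a law that has no atoms, so the diagonal is null by Fubini.
-/
theorem ae_ne {g h : Γ} (hgh : g ≠ h) : ∀ᵐ x ∂measure Γ, x g ≠ x h := by
  have hind : (measure Γ).map (fun x : Space Γ => (x g, x h)) = volume.prod volume :=
    Measure.infinitePi_map_eval_prod (P := fun _ : Γ => (volume : Measure unitInterval)) hgh
  have hd : MeasurableSet {q : unitInterval × unitInterval | q.1 = q.2} :=
    measurableSet_eq_fun measurable_fst measurable_snd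
  have h0 : (volume.prod volume : Measure (unitInterval × unitInterval)) {q | q.1 = q.2} = 0 := by
    rw [Measure.measure_prod_null hd]
    refine Filter.Eventually.of_forall fun x => ?_
    have : Prod.mk x ⁻¹' {q : unitInterval × unitInterval | q.1 = q.2} = {x} := by
      ext y; simp [eq_comm]
    change volume (Prod.mk x ⁻¹' _) = 0
    rw [this]; simp
  rw [← hind, Measure.map_apply ((measurable_eval g).prodMk (measurable_eval h)) hd] at h0
  exact measure_eq_zero_iff_ae_notMem.1 h0

theorem isFreePMPAction [Group Γ] [Countable Γ] : IsFreePMPAction Γ (measure Γ) := by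
  refine ⟨measurePreserving_smul, ?_⟩
  rw [ae_all_iff]
  intro g
  by_cases hg : g = 1
  · exact Filter.Eventually.of_forall fun _ _ => hg
  filter_upwards [ae_ne hg] with x hx h
  refine absurd ?_ hx
  have := congrFun h 1
  rwa [smul_apply, one_mul] at this

theorem indep_of_disjoint {s t : Set Γ} (hst : Disjoint s t) {A B : Set (Space Γ)}
    (hA : MeasurableSet[⨆ h ∈ s, MeasurableSpace.comap (fun x : Space Γ => x h) inferInstance] A)
    (hB : MeasurableSet[⨆ h ∈ t, MeasurableSpace.comap (fun x : Space Γ => x h) inferInstance] B) :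
    measure Γ (A ∩ B) = measure Γ A * measure Γ B :=
  (Indep_iff _ _ _).1 (indep_iSup_of_disjoint (fun h => (measurable_eval h).comap_le)
    iIndepFun_eval hst) A B hA hB

/-- The `σ`-algebra generated by a set of coordinates. -/
@[reducible] def coordSpace (s : Set Γ) : MeasurableSpace (Space Γ) :=
  ⨆ h ∈ s, MeasurableSpace.comap (fun x : Space Γ => x h) inferInstance

theorem coordSpace_mono {s t : Set Γ} (h : s ⊆ t) : coordSpace s ≤ coordSpace t :=
  biSup_mono h

theorem coordSpace_le (s : Set Γ) : coordSpace s ≤ inferInstanceAs (MeasurableSpace (Space Γ)) :=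
  iSup₂_le fun h _ => (measurable_eval h).comap_le

theorem measurableSet_coordSpace_eval {s : Set Γ} {h : Γ} (hs : h ∈ s) {A : Set unitInterval}
    (hA : MeasurableSet A) : MeasurableSet[coordSpace s] {x : Space Γ | x h ∈ A} :=
  (le_iSup₂_of_le h hs le_rfl : MeasurableSpace.comap (fun x : Space Γ => x h) inferInstance
    ≤ coordSpace s) _ ⟨A, hA, rfl⟩

theorem measurableSet_coordSpace_smul [Group Γ] {s t : Set Γ} (g : Γ) (hst : ∀ h ∈ s, h * g ∈ t)
    {A : Set (Space Γ)} (hA : MeasurableSet[coordSpace s] A) :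
    MeasurableSet[coordSpace t] ((fun x : Space Γ => g • x) ⁻¹' A) := by
  have : (coordSpace s).comap (fun x : Space Γ => g • x) ≤ coordSpace t := by
    simp only [coordSpace, MeasurableSpace.comap_iSup, MeasurableSpace.comap_comp]
    exact iSup₂_le fun h hh => le_iSup₂_of_le (h * g) (hst h hh) le_rfl
  exact this _ ⟨A, hA, rfl⟩

/-! ### Extinction of the critical branching process -/

section Depth

variable [Group Γ] (a b : Γ)

/-- The points at which the fair coin falls on heads. -/
def heads (Γ : Type) [Group Γ] : Set (Space Γ) :=
  {x | x 1 ∈ Set.Iio (⟨1 / 2, by norm_num, by norm_num⟩ : unitInterval)}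

/-- Consider the map that sends a point `x` to `a • x` if `x ∈ heads Γ`, and to `b • x` otherwise.
The set `deep a b n` consists of the points with at least one `n`-th preimage. -/
def deep : ℕ → Set (Space Γ)
  | 0 => Set.univ
  | n + 1 => (fun x => a⁻¹ • x) ⁻¹' (heads Γ ∩ deep n) ∪
      (fun x => b⁻¹ • x) ⁻¹' ((heads Γ)ᶜ ∩ deep n)

theorem measurableSet_heads : MeasurableSet (heads Γ) :=
  measurable_eval 1 measurableSet_Iio

theorem measure_heads : (measure Γ).real (heads Γ) = 1 / 2 := by
  rw [Measure.real, heads, measure_eval_preimage 1 measurableSet_Iio, unitInterval.volume_Iio,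
    ENNReal.toReal_ofReal (by norm_num)]

/-- Ancestors of x are the points m⁻¹ • x with m a nonempty positive word in a, b. Only their labels
matter; the label of x itself does not, which gives the independence used below. -/
theorem measurableSet_deep (n : ℕ) :
    MeasurableSet[coordSpace {h : Γ | ∃ m ∈ Submonoid.closure {a, b}, h⁻¹ = a * m ∨ h⁻¹ = b * m}]
      (deep a b n) := by
  have ha : a ∈ Submonoid.closure {a, b} := Submonoid.subset_closure (by simp)
  have hb : b ∈ Submonoid.closure {a, b} := Submonoid.subset_closure (by simp)
  induction n with
  | zero => exact MeasurableSet.univ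
  | succ n ih =>
    have h1 : MeasurableSet[coordSpace {h : Γ | h⁻¹ ∈ Submonoid.closure {a, b}}] (deep a b n) := by
      refine coordSpace_mono ?_ _ ih
      rintro h ⟨m, hm, e | e⟩ <;> simp only [Set.mem_ofPred_eq, e]
      exacts [mul_mem ha hm, mul_mem hb hm]
    have h2 : MeasurableSet[coordSpace {h : Γ | h⁻¹ ∈ Submonoid.closure {a, b}}] (heads Γ) :=
      measurableSet_coordSpace_eval (by simp) measurableSet_Iio
    refine MeasurableSet.union ?_ ?_
    · refine measurableSet_coordSpace_smul a⁻¹ (fun h hh => ?_) (h2.inter h1)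
      exact ⟨h⁻¹, hh, by simp⟩
    · refine measurableSet_coordSpace_smul b⁻¹ (fun h hh => ?_) (h2.compl.inter h1)
      exact ⟨h⁻¹, hh, by simp⟩

/-- The preimages a⁻¹ • x and b⁻¹ • x each occur and have n further generations with probability
q/2, independently since the two lines of ancestors share no label. Hence q' = q/2 + q/2 - q²/4. The
homomorphism ρ only serves to tell positive words apart. -/
theorem measure_real_deep_succ (ρ : Γ →* Equiv.Perm ℚ) (ha : ∀ q, ρ a q = 2 * q)
    (hb : ∀ q, ρ b q = 2 * q + 1) (n : ℕ) :
    (measure Γ).real (deep a b (n + 1)) =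
      (measure Γ).real (deep a b n) - (measure Γ).real (deep a b n) ^ 2 / 4 := by
  -- Positive words send 1 to a positive integer. Its parity then reveals the first letter, and a
  -- nonempty word cannot fix 1.
  have hpos : ∀ m ∈ Submonoid.closure {a, b}, ∃ k : ℕ, ρ m 1 = k + 1 := by
    intro m hm
    induction hm using Submonoid.closure_induction_left with
    | one => exact ⟨0, by simp⟩
    | mul_left x hx y hy ih =>
      obtain ⟨k, hk⟩ := ih
      rcases hx with rfl | rfl
      · exact ⟨2 * k + 1, by rw [map_mul, Equiv.Perm.mul_apply, hk, ha]; push_cast; ring⟩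
      · exact ⟨2 * k + 2, by rw [map_mul, Equiv.Perm.mul_apply, hk, hb]; push_cast; ring⟩
  set P := Submonoid.closure {a, b} with hP
  have hdisj : Disjoint {h : Γ | ∃ m ∈ P, h⁻¹ = a * m} {h : Γ | ∃ m ∈ P, h⁻¹ = b * m} := by
    rw [Set.disjoint_left]
    rintro h ⟨m, hm, e⟩ ⟨m', hm', e'⟩
    obtain ⟨k, hk⟩ := hpos m hm
    obtain ⟨k', hk'⟩ := hpos m' hm'
    have h1 : ρ (a * m) 1 = ρ (b * m') 1 := by rw [← e, ← e']
    rw [map_mul, map_mul, Equiv.Perm.mul_apply, Equiv.Perm.mul_apply, hk, hk', ha, hb] at h1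
    have h2 : 2 * (k + 1) = 2 * (k' + 1) + 1 := by exact_mod_cast h1
    omega
  have hone : Disjoint {(1 : Γ)} {h : Γ | ∃ m ∈ P, h⁻¹ = a * m ∨ h⁻¹ = b * m} := by
    rw [Set.disjoint_singleton_left]
    rintro ⟨m, hm, e⟩
    obtain ⟨k, hk⟩ := hpos m hm
    have h1 : ρ (1 : Γ)⁻¹ 1 = 1 := by simp
    rcases e with e | e
    · rw [e, map_mul, Equiv.Perm.mul_apply, hk, ha] at h1
      have h2 : 2 * (k + 1) = 1 := by exact_mod_cast h1
      omega
    · rw [e, map_mul, Equiv.Perm.mul_apply, hk, hb] at h1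
      have h2 : 2 * (k + 1) + 1 = 1 := by exact_mod_cast h1
      omega
  have hdeep := measurableSet_deep a b n
  have hdeep' : MeasurableSet (deep a b n) := coordSpace_le _ _ hdeep
  have hheads : MeasurableSet[coordSpace {(1 : Γ)}] (heads Γ) :=
    measurableSet_coordSpace_eval (Set.mem_singleton 1) measurableSet_Iio
  have e1 : (measure Γ).real (heads Γ ∩ deep a b n) = 1 / 2 * (measure Γ).real (deep a b n) := by
    rw [Measure.real, indep_of_disjoint hone hheads hdeep, ENNReal.toReal_mul, ← measure_heads (Γ := Γ)]
    rfl
  have e2 : (measure Γ).real ((heads Γ)ᶜ ∩ deep a b n) =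
      1 / 2 * (measure Γ).real (deep a b n) := by
    have h1 : (measure Γ).real (heads Γ)ᶜ = 1 / 2 := by
      rw [probReal_compl_eq_one_sub measurableSet_heads, measure_heads]; norm_num
    rw [Measure.real, indep_of_disjoint hone hheads.compl hdeep, ENNReal.toReal_mul, ← h1]
    rfl
  have hN : MeasurableSet[coordSpace {h : Γ | h⁻¹ ∈ P}] (deep a b n) := by
    refine coordSpace_mono ?_ _ hdeep
    rintro h ⟨m, hm, e | e⟩ <;> simp only [Set.mem_ofPred_eq, e]
    exacts [mul_mem (Submonoid.subset_closure (by simp)) hm,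
      mul_mem (Submonoid.subset_closure (by simp)) hm]
  have hN' : MeasurableSet[coordSpace {h : Γ | h⁻¹ ∈ P}] (heads Γ) :=
    measurableSet_coordSpace_eval (by simp) measurableSet_Iio
  have m1 := measurableSet_coordSpace_smul (t := {h : Γ | ∃ m ∈ P, h⁻¹ = a * m}) a⁻¹
    (fun h hh => ⟨h⁻¹, hh, by simp⟩) (hN'.inter hN)
  have m2 := measurableSet_coordSpace_smul (t := {h : Γ | ∃ m ∈ P, h⁻¹ = b * m}) b⁻¹
    (fun h hh => ⟨h⁻¹, hh, by simp⟩) (hN'.compl.inter hN)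
  have e3 : (measure Γ).real ((fun x => a⁻¹ • x) ⁻¹' (heads Γ ∩ deep a b n)) =
      1 / 2 * (measure Γ).real (deep a b n) := by
    rw [(measurePreserving_smul a⁻¹).measureReal_preimage
      (measurableSet_heads.inter hdeep').nullMeasurableSet, e1]
  have e4 : (measure Γ).real ((fun x => b⁻¹ • x) ⁻¹' ((heads Γ)ᶜ ∩ deep a b n)) =
      1 / 2 * (measure Γ).real (deep a b n) := by
    rw [(measurePreserving_smul b⁻¹).measureReal_preimage
      (measurableSet_heads.compl.inter hdeep').nullMeasurableSet, e2]
  have e5 : (measure Γ).real ((fun x => a⁻¹ • x) ⁻¹' (heads Γ ∩ deep a b n) ∩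
      (fun x => b⁻¹ • x) ⁻¹' ((heads Γ)ᶜ ∩ deep a b n)) =
      (1 / 2 * (measure Γ).real (deep a b n)) * (1 / 2 * (measure Γ).real (deep a b n)) := by
    rw [Measure.real, indep_of_disjoint hdisj m1 m2, ENNReal.toReal_mul]
    exact congrArg₂ _ e3 e4
  have e6 := measureReal_union_add_inter (μ := measure Γ)
    (s := (fun x => a⁻¹ • x) ⁻¹' (heads Γ ∩ deep a b n)) (coordSpace_le _ _ m2)
  rw [e3, e4, e5] at e6
  rw [deep]
  linarith

/-- The probabilities decrease to a limit L with L = L - L²/4, so L = 0. Invariance of the measure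
and countability of Γ extend this to the whole orbit. -/
theorem ae_exists_notMem_deep [Countable Γ] (ρ : Γ →* Equiv.Perm ℚ) (ha : ∀ q, ρ a q = 2 * q)
    (hb : ∀ q, ρ b q = 2 * q + 1) : ∀ᵐ x ∂measure Γ, ∀ g : Γ, ∃ n, g • x ∉ deep a b n := by
  set q : ℕ → ℝ := fun n => (measure Γ).real (deep a b n) with hq
  have hrec : ∀ n, q (n + 1) = q n - q n ^ 2 / 4 := measure_real_deep_succ a b ρ ha hb
  have hanti : Antitone q := antitone_nat_of_succ_le fun n => by
    rw [hrec]; nlinarith [sq_nonneg (q n)]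
  have hlim := tendsto_atTop_ciInf hanti ⟨0, by rintro _ ⟨n, rfl⟩; exact measureReal_nonneg⟩
  have hL : ⨅ n, q n = 0 := by
    have h1 := (Filter.tendsto_add_atTop_iff_nat 1).2 hlim
    have h2 : Filter.Tendsto (fun n => q (n + 1)) Filter.atTop
        (nhds ((⨅ n, q n) - (⨅ n, q n) ^ 2 / 4)) := by
      simp only [hrec]
      exact hlim.sub ((hlim.pow 2).div_const 4)
    have h3 := tendsto_nhds_unique h1 h2
    have h4 : (⨅ n, q n) ^ 2 = 0 := by linarith
    exact pow_eq_zero_iff two_ne_zero |>.1 h4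
  rw [hL] at hlim
  have hnull : (measure Γ).real (⋂ n, deep a b n) = 0 := by
    refine le_antisymm (ge_of_tendsto' hlim fun n => ?_) measureReal_nonneg
    exact measureReal_mono (Set.iInter_subset _ n)
  have hae : ∀ᵐ x ∂measure Γ, ∃ n, x ∉ deep a b n := by
    rw [measureReal_eq_zero_iff] at hnull
    filter_upwards [measure_eq_zero_iff_ae_notMem.1 hnull] with x hx
    simpa using hx
  rw [ae_all_iff]
  exact fun g => (measurePreserving_smul g).quasiMeasurePreserving.ae hae

end Depth

end Bernoulli

/-! ### Cocycles of actions of free groups -/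

/-- Each generator acts on X × Δ by a skew translation, and freeness extends this to an action Φ.
All these maps commute with right multiplication on Δ, so Φ g is determined by its values at (x, 1),
and these form the cocycle. -/
theorem FreeGroup.exists_cocycle {S X Δ : Type*} [Group Δ] [MulAction (FreeGroup S) X]
    (c : S → X → Δ) : ∃ σ : FreeGroup S → X → Δ,
      (∀ g h x, σ (g * h) x = σ g (h • x) * σ h x) ∧ ∀ s x, σ (FreeGroup.of s) x = c s x := by
  let Φ : FreeGroup S →* Equiv.Perm (X × Δ) := FreeGroup.lift fun s =>
    { toFun := fun q => (FreeGroup.of s • q.1, c s q.1 * q.2)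
      invFun := fun q => ((FreeGroup.of s)⁻¹ • q.1, (c s ((FreeGroup.of s)⁻¹ • q.1))⁻¹ * q.2)
      left_inv := fun q => by simp
      right_inv := fun q => by simp }
  have key : ∀ g : FreeGroup S, ∀ x d, Φ g (x, d) = (g • x, (Φ g (x, 1)).2 * d) := by
    intro g
    induction g using FreeGroup.induction_on with
    | C1 => simp
    | of s => intro x d; simp [Φ]
    | inv_of s ih => intro x d; simp [Φ, Equiv.Perm.inv_def]
    | mul g h hg hh =>
      intro x d
      rw [_root_.map_mul, Equiv.Perm.mul_apply, Equiv.Perm.mul_apply, hh, hg, hh x 1,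
        hg _ ((Φ h (x, 1)).2 * 1)]
      simp [mul_smul, mul_assoc]
  refine ⟨fun g x => (Φ g (x, 1)).2, fun g h x => ?_, fun s x => by simp [Φ]⟩
  change (Φ (g * h) (x, 1)).2 = (Φ g (h • x, 1)).2 * (Φ h (x, 1)).2
  rw [_root_.map_mul, Equiv.Perm.mul_apply, key h, key g]

section Cocycle

variable {Γ X Δ : Type*} [Group Γ] [Group Δ] [MulAction Γ X] {σ : Γ → X → Δ}

theorem cocycle_one (hσ : ∀ g h x, σ (g * h) x = σ g (h • x) * σ h x) (x : X) : σ 1 x = 1 := by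
  simpa using hσ 1 1 x

theorem cocycle_inv (hσ : ∀ g h x, σ (g * h) x = σ g (h • x) * σ h x) (g : Γ) (x : X) :
    σ g⁻¹ x = (σ g (g⁻¹ • x))⁻¹ := by
  have := hσ g g⁻¹ x
  rw [mul_inv_cancel, cocycle_one hσ] at this
  exact eq_inv_of_mul_eq_one_right this.symm

theorem measurable_cocycle_of_closure [MeasurableSpace X] [MeasurableSpace Δ]
    [DiscreteMeasurableSpace Δ] [Countable Δ]
    (hσ : ∀ g h x, σ (g * h) x = σ g (h • x) * σ h x)
    (hX : ∀ g : Γ, Measurable fun x : X => g • x) {T : Set Γ} (hT : ∀ g ∈ T, Measurable (σ g))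
    {g : Γ} (hg : g ∈ Subgroup.closure T) : Measurable (σ g) := by
  induction hg using Subgroup.closure_induction with
  | mem g hg => exact hT g hg
  | one => rw [funext (cocycle_one hσ)]; exact measurable_const
  | mul g h _ _ ihg ihh =>
    rw [funext (hσ g h)]
    exact (measurable_of_countable fun q : Δ × Δ => q.1 * q.2).comp ((ihg.comp (hX h)).prodMk ihh)
  | inv g _ ih =>
    rw [funext (cocycle_inv hσ g)]
    exact (measurable_of_countable fun d : Δ => d⁻¹).comp (ih.comp (hX g⁻¹))

/-- The elements on which a cocycle agrees, over an invariant set, with a homomorphism. -/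
theorem cocycle_eq_of_mem_closure (hσ : ∀ g h x, σ (g * h) x = σ g (h • x) * σ h x) (φ : Γ →* Δ)
    {Y : Set X} (hY : ∀ (g : Γ), ∀ x ∈ Y, g • x ∈ Y) {T : Set Γ}
    (hT : ∀ g ∈ T, ∀ x ∈ Y, σ g x = φ g) {g : Γ} (hg : g ∈ Subgroup.closure T) {x : X}
    (hx : x ∈ Y) : σ g x = φ g := by
  induction hg using Subgroup.closure_induction generalizing x with
  | mem g hg => exact hT g hg x hx
  | one => rw [cocycle_one hσ, map_one]
  | mul g h _ _ ihg ihh => rw [hσ, ihg (hY h x hx), ihh hx, map_mul]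
  | inv g _ ih => rw [cocycle_inv hσ, ih (hY g⁻¹ x hx), map_inv]

/-- The relation between two points of an orbit on which a cocycle takes the value given by a
homomorphism. -/
def cocycleSetoid (hσ : ∀ g h x, σ (g * h) x = σ g (h • x) * σ h x) (φ : Γ →* Δ) : Setoid X where
  r x y := ∃ g : Γ, g • x = y ∧ σ g x = φ g
  iseqv :=
    { refl := fun x => ⟨1, one_smul _ _, by rw [cocycle_one hσ, map_one]⟩
      symm := by
        rintro x _ ⟨g, rfl, h⟩
        exact ⟨g⁻¹, inv_smul_smul _ _, by rw [cocycle_inv hσ, inv_smul_smul, h, map_inv]⟩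
      trans := by
        rintro x _ _ ⟨g, rfl, h⟩ ⟨g', rfl, h'⟩
        exact ⟨g' * g, mul_smul _ _ _, by rw [hσ, h, h', map_mul]⟩ }

theorem measurableSet_cocycleSetoid [Countable Γ] [MeasurableSpace X] [StandardBorelSpace X]
    [MeasurableSpace Δ] [DiscreteMeasurableSpace Δ]
    (hσ : ∀ g h x, σ (g * h) x = σ g (h • x) * σ h x)
    (hX : ∀ g : Γ, Measurable fun x : X => g • x) (hm : ∀ g, Measurable (σ g)) (φ : Γ →* Δ) :
    MeasurableSet {q : X × X | cocycleSetoid hσ φ q.1 q.2} := by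
  have : {q : X × X | cocycleSetoid hσ φ q.1 q.2} =
      ⋃ g : Γ, {q : X × X | g • q.1 = q.2} ∩ Prod.fst ⁻¹' (σ g ⁻¹' {φ g}) := by
    ext q
    simp only [Set.mem_iUnion, Set.mem_inter_iff, Set.mem_preimage, Set.mem_singleton_iff]
    rfl
  rw [this]
  refine MeasurableSet.iUnion fun g => MeasurableSet.inter ?_ ?_
  · exact measurableSet_eq_fun ((hX g).comp measurable_fst) measurable_snd
  · exact measurable_fst (hm g (measurableSet_singleton _))

/-- A cocycle with values in a free product shows that there is no cyclic sequence of points whose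
consecutive terms are distinct and related by one factor and the other in turn. -/
theorem exists_eq_of_cyclic {σ : Γ → X → Monoid.CoprodI fun _ : Bool => Γ}
    (hσ : ∀ g h x, σ (g * h) x = σ g (h • x) * σ h x) {x : X} (hx : ∀ g : Γ, g • x = x → g = 1)
    (n : ℕ) (u v : Fin (n + 1) → X) (hu : u 0 = x)
    (h : ∀ i, (∃ g : Γ, g • u i = v i ∧ σ g (u i) = Monoid.CoprodI.of (i := true) g) ∧
      ∃ g : Γ, g • v i = u (i + 1) ∧ σ g (v i) = Monoid.CoprodI.of (i := false) g) :
    ∃ i, u i = v i ∨ v i = u (i + 1) := by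
  by_contra! hne
  choose g hg hσg using fun i => (h i).1
  choose k hk hσk using fun i => (h i).2
  have hg1 : ∀ i, g i ≠ 1 := fun i e => (hne i).1 (by rw [← hg i, e, one_smul])
  have hk1 : ∀ i, k i ≠ 1 := fun i e => (hne i).2 (by rw [← hk i, e, one_smul])
  -- After m + 1 rounds the accumulated value of the cocycle is a reduced word whose letters
  -- alternate between the two factors. Indices wrap around, so m = n closes the cycle.
  have key : ∀ m : ℕ, ∃ (γ : Γ) (w : Monoid.CoprodI.NeWord (fun _ : Bool => Γ) false true),
      γ • x = u (Fin.ofNat (n + 1) (m + 1)) ∧ σ γ x = w.prod := by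
    have step : ∀ i : Fin (n + 1), ∃ (γ : Γ)
        (w : Monoid.CoprodI.NeWord (fun _ : Bool => Γ) false true),
        γ • u i = u (i + 1) ∧ σ γ (u i) = w.prod := fun i =>
      ⟨k i * g i, .append (.singleton (k i) (hk1 i)) Bool.false_ne_true
        (.singleton (g i) (hg1 i)), by rw [mul_smul, hg, hk],
        by rw [hσ, hg, hσk, hσg]; simp⟩
    intro m
    induction m with
    | zero =>
      obtain ⟨γ, w, h1, h2⟩ := step 0
      have e : Fin.ofNat (n + 1) (0 + 1) = 0 + 1 := by ext; simp
      exact ⟨γ, w, by rw [e, ← h1, hu], by rw [← h2, hu]⟩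
    | succ m ih =>
      obtain ⟨γ, w, h1, h2⟩ := ih
      obtain ⟨γ', w', h1', h2'⟩ := step (Fin.ofNat (n + 1) (m + 1))
      have e : Fin.ofNat (n + 1) (m + 1 + 1) = Fin.ofNat (n + 1) (m + 1) + 1 := by
        ext; simp [Fin.val_add]
      exact ⟨γ' * γ, .append w' Bool.false_ne_true.symm w, by rw [mul_smul, h1, h1', e],
        by rw [hσ, h1, h2', h2]; simp⟩
  obtain ⟨γ, w, h1, h2⟩ := key n
  have e : Fin.ofNat (n + 1) (n + 1) = 0 := by ext; simp
  rw [e, hu] at h1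
  rw [hx γ h1, cocycle_one hσ] at h2
  -- By freeness of the action the accumulated element is 1, so a nonempty reduced word would have
  -- product 1.
  have h3 : w.toWord = Monoid.CoprodI.Word.empty := by
    classical
    apply Monoid.CoprodI.Word.equiv.symm.injective
    change w.prod = Monoid.CoprodI.Word.prod _
    rw [← h2, Monoid.CoprodI.Word.prod_empty]
  exact w.toList_ne_nil (congrArg Monoid.CoprodI.Word.toList h3)

end Cocycle

/-! ### Random solution of the commutator equation -/

namespace Bernoulli

variable {Γ : Type} [Group Γ] (a b : Γ) {Δ : Type*} [Group Δ] (α β ω : Δ)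

open Classical in
/-- The approximations of the solution of the equation in `solution_spec`. -/
noncomputable def approxSolution : ℕ → Space Γ → Δ × Δ
  -- An arbitrary initial value: it is forgotten as soon as the recursion has died out.
  | 0, _ => (α, β)
  | n + 1, x =>
    (if b⁻¹ • x ∈ heads Γ then α
      else ω * β * (approxSolution n (b⁻¹ • x)).1 * (approxSolution n (b⁻¹ • x)).2⁻¹,
    if a⁻¹ • x ∈ heads Γ
      then ω⁻¹ * α * (approxSolution n (a⁻¹ • x)).2 * (approxSolution n (a⁻¹ • x)).1⁻¹
      else β)

/-- The recursion passes from x to a⁻¹ • x or b⁻¹ • x exactly along the preimages counted by `deep`.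
Off `deep a b n` it stops within n steps and never reads the initial value. -/
theorem approxSolution_eq_of_notMem_deep {n m : ℕ} (h : n ≤ m) {x : Space Γ}
    (hx : x ∉ deep a b n) :
    approxSolution a b α β ω m x = approxSolution a b α β ω n x := by
  induction n generalizing m x with
  | zero => exact absurd (Set.mem_univ x) hx
  | succ n ih =>
    obtain ⟨m, rfl⟩ : ∃ k, m = k + 1 := ⟨m - 1, by omega⟩
    simp only [deep, Set.mem_union, Set.mem_preimage, Set.mem_inter_iff, Set.mem_compl_iff,
      not_or, not_and] at hx
    simp only [approxSolution]
    congr 1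
    · split_ifs with h1
      · rfl
      · rw [ih (by omega) (hx.2 h1)]
    · split_ifs with h1
      · rw [ih (by omega) (hx.1 h1)]
      · rfl

/-- The least `n` such that `x ∉ deep a b n`. -/
noncomputable def depth (x : Space Γ) : ℕ := sInf {n | x ∉ deep a b n}

/-- A solution of the equation in `solution_spec`. -/
noncomputable def solution (x : Space Γ) : Δ × Δ := approxSolution a b α β ω (depth a b x) x

theorem solution_eq {n : ℕ} {x : Space Γ} (hx : x ∉ deep a b n) :
    solution a b α β ω x = approxSolution a b α β ω n x :=
  (approxSolution_eq_of_notMem_deep a b α β ω (Nat.sInf_le hx)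
    (Nat.sInf_mem (s := {n | x ∉ deep a b n}) ⟨n, hx⟩)).symm

theorem solution_fst_of_mem_heads {x : Space Γ} (hx : ∃ n, b • x ∉ deep a b n)
    (h : x ∈ heads Γ) : (solution a b α β ω (b • x)).1 = α := by
  obtain ⟨n, hn⟩ := hx
  rw [← approxSolution_eq_of_notMem_deep a b α β ω n.le_succ hn |>.trans
    (solution_eq a b α β ω hn).symm]
  simp [approxSolution, h]

theorem solution_snd_of_notMem_heads {x : Space Γ} (hx : ∃ n, a • x ∉ deep a b n)
    (h : x ∉ heads Γ) : (solution a b α β ω (a • x)).2 = β := by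
  obtain ⟨n, hn⟩ := hx
  rw [← approxSolution_eq_of_notMem_deep a b α β ω n.le_succ hn |>.trans
    (solution_eq a b α β ω hn).symm]
  simp [approxSolution, h]

/-- Each x carries one equation, in the unknowns A(bx) and B(ax). Heads fixes A(bx) = α and solves
for B(ax); tails fixes B(ax) = β and solves for A(bx). Distinct x involve distinct unknowns, so
there is no conflict. -/
theorem solution_spec {x : Space Γ} (hx : ∀ g : Γ, ∃ n, g • x ∉ deep a b n) :
    (solution a b α β ω (b • x)).1 * (solution a b α β ω x).2 =
      ω * (solution a b α β ω (a • x)).2 * (solution a b α β ω x).1 := by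
  obtain ⟨k, hk⟩ := hx 1
  rw [one_smul] at hk
  by_cases h : x ∈ heads Γ
  · obtain ⟨n, hn⟩ := hx a
    have h1 : (solution a b α β ω (a • x)).2 =
        ω⁻¹ * α * (solution a b α β ω x).2 * (solution a b α β ω x).1⁻¹ := by
      rw [solution_eq a b α β ω hn, solution_eq a b α β ω hk,
        -- Both values are compared at levels large enough for both points, n + k + 1 and n + k,
        -- which differ by one step of the recursion.
        ← approxSolution_eq_of_notMem_deep a b α β ω (show n ≤ n + k + 1 by omega) hn,
        ← approxSolution_eq_of_notMem_deep a b α β ω (show k ≤ n + k by omega) hk]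
      simp [approxSolution, h]
    rw [h1, solution_fst_of_mem_heads a b α β ω (hx b) h]
    group
  · obtain ⟨n, hn⟩ := hx b
    have h1 : (solution a b α β ω (b • x)).1 =
        ω * β * (solution a b α β ω x).1 * (solution a b α β ω x).2⁻¹ := by
      rw [solution_eq a b α β ω hn, solution_eq a b α β ω hk,
        ← approxSolution_eq_of_notMem_deep a b α β ω (show n ≤ n + k + 1 by omega) hn,
        ← approxSolution_eq_of_notMem_deep a b α β ω (show k ≤ n + k by omega) hk]
      simp [approxSolution, h]
    rw [h1, solution_snd_of_notMem_heads a b α β ω (hx a) h]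
    group

theorem measurableSet_deep' (n : ℕ) : MeasurableSet (deep a b n) :=
  coordSpace_le _ _ (measurableSet_deep a b n)

theorem measurable_depth : Measurable (depth a b) := by
  refine measurable_to_countable' fun n => ?_
  -- Points of infinite depth receive the value 0, the infimum of the empty set; they form the
  -- second term.
  have : depth a b ⁻¹' {n} = ((deep a b n)ᶜ ∩ ⋂ m ∈ Set.Iio n, deep a b m) ∪
      ({_x : Space Γ | n = 0} ∩ ⋂ m, deep a b m) := by
    ext x
    simp only [Set.mem_preimage, Set.mem_singleton_iff, Set.mem_union, Set.mem_inter_iff,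
      Set.mem_compl_iff, Set.mem_iInter, Set.mem_Iio, Set.mem_ofPred_eq]
    constructor
    · rintro rfl
      by_cases h : ∃ n, x ∉ deep a b n
      · exact Or.inl ⟨Nat.sInf_mem (s := {n | x ∉ deep a b n}) h, fun m hm => not_not.1 (Nat.notMem_of_lt_sInf hm)⟩
      · push Not at h
        exact Or.inr ⟨by simp [depth, h], h⟩
    · rintro (⟨h1, h2⟩ | ⟨rfl, h⟩)
      · exact le_antisymm (Nat.sInf_le h1)
          (le_csInf ⟨n, h1⟩ fun m hm => not_lt.1 fun hlt => hm (h2 m hlt))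
      · simp [depth, h]
  rw [this]
  have hd := measurableSet_deep' a b
  exact ((hd n).compl.inter (MeasurableSet.biInter (Set.to_countable _) fun m _ => hd m)).union
    ((MeasurableSet.const _).inter (MeasurableSet.iInter hd))

theorem measurable_solution [MeasurableSpace Δ] [DiscreteMeasurableSpace Δ] [Countable Δ] :
    Measurable (solution a b α β ω) := by
  have hsmul (g : Γ) : Measurable fun x : Space Γ => g • x := (measurePreserving_smul g).measurable
  have happrox : ∀ n, Measurable (approxSolution a b α β ω n) := by
    intro n
    induction n with
    | zero => exact measurable_const
    | succ n ih =>
      refine Measurable.prodMk ?_ ?_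
      · exact Measurable.ite (hsmul b⁻¹ measurableSet_heads) measurable_const
          ((measurable_of_countable fun q : Δ × Δ => ω * β * q.1 * q.2⁻¹).comp
            (ih.comp (hsmul b⁻¹)))
      · exact Measurable.ite (hsmul a⁻¹ measurableSet_heads)
          ((measurable_of_countable fun q : Δ × Δ => ω⁻¹ * α * q.2 * q.1⁻¹).comp
            (ih.comp (hsmul a⁻¹))) measurable_const
  exact (measurable_from_prod_countable_right (f := fun q : ℕ × Space Γ =>
    approxSolution a b α β ω q.1 q.2) happrox).comp
      ((measurable_depth a b).prodMk measurable_id)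

end Bernoulli

/-! ### Measure free-factors of free groups -/

theorem Monoid.CoprodI.countable {ι : Type*} {M : ι → Type*} [∀ i, Monoid (M i)] [Countable ι]
    [∀ i, Countable (M i)] : Countable (Monoid.CoprodI M) := by
  classical
  have : Countable (FreeMonoid (Σ i, M i)) := inferInstanceAs (Countable (List _))
  exact (Con.mk'_surjective (c := conGen (CoprodI.Rel M))).countable

/-- The whole group is a measure free-factor of itself. -/
theorem isMeasureFreeFactor_top {Γ : Type} [Group Γ] [Countable Γ] :
    IsMeasureFreeFactor (⊤ : Subgroup Γ) := by
  refine ⟨Bernoulli.Space Γ, inferInstance, inferInstance, Bernoulli.measure Γ, inferInstance,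
    inferInstance, Bernoulli.isFreePMPAction, ⊥, ?_, ?_, bot_le, ?_, ?_⟩
  · exact measurableSet_eq_fun measurable_fst measurable_snd
  · rintro x y ⟨g, hg⟩
    exact ⟨g, hg⟩
  · refine Filter.Eventually.of_forall fun x y => ?_
    rintro ⟨g, hg⟩
    exact (le_sup_left : MulAction.orbitRel (⊤ : Subgroup Γ) (Bernoulli.Space Γ) ≤ _)
      ⟨⟨g, trivial⟩, hg⟩
  · exact Filter.Eventually.of_forall fun x n u v _ h => ⟨0, Or.inr (h 0).2⟩

namespace Bernoulli

open Monoid (CoprodI)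

variable {S : Type} {s t : S}

/-- The two maps append a binary digit, which makes the submonoid they generate visibly free.
Invertibility over ℚ lets them extend to the free group. -/
theorem exists_perm_rat (hst : s ≠ t) : ∃ ρ : FreeGroup S →* Equiv.Perm ℚ,
    (∀ q, ρ (FreeGroup.of s) q = 2 * q) ∧ ∀ q, ρ (FreeGroup.of t) q = 2 * q + 1 := by
  classical
  refine ⟨FreeGroup.lift fun u => if u = s then Equiv.mulLeft₀ 2 two_ne_zero
    else (Equiv.mulLeft₀ 2 two_ne_zero).trans (Equiv.addRight 1), fun q => ?_, fun q => ?_⟩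
  · simp
  · simp [hst.symm]

end Bernoulli

open Monoid (CoprodI) in
open Bernoulli in
/-- In a free group with basis `S`, let `s` and `t` be elements of the basis, let `K` be a part of
the rest of the basis, and let `w` be a word in the remaining elements. Then the product of `w` and
of the commutator of `s` and `t`, together with `K`, generates a measure free-factor. -/
theorem isMeasureFreeFactor_closure_commutator_mul {S : Type} [Countable S] {s t : S}
    (hst : s ≠ t) {K : Set S} (hs : s ∉ K) (ht : t ∉ K) {w : FreeGroup S}
    (hw : w ∈ Subgroup.closure (FreeGroup.of '' {u | u ≠ s ∧ u ≠ t ∧ u ∉ K})) :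
    IsMeasureFreeFactor (Subgroup.closure
      (insert (FreeGroup.of s * FreeGroup.of t * (FreeGroup.of s)⁻¹ * (FreeGroup.of t)⁻¹ * w) (FreeGroup.of '' K))) := by
  classical
  set a := FreeGroup.of s with ha
  set b := FreeGroup.of t with hb
  set W := a * b * a⁻¹ * b⁻¹ * w with hW
  set Λ := Subgroup.closure (insert W (FreeGroup.of '' K)) with hΛ
  have : Countable (FreeGroup S) := inferInstanceAs (Countable (Quot _))
  let Δ := CoprodI fun _ : Bool => FreeGroup S
  have : Countable Δ := CoprodI.countable
  let _ : MeasurableSpace Δ := ⊤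
  let inl : FreeGroup S →* Δ := CoprodI.of (M := fun _ : Bool => FreeGroup S) (i := true)
  let inr : FreeGroup S →* Δ := CoprodI.of (M := fun _ : Bool => FreeGroup S) (i := false)
  -- Since W w⁻¹ba = ab, this is the factor that σ(ab, x) must have over σ(ba, x) if σ is inl on W
  -- and inr on w.
  let ω : Δ := inl W * inr w⁻¹
  let c : S → Space (FreeGroup S) → Δ := fun u x =>
    if u = s then (solution a b (inr a) (inr b) ω x).1
    else if u = t then (solution a b (inr a) (inr b) ω x).2
    else if u ∈ K then inl (FreeGroup.of u) else inr (FreeGroup.of u)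
  obtain ⟨σ, hσ, hσc⟩ := FreeGroup.exists_cocycle c
  have hca : ∀ x, σ a x = (solution a b (inr a) (inr b) ω x).1 := fun x =>
    (hσc s x).trans (if_pos rfl)
  have hcb : ∀ x, σ b x = (solution a b (inr a) (inr b) ω x).2 := fun x =>
    (hσc t x).trans ((if_neg hst.symm).trans (if_pos rfl))
  have hsmul (g : FreeGroup S) : Measurable fun x : Space (FreeGroup S) => g • x :=
    (Bernoulli.measurePreserving_smul g).measurable
  let Y : Set (Space (FreeGroup S)) := {x | ∀ g : FreeGroup S, ∃ n, g • x ∉ deep a b n}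
  have hY : ∀ g : FreeGroup S, ∀ x ∈ Y, g • x ∈ Y := fun g x hx g' => by
    rw [← mul_smul]; exact hx _
  have hYae : ∀ᵐ x ∂measure (FreeGroup S), x ∈ Y := by
    obtain ⟨ρ, h1, h2⟩ := exists_perm_rat hst
    exact ae_exists_notMem_deep a b ρ h1 h2
  have hσw : ∀ g ∈ Subgroup.closure (FreeGroup.of '' {u | u ≠ s ∧ u ≠ t ∧ u ∉ K}),
      ∀ x, σ g x = inr g := fun g hg x => by
    refine cocycle_eq_of_mem_closure hσ inr (Y := Set.univ) (fun _ _ _ => trivial) ?_ hg trivial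
    rintro _ ⟨u, ⟨h1, h2, h3⟩, rfl⟩ x -
    rw [hσc]
    simp [c, h1, h2, h3]
  have hσΛ : ∀ g ∈ Λ, ∀ x ∈ Y, σ g x = inl g := fun g hg x hx => by
    refine cocycle_eq_of_mem_closure hσ inl hY ?_ hg hx
    rintro _ (rfl | ⟨u, hu, rfl⟩) x hx
    -- Writing x = w⁻¹ba • y turns the value of σ at W w⁻¹ba into σ(ab, y). The equation solved by A
    -- and B then leaves σ(W, x) = inl W after cancellation.
    · obtain ⟨y, rfl⟩ : ∃ y, x = (w⁻¹ * b * a) • y :=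
        ⟨(w⁻¹ * b * a)⁻¹ • x, (smul_inv_smul _ _).symm⟩
      have hy : y ∈ Y := by
        have := hY (w⁻¹ * b * a)⁻¹ _ hx
        rwa [inv_smul_smul] at this
      have e1 : σ (W * (w⁻¹ * b * a)) y = σ (a * b) y := by
        congr 1; rw [hW]; group
      have e2 := solution_spec a b (inr a) (inr b) ω hy
      rw [← hca, ← hca, ← hcb, ← hcb] at e2
      rw [hσ W, hσ (w⁻¹ * b), hσ w⁻¹ b, hσ a b, hσw _ (inv_mem hw), e2] at e1
      simp only [ω, mul_assoc] at e1
      simpa only [← mul_assoc, mul_left_inj] using e1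
    · rw [hσc]
      have h1 : u ≠ s := fun h => hs (h ▸ hu)
      have h2 : u ≠ t := fun h => ht (h ▸ hu)
      simp [c, h1, h2, hu]
  -- The complementary relation: pairs of an orbit on which the cocycle is the second inclusion.
  let R₂ : Setoid (Space (FreeGroup S)) := cocycleSetoid hσ inr
  let R₁ : Setoid (Space (FreeGroup S)) := MulAction.orbitRel Λ (Space (FreeGroup S))
  have hR₁ : ∀ g ∈ Λ, ∀ x, (R₁ ⊔ R₂) x (g • x) := fun g hg x =>
    (R₁ ⊔ R₂).symm ((le_sup_left : R₁ ≤ R₁ ⊔ R₂) ⟨⟨g, hg⟩, rfl⟩)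
  have hR₂ : ∀ g x, σ g x = inr g → (R₁ ⊔ R₂) x (g • x) := fun g x h =>
    (le_sup_right : R₂ ≤ R₁ ⊔ R₂) ⟨g, rfl, h⟩
  -- The square with corner x closes up in the generated relation: w⁻¹ moves inside R₂ and W inside
  -- R₁.
  have hsquare : ∀ x, (R₁ ⊔ R₂) (b • a • x) (a • b • x) := fun x => by
    have h1 := hR₂ w⁻¹ (b • a • x) (hσw _ (inv_mem hw) _)
    have h2 := hR₁ W (Subgroup.subset_closure (Set.mem_insert _ _)) (w⁻¹ • b • a • x)
    have e : W • w⁻¹ • b • a • x = a • b • x := by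
      simp only [← mul_smul]; congr 1; rw [hW]; group
    rw [e] at h2
    exact (R₁ ⊔ R₂).trans h1 h2
  -- Induction on the depth. A side imposed by the coin lies in R₂. The opposite one is obtained by
  -- going around the square at the preimage y, whose two sides from y are known because y has
  -- smaller depth.
  have hab : ∀ n, ∀ x ∈ Y, x ∉ deep a b n →
      (R₁ ⊔ R₂) x (a • x) ∧ (R₁ ⊔ R₂) x (b • x) := by
    intro n
    induction n with
    | zero => exact fun x _ h => absurd (Set.mem_univ x) h
    | succ n ih =>
      intro x hx h
      simp only [deep, Set.mem_union, Set.mem_preimage, Set.mem_inter_iff, Set.mem_compl_iff,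
        not_or, not_and] at h
      constructor
      · obtain ⟨y, rfl⟩ : ∃ y, x = b • y := ⟨b⁻¹ • x, (smul_inv_smul _ _).symm⟩
        have hy : y ∈ Y := by simpa using hY b⁻¹ _ hx
        rw [inv_smul_smul] at h
        by_cases hh : y ∈ heads (FreeGroup S)
        · refine hR₂ _ _ ?_
          rw [hca]
          exact solution_fst_of_mem_heads a b _ _ _ (hy b) hh
        · obtain ⟨h1, h2⟩ := ih y hy (h.2 hh)
          have h3 : (R₁ ⊔ R₂) (a • y) (b • a • y) := by
            refine hR₂ _ _ ?_
            rw [hcb]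
            exact solution_snd_of_notMem_heads a b _ _ _ (hy a) hh
          exact (R₁ ⊔ R₂).trans ((R₁ ⊔ R₂).symm h2)
            ((R₁ ⊔ R₂).trans h1 ((R₁ ⊔ R₂).trans h3 (hsquare y)))
      · obtain ⟨y, rfl⟩ : ∃ y, x = a • y := ⟨a⁻¹ • x, (smul_inv_smul _ _).symm⟩
        have hy : y ∈ Y := by simpa using hY a⁻¹ _ hx
        rw [inv_smul_smul] at h
        by_cases hh : y ∈ heads (FreeGroup S)
        · obtain ⟨h1, h2⟩ := ih y hy (h.1 hh)
          have h3 : (R₁ ⊔ R₂) (b • y) (a • b • y) := by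
            refine hR₂ _ _ ?_
            rw [hca]
            exact solution_fst_of_mem_heads a b _ _ _ (hy b) hh
          exact (R₁ ⊔ R₂).trans ((R₁ ⊔ R₂).symm h1)
            ((R₁ ⊔ R₂).trans h2 ((R₁ ⊔ R₂).trans h3 ((R₁ ⊔ R₂).symm (hsquare y))))
        · refine hR₂ _ _ ?_
          rw [hcb]
          exact solution_snd_of_notMem_heads a b _ _ _ (hy a) hh
  have hgen : ∀ g : FreeGroup S, ∀ x ∈ Y, (R₁ ⊔ R₂) x (g • x) := by
    intro g
    have hof : ∀ u : S, ∀ x ∈ Y, (R₁ ⊔ R₂) x (FreeGroup.of u • x) := by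
      intro u x hx
      obtain ⟨n, hn⟩ := hx 1
      rw [one_smul] at hn
      by_cases h1 : u = s
      · exact h1 ▸ (hab n x hx hn).1
      by_cases h2 : u = t
      · exact h2 ▸ (hab n x hx hn).2
      by_cases h3 : u ∈ K
      · exact hR₁ _ (Subgroup.subset_closure (Set.mem_insert_of_mem _ ⟨u, h3, rfl⟩)) x
      · exact hR₂ _ _ (hσw _ (Subgroup.subset_closure ⟨u, ⟨h1, h2, h3⟩, rfl⟩) x)
    induction g using FreeGroup.induction_on with
    | C1 => exact fun x _ => by rw [one_smul]
    | of u => exact hof u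
    | inv_of u _ =>
      intro x hx
      simpa using (R₁ ⊔ R₂).symm (hof u _ (hY (FreeGroup.of u)⁻¹ x hx))
    | mul g h ihg ihh =>
      intro x hx
      rw [mul_smul]
      exact (R₁ ⊔ R₂).trans (ihh x hx) (ihg _ (hY h x hx))
  have hσm : ∀ g, Measurable (σ g) := by
    intro g
    refine measurable_cocycle_of_closure hσ hsmul (T := Set.range FreeGroup.of) ?_
      (by rw [FreeGroup.closure_range_of]; trivial)
    rintro _ ⟨u, rfl⟩
    rw [funext (hσc u)]
    have hm := measurable_solution a b (inr a) (inr b) ω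
    simp only [c]
    split_ifs
    exacts [measurable_fst.comp hm, measurable_snd.comp hm, measurable_const, measurable_const]
  refine ⟨Space (FreeGroup S), inferInstance, inferInstance, measure (FreeGroup S), inferInstance,
    inferInstance, isFreePMPAction, R₂, measurableSet_cocycleSetoid hσ hsmul hσm inr, ?_, ?_, ?_,
    ?_⟩
  · rintro x y ⟨g, hg⟩
    exact ⟨g, hg⟩
  · rintro x y ⟨g, hg, -⟩
    exact ⟨g⁻¹, by simp [← hg]⟩
  · filter_upwards [hYae] with x hx y
    rintro ⟨g, rfl⟩
    simpa using hgen g⁻¹ (g • y) hx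
  · filter_upwards [hYae, (isFreePMPAction (Γ := FreeGroup S)).2] with x hx hfree n u v hu h
    -- The cocycle is inl on Λ only over the invariant set Y, so the whole sequence must stay there.
    have hxu : ∀ i, u i ∈ Y := by
      have hstep : ∀ i, u i ∈ Y → u (i + 1) ∈ Y := by
        intro i hi
        obtain ⟨⟨⟨g, hg⟩, h1⟩, ⟨k, h2, -⟩⟩ := h i
        have h1' : g • v i = u i := h1
        have h3 : v i = g⁻¹ • u i := by rw [← h1', inv_smul_smul]
        rw [← h2, h3]
        exact hY _ _ (hY _ _ hi)
      intro i
      induction i using Fin.induction with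
      | zero => exact hu ▸ hx
      | succ i ih => simpa using hstep _ ih
    refine exists_eq_of_cyclic hσ hfree n u v hu fun i => ⟨?_, (h i).2⟩
    obtain ⟨⟨g, hg⟩, h1⟩ := (h i).1
    have h1' : g • v i = u i := h1
    exact ⟨g⁻¹, by rw [← h1', inv_smul_smul], hσΛ _ (inv_mem hg) _ (hxu i)⟩

theorem IsMeasureFreeFactor.map {Γ Γ' : Type*} [Group Γ] [Group Γ'] {Λ : Subgroup Γ}
    (h : IsMeasureFreeFactor Λ) (e : Γ ≃* Γ') : IsMeasureFreeFactor (Λ.map e.toMonoidHom) := by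
  obtain ⟨X, _, _, μ, _, _, ⟨h1, h2⟩, S, hS, h3, h4, h5, h6⟩ := h
  let _ : MulAction Γ' X := MulAction.compHom X e.symm.toMonoidHom
  have hΓ : MulAction.orbitRel Γ' X = MulAction.orbitRel Γ X := by
    ext x y
    constructor
    · rintro ⟨g, rfl⟩
      exact ⟨e.symm g, rfl⟩
    · rintro ⟨g, rfl⟩
      exact ⟨e g, congrArg (· • y) (e.symm_apply_apply g)⟩
  have hΛ : MulAction.orbitRel (Λ.map e.toMonoidHom) X = MulAction.orbitRel Λ X := by
    ext x y
    constructor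
    · rintro ⟨⟨_, g, hg, rfl⟩, rfl⟩
      exact ⟨⟨g, hg⟩, congrArg (· • y) (e.symm_apply_apply g).symm⟩
    · rintro ⟨⟨g, hg⟩, rfl⟩
      exact ⟨⟨e g, g, hg, rfl⟩, congrArg (· • y) (e.symm_apply_apply g)⟩
  refine ⟨X, inferInstance, inferInstance, μ, inferInstance, inferInstance,
    ⟨fun g => h1 (e.symm g), ?_⟩, S, hS, ?_⟩
  · filter_upwards [h2] with x hx g hg
    exact e.symm.map_eq_one_iff.1 (hx _ hg)
  · rw [hΓ, hΛ]
    exact ⟨h3, h4, h5, h6⟩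

/-! ### The fundamental group of a surface with boundary, algebraically -/

/-- The free basis of the fundamental group of the surface of genus `p` with `n + 1` boundary
components: the handles, and the boundary components but the last one. -/
abbrev SurfaceBasis (p n : ℕ) : Type := (Fin p × Bool) ⊕ Fin n

namespace SurfaceBasis

open FreeGroup (of)

variable {p n : ℕ}

/-- The product of commutators that corresponds to the handles. -/
def handleWord {G : Type*} [Group G] (f : Fin p × Bool → G) : G :=
  (List.ofFn fun i : Fin p => f (i, false) * f (i, true) * (f (i, false))⁻¹ * (f (i, true))⁻¹).prod

theorem map_handleWord {G G' : Type*} [Group G] [Group G'] (φ : G →* G')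
    (f : Fin p × Bool → G) : φ (handleWord f) = handleWord (φ ∘ f) := by
  simp [handleWord, map_list_prod, List.map_ofFn, Function.comp_def]

/-- The words that correspond to the boundary components. -/
def boundaryWord (p n : ℕ) : Fin (n + 1) → FreeGroup (SurfaceBasis p n) :=
  Fin.snoc (α := fun _ => FreeGroup (SurfaceBasis p n)) (fun j => of (Sum.inr j))
    (handleWord (of ∘ Sum.inl) * (List.ofFn fun j : Fin n => of (Sum.inr j)).prod)⁻¹

theorem boundaryWord_castSucc (j : Fin n) : boundaryWord p n j.castSucc = of (Sum.inr j) :=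
  Fin.snoc_castSucc ..

theorem boundaryWord_last : boundaryWord p n (Fin.last n) =
    (handleWord (of ∘ Sum.inl) * (List.ofFn fun j : Fin n => of (Sum.inr j)).prod)⁻¹ :=
  Fin.snoc_last ..

/-- Every element of a group becomes a commutator in a larger group. -/
theorem exists_commutator (G : Type*) [Group G] (t : G) :
    ∃ (ι : G →* Equiv.Perm (G × ℤ)) (f s : Equiv.Perm (G × ℤ)),
      Function.Injective ι ∧ f * s * f⁻¹ * s⁻¹ = ι t := by
  let ι : G →* Equiv.Perm (G × ℤ) := MonoidHom.mk'
    (fun g => (Equiv.mulLeft g).prodCongr (Equiv.refl ℤ)) fun g h => by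
      ext q <;> simp [mul_assoc]
  -- On level m, f multiplies by t^m, and s shifts the level by one. Passing s through f costs one
  -- factor t on every level.
  let f : Equiv.Perm (G × ℤ) :=
    { toFun := fun q => (t ^ q.2 * q.1, q.2)
      invFun := fun q => ((t ^ q.2)⁻¹ * q.1, q.2)
      left_inv := fun q => by simp
      right_inv := fun q => by simp }
  let s : Equiv.Perm (G × ℤ) := (Equiv.refl G).prodCongr (Equiv.addRight 1)
  refine ⟨ι, f, s, fun g h e => ?_, mul_inv_eq_of_eq_mul (mul_inv_eq_of_eq_mul ?_)⟩
  · simpa [ι] using congrArg Prod.fst (Equiv.congr_fun e (1, 0))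
  · refine Equiv.ext fun q => Prod.ext ?_ rfl
    simp only [f, s, ι, Equiv.Perm.mul_apply, Equiv.coe_fn_mk, Equiv.prodCongr_apply, Prod.map,
      Equiv.coe_addRight, Equiv.refl_apply, MonoidHom.mk'_apply, Equiv.coe_mulLeft]
    rw [zpow_add_one, ← mul_assoc, (Commute.self_zpow t q.2).eq]

/-- A left inverse up to an injection ι: send the first handle to f, s, the other handles to 1 and
the j-th boundary generator to ι(x_j). The element made into a commutator is chosen so that the last
boundary word goes to ι of the last generator. -/
theorem lift_boundaryWord_injective (hp : 1 ≤ p) :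
    Function.Injective (FreeGroup.lift (boundaryWord p n)) := by
  obtain ⟨p, rfl⟩ : ∃ k, p = k + 1 := ⟨p - 1, by omega⟩
  set P : FreeGroup (Fin (n + 1)) := (List.ofFn fun j : Fin n => of j.castSucc).prod with hP
  obtain ⟨ι, f, s, hι, hfs⟩ := exists_commutator (FreeGroup (Fin (n + 1)))
    ((of (Fin.last n))⁻¹ * P⁻¹)
  let F : Fin (p + 1) × Bool → Equiv.Perm (FreeGroup (Fin (n + 1)) × ℤ) := fun q =>
    if q.1 = 0 then bif q.2 then s else f else 1
  have hF : handleWord F = ι ((of (Fin.last n))⁻¹ * P⁻¹) := by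
    rw [handleWord, List.ofFn_succ, List.prod_cons, ← hfs]
    simp [F]
  let φ : FreeGroup (SurfaceBasis (p + 1) n) →* Equiv.Perm (FreeGroup (Fin (n + 1)) × ℤ) :=
    FreeGroup.lift (Sum.elim F fun j => ι (of j.castSucc))
  have key : φ.comp (FreeGroup.lift (boundaryWord (p + 1) n)) = ι := by
    refine FreeGroup.ext_hom _ _ fun j => ?_
    rw [MonoidHom.comp_apply, FreeGroup.lift_apply_of]
    induction j using Fin.lastCases with
    | last =>
      have h1 : φ ∘ of ∘ Sum.inl = F := by ext1 q; simp [φ]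
      have h2 : φ (List.ofFn fun j : Fin n => of (Sum.inr j)).prod = ι P := by
        rw [hP, map_list_prod, map_list_prod, List.map_ofFn, List.map_ofFn]
        congr 2
      rw [boundaryWord_last, _root_.map_inv, _root_.map_mul, map_handleWord, h1, h2, hF,
        ← _root_.map_mul, ← _root_.map_inv]
      simp
    | cast j => rw [boundaryWord_castSucc]; simp [φ]
  have : Function.Injective (φ.comp (FreeGroup.lift (boundaryWord (p + 1) n))) := key ▸ hι
  exact Function.Injective.of_comp (f := φ) this

/-- The last boundary word is the inverse of the handle word times the product of the other ones, so
it can be traded for the handle word. -/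
theorem closure_range_boundaryWord :
    Subgroup.closure (Set.range (boundaryWord p n)) =
      Subgroup.closure (insert (handleWord (of ∘ Sum.inl)) (of '' Set.range Sum.inr)) := by
  set P : FreeGroup (SurfaceBasis p n) := (List.ofFn fun j : Fin n => of (Sum.inr j)).prod with hP
  have hPmem : ∀ H : Subgroup (FreeGroup (SurfaceBasis p n)),
      (∀ j : Fin n, of (Sum.inr j) ∈ H) → P ∈ H := fun H hH =>
    list_prod_mem (by simpa using hH)
  apply le_antisymm <;> rw [Subgroup.closure_le]
  · rintro _ ⟨j, rfl⟩
    have hj : ∀ j : Fin n, of (Sum.inr j) ∈ Subgroup.closure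
        (insert (handleWord (of ∘ Sum.inl)) (of '' Set.range (Sum.inr : Fin n → SurfaceBasis p n))) :=
      fun j => Subgroup.subset_closure (Set.mem_insert_of_mem _ ⟨_, ⟨j, rfl⟩, rfl⟩)
    induction j using Fin.lastCases with
    | last =>
      rw [boundaryWord_last]
      exact inv_mem (mul_mem (Subgroup.subset_closure (Set.mem_insert _ _)) (hPmem _ hj))
    | cast j =>
      rw [boundaryWord_castSucc]
      exact hj j
  · have hj : ∀ j : Fin n, of (Sum.inr j) ∈ Subgroup.closure (Set.range (boundaryWord p n)) :=
      fun j => Subgroup.subset_closure ⟨j.castSucc, boundaryWord_castSucc j⟩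
    rintro _ (rfl | ⟨_, ⟨j, rfl⟩, rfl⟩)
    · have h := inv_mem (Subgroup.subset_closure (k := Set.range (boundaryWord p n))
        ⟨Fin.last n, rfl⟩)
      rw [boundaryWord_last, inv_inv] at h
      exact (Subgroup.mul_mem_cancel_right _ (hPmem _ hj)).1 h
    · exact hj j

/-- Without handles the boundary generators are the whole basis. Otherwise the first handle is the
commutator, the other handles form w, and the boundary generators form K. -/
theorem isMeasureFreeFactor_closure_boundaryWord :
    IsMeasureFreeFactor (Subgroup.closure (Set.range (boundaryWord p n))) := by
  rw [closure_range_boundaryWord]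
  rcases p with - | p
  · have h : Subgroup.closure (insert (handleWord (of ∘ Sum.inl)) (of '' Set.range Sum.inr)) =
        (⊤ : Subgroup (FreeGroup (SurfaceBasis 0 n))) := by
      rw [eq_top_iff, ← FreeGroup.closure_range_of]
      refine Subgroup.closure_mono ?_
      rintro _ ⟨⟨⟨i, -⟩⟩ | j, rfl⟩
      · exact i.elim0
      · exact Set.mem_insert_of_mem _ ⟨_, ⟨j, rfl⟩, rfl⟩
    have : Countable (FreeGroup (SurfaceBasis 0 n)) := inferInstanceAs (Countable (Quot _))
    rw [h]
    exact isMeasureFreeFactor_top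
  · rw [handleWord, List.ofFn_succ, List.prod_cons]
    refine isMeasureFreeFactor_closure_commutator_mul (by simp) (by simp) (by simp) ?_
    refine list_prod_mem fun x hx => ?_
    obtain ⟨i, rfl⟩ := List.mem_ofFn.1 hx
    have h : ∀ ε : Bool, of (Sum.inl (i.succ, ε)) ∈ Subgroup.closure
        (of '' {u : SurfaceBasis (p + 1) n | u ≠ Sum.inl (0, false) ∧ u ≠ Sum.inl (0, true) ∧
          u ∉ Set.range Sum.inr}) := fun ε =>
      Subgroup.subset_closure ⟨_, by simp, rfl⟩
    exact mul_mem (mul_mem (mul_mem (h _) (h _)) (inv_mem (h _))) (inv_mem (h _))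

end SurfaceBasis

/-! ### Homotopy classes of paths -/

namespace Path.Homotopic.Quotient

variable {X Y : Type*} [TopologicalSpace X] [TopologicalSpace Y]

/-- To prove a property of all homotopy classes of paths it is enough to prove that it is stable
under concatenation and that it holds for the paths that are small with respect to an open cover. -/
theorem induction_of_open_cover {ι : Type*} {U : ι → Set X} (hU : ∀ i, IsOpen (U i))
    (hcover : ∀ x, ∃ i, x ∈ U i) {P : ∀ {x y : X}, Path.Homotopic.Quotient x y → Prop}
    (htrans : ∀ {x y z : X} (p : Path.Homotopic.Quotient x y) (q : Path.Homotopic.Quotient y z),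
      P p → P q → P (p.trans q))
    (hsmall : ∀ (i : ι) {x y : X} (p : Path x y), (∀ t, p t ∈ U i) → P (mk p))
    {x y : X} (q : Path.Homotopic.Quotient x y) : P q := by
  induction q with | mk p => ?_
  obtain ⟨t, h0, hmono, ⟨n, hn⟩, ht⟩ := exists_monotone_Icc_subset_open_cover_unitInterval
    (c := fun i => p ⁻¹' U i) (fun i => (hU i).preimage p.continuous)
    (fun s _ => by simpa using hcover (p s))
  have hsub : ∀ m, P (mk (p.subpath (t m) (t (m + 1)))) := fun m => by
    obtain ⟨i, hi⟩ := ht m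
    refine hsmall i _ fun s => ?_
    have : p.subpath (t m) (t (m + 1)) s ∈ Set.range (p.subpath (t m) (t (m + 1))) := ⟨s, rfl⟩
    rw [Path.range_subpath, Set.uIcc_of_le (hmono m.le_succ)] at this
    obtain ⟨s', hs', e⟩ := this
    rw [← e]
    exact hi hs'
  have key : ∀ m, P (mk (p.subpath (t 0) (t (m + 1)))) := by
    intro m
    induction m with
    | zero => exact hsub 0
    | succ m ih =>
      rw [← Path.Homotopic.Quotient.eq.2 ⟨Path.Homotopy.subpathTransSubpath p (t 0) (t (m + 1)) _⟩]
      exact htrans _ _ ih (hsub _)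
  have h1 := key n
  have h2 : ∀ s s' : unitInterval, s = 0 → s' = 1 → P (mk (p.subpath s s')) → P (mk p) := by
    rintro _ _ rfl rfl h
    have e : ∀ (a b : X) (ha : a = x) (hb : b = y) (q : Path a b), (∀ s, q s = p s) →
        P (mk q) → P (mk p) := by
      rintro a b rfl rfl q hq h
      rwa [show p = q from Path.ext (funext fun s => (hq s).symm)]
    refine e _ _ p.source p.target _ (fun s => ?_) h
    simp [Path.subpath]
  exact h2 _ _ h0 (hn _ n.le_succ) h1

/-- The line is simply connected. This is why segments of a curve may be defined through an
arbitrary path between two parameters, and why they ignore reparametrization. -/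
instance (s t : ℝ) : Subsingleton (Path.Homotopic.Quotient s t) := by
  refine ⟨fun p q => ?_⟩
  induction p with | mk p => ?_
  induction q with | mk q => ?_
  exact Path.Homotopic.Quotient.eq.2 (SimplyConnectedSpace.paths_homotopic p q)

/-- The homotopy class of the part of a curve between two values of the parameter. -/
noncomputable def seg (f : C(ℝ, X)) (s t : ℝ) : Path.Homotopic.Quotient (f s) (f t) :=
  (mk (PathConnectedSpace.somePath s t)).map f

theorem mk_map_eq_seg (f : C(ℝ, X)) {s t : ℝ} (p : Path s t) :
    mk (p.map f.continuous) = seg f s t := by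
  rw [mk_map, seg, Subsingleton.elim (mk p)]

theorem mk_eq_seg (f : C(ℝ, X)) {x y : X} (p : Path x y) (q : C(unitInterval, ℝ))
    (h : ∀ u, p u = f (q u)) : mk p = (seg f (q 0) (q 1)).cast
      (by rw [← h, p.source]) (by rw [← h, p.target]) := by
  have e := mk_map_eq_seg f (⟨q, rfl, rfl⟩ : Path (q 0) (q 1))
  rw [← e, ← mk_cast]
  exact congrArg mk (Path.ext (funext h))

theorem seg_trans (f : C(ℝ, X)) (s t u : ℝ) : (seg f s t).trans (seg f t u) = seg f s u := by
  rw [← mk_map_eq_seg f (PathConnectedSpace.somePath s t),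
    ← mk_map_eq_seg f (PathConnectedSpace.somePath t u), ← mk_trans, ← Path.map_trans,
    mk_map_eq_seg]

theorem seg_symm (f : C(ℝ, X)) (s t : ℝ) : (seg f s t).symm = seg f t s := by
  rw [← mk_map_eq_seg f (PathConnectedSpace.somePath s t), ← mk_symm, Path.map_symm,
    mk_map_eq_seg]

theorem map_seg (f : C(ℝ, X)) (g : C(X, Y)) (s t : ℝ) :
    (seg f s t).map g = seg (g.comp f) s t := by
  rw [seg, seg, map_comp]

/-- Reparametrization of a segment of a curve. -/
theorem seg_comp (f : C(ℝ, X)) (g : C(ℝ, ℝ)) (s t : ℝ) :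
    seg (f.comp g) s t = seg f (g s) (g t) := by
  rw [← map_seg, seg.eq_def f, Subsingleton.elim (seg g s t)]

/-- A segment only depends on the restriction of the curve to the interval of parameters. -/
theorem seg_congr {f g : C(ℝ, X)} {s t : ℝ} (h : ∀ u ∈ Set.uIcc s t, f u = g u) :
    seg f s t = (seg g s t).cast (h s Set.left_mem_uIcc) (h t Set.right_mem_uIcc) := by
  let p : Path s t :=
    { toFun := fun u => (1 - u.1) * s + u.1 * t
      source' := by simp
      target' := by simp }
  rw [← mk_map_eq_seg f p, ← mk_map_eq_seg g p, ← mk_cast]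
  refine congrArg mk (Path.ext (funext fun u => h _ ?_))
  have h1 : 0 ≤ u.1 := u.2.1
  have h2 : u.1 ≤ 1 := u.2.2
  change (1 - u.1) * s + u.1 * t ∈ _
  rw [← segment_eq_uIcc]
  exact ⟨1 - u.1, u.1, by linarith, h1, by ring, by simp⟩

theorem seg_const (x : X) (s t : ℝ) : seg (ContinuousMap.const ℝ x) s t = refl x := by
  rw [← mk_map_eq_seg _ (PathConnectedSpace.somePath s t)]
  rfl

theorem cast_trans_cast {x y z x' y' z' : X} (p : Path.Homotopic.Quotient x y)
    (q : Path.Homotopic.Quotient y z) (hx : x' = x) (hy : y' = y) (hz : z' = z) :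
    (p.cast hx hy).trans (q.cast hy hz) = (p.trans q).cast hx hz := by
  subst hx hy hz
  simp

theorem symm_cast {x y x' y' : X} (p : Path.Homotopic.Quotient x y) (hx : x' = x) (hy : y' = y) :
    (p.cast hx hy).symm = p.symm.cast hy hx := by
  subst hx hy
  simp

theorem cast_refl {x x' : X} (hx : x' = x) (hx' : x' = x) :
    (refl x).cast hx hx' = refl x' := by
  subst hx
  simp

theorem cast_seg_eq_refl {f : C(ℝ, X)} {s t : ℝ} {x : X} (h : ∀ u ∈ Set.uIcc s t, f u = x)
    (hs : x = f s) (ht : x = f t) : (seg f s t).cast hs ht = refl x := by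
  rw [seg_congr (g := ContinuousMap.const ℝ x) h, seg_const]
  simp

theorem map_trans (f : C(X, Y)) {x y z : X} (p : Path.Homotopic.Quotient x y)
    (q : Path.Homotopic.Quotient y z) : (p.trans q).map f = (p.map f).trans (q.map f) := by
  induction p with | mk p => ?_
  induction q with | mk q => ?_
  exact congrArg mk (Path.map_trans p q f.continuous)

theorem symm_trans_eq {x y z : X} (p : Path.Homotopic.Quotient x y)
    (q : Path.Homotopic.Quotient y z) : (p.trans q).symm = q.symm.trans p.symm := by
  induction p with | mk p => ?_
  induction q with | mk q => ?_
  exact congrArg mk (Path.trans_symm p q)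

/-- The track of a point under a homotopy. -/
noncomputable def track (K : C(X × ℝ, Y)) (x : X) :
    Path.Homotopic.Quotient (K (x, 0)) (K (x, 1)) :=
  (prod (refl x) (mk (PathConnectedSpace.somePath 0 1))).map K

theorem track_eq_seg (K : C(X × ℝ, Y)) (x : X) (f : C(ℝ, Y)) (g : C(ℝ, ℝ))
    (h : ∀ u, K (x, u) = f (g u)) :
    track K x = (seg f (g 0) (g 1)).cast (h 0) (h 1) := by
  rw [← seg_comp, ← mk_map_eq_seg _ (PathConnectedSpace.somePath 0 1), ← mk_cast]
  exact congrArg mk (Path.ext (funext fun t => h _))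

/-- A homotopy is natural along every path. -/
theorem map_trans_track (K : C(X × ℝ, Y)) {x y : X} (q : Path.Homotopic.Quotient x y) :
    ((prod q (refl 0)).map K).trans (track K y) =
      (track K x).trans ((prod q (refl 1)).map K) := by
  rw [track, track, ← map_trans, ← map_trans, comp_prod_eq_prod_comp, comp_prod_eq_prod_comp]
  simp

/-- A path is homotopic to the one given by the tracks of its end points under a homotopy
that ends with a constant map. -/
theorem eq_of_homotopy (K : C(X × ℝ, X)) (h0 : ∀ z, K (z, 0) = z) {x y b : X} (p : Path x y)
    (h1 : ∀ t, K (p t, 1) = b) (hx : b = K (x, 1)) (hy : b = K (y, 1)) :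
    mk p = ((track K x).cast (h0 x).symm hx).trans ((track K y).cast (h0 y).symm hy).symm := by
  have h := map_trans_track K (mk p)
  have e0 : ((prod (mk p) (refl 0)).map K).cast (h0 x).symm (h0 y).symm = mk p :=
    congrArg mk (Path.ext (funext fun t => h0 (p t)))
  have e1 : ((prod (mk p) (refl 1)).map K).cast hx hy = refl b :=
    congrArg mk (Path.ext (funext fun t => h1 t))
  have h2 := congrArg (fun q => q.cast (h0 x).symm hy) h
  rw [← cast_trans_cast _ _ _ (h0 y).symm, ← cast_trans_cast _ _ _ hx, e0, e1, trans_refl] at h2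
  rw [← h2, trans_assoc, trans_symm, trans_refl]

end Path.Homotopic.Quotient

/-! ### The fundamental group of a wedge of circles -/

/-- The indices of the lines that form a wedge of circles: `none` is collapsed to the base point. -/
def Petal (S : Type*) : Type _ := Option S

namespace Petal

/-- The product with ℝ is then a disjoint union of lines. The extra index provides a base point even
when there is no circle. -/
instance (S : Type*) : TopologicalSpace (Petal S) := ⊥

instance (S : Type*) : DiscreteTopology (Petal S) := ⟨rfl⟩

end Petal

namespace Wedge

open Path.Homotopic.Quotient

variable (S : Type*)

/-- The part of the family of lines that is collapsed to the base point. -/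
def collapsed : Set (Petal S × ℝ) := {q | q.1 = (none : Option S) ∨ q.2 ≤ 0 ∨ 1 ≤ q.2}

/-- The identification of all the points of the collapsed part. -/
def setoid : Setoid (Petal S × ℝ) where
  r x y := x = y ∨ (x ∈ collapsed S ∧ y ∈ collapsed S)
  iseqv :=
    { refl := fun x => Or.inl rfl
      symm := by
        rintro x y (h | h)
        exacts [Or.inl h.symm, Or.inr h.symm]
      trans := by
        rintro x y z (rfl | h) (rfl | h')
        exacts [Or.inl rfl, Or.inr h', Or.inr h, Or.inr ⟨h.1, h'.2⟩] }

end Wedge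

/-- The wedge of a family of circles, obtained from a family of lines by collapsing the complement
of the intervals `(0, 1)`. -/
def Wedge (S : Type*) : Type _ := Quotient (Wedge.setoid S)

namespace Wedge

open Path.Homotopic.Quotient

variable {S : Type*}

instance : TopologicalSpace (Wedge S) := inferInstanceAs (TopologicalSpace (Quotient _))

/-- The projection from the family of lines to the wedge of circles. -/
def proj (q : Petal S × ℝ) : Wedge S := Quotient.mk _ q

theorem isQuotientMap_proj : Topology.IsQuotientMap (proj : Petal S × ℝ → Wedge S) :=
  isQuotientMap_quotient_mk'

theorem continuous_proj : Continuous (proj : Petal S × ℝ → Wedge S) :=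
  isQuotientMap_proj.continuous

theorem proj_surjective : Function.Surjective (proj : Petal S × ℝ → Wedge S) :=
  isQuotientMap_proj.surjective

theorem proj_eq_proj {q q' : Petal S × ℝ} :
    proj q = proj q' ↔ q = q' ∨ (q ∈ collapsed S ∧ q' ∈ collapsed S) :=
  Quotient.eq (r := setoid S)

variable (S) in
/-- The base point of a wedge of circles. -/
def base : Wedge S := proj ((none : Option S), 0)

theorem proj_eq_base {q : Petal S × ℝ} : proj q = base S ↔ q ∈ collapsed S := by
  rw [base, proj_eq_proj]
  constructor
  · rintro (rfl | h)
    exacts [Or.inl rfl, h.1]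
  · exact fun h => Or.inr ⟨h, Or.inl rfl⟩

/-- The line that wraps once around a circle. -/
def line (o : Petal S) : C(ℝ, Wedge S) :=
  ⟨fun t => proj (o, t), continuous_proj.comp (by fun_prop)⟩

/-- The circle with index `s`. -/
def circle (s : S) : C(ℝ, Wedge S) := line (some s : Option S)

theorem circle_eq_base {s : S} {t : ℝ} : circle s t = base S ↔ t ≤ 0 ∨ 1 ≤ t := by
  refine (proj_eq_base (q := ((some s : Option S), t))).trans ?_
  simp [collapsed]

theorem circle_inj {s s' : S} {t t' : ℝ} (h : circle s t = circle s' t') (h0 : 0 < t)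
    (h1 : t < 1) : s = s' ∧ t = t' := by
  rcases (proj_eq_proj (q := ((some s : Option S), t)) (q' := ((some s' : Option S), t'))).1 h with
    e | ⟨h2, -⟩
  · exact ⟨Option.some.inj (congrArg Prod.fst e), congrArg Prod.snd e⟩
  · have := circle_eq_base.1 (proj_eq_base.2 h2 : circle s t = base S)
    rcases this with h | h <;> linarith

theorem eq_base_or_eq_circle (x : Wedge S) :
    x = base S ∨ ∃ s t, 0 < t ∧ t < 1 ∧ x = circle s t := by
  obtain ⟨⟨o, t⟩, rfl⟩ := proj_surjective x
  rcases o with - | s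
  · exact Or.inl (proj_eq_base.2 (Or.inl rfl))
  · by_cases h : circle s t = base S
    · exact Or.inl h
    · refine Or.inr ⟨s, t, ?_, ?_, rfl⟩ <;> rw [circle_eq_base] at h <;> push Not at h
      exacts [h.1, h.2]

variable (S) in
theorem circle_zero (s : S) : circle s 0 = base S := circle_eq_base.2 (Or.inl le_rfl)

theorem circle_one (s : S) : circle s 1 = base S := circle_eq_base.2 (Or.inr le_rfl)

/-- The class of the loop that wraps once around a circle. -/
noncomputable def petal (s : S) : FundamentalGroup (Wedge S) (base S) :=
  FundamentalGroup.fromPath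
    ((seg (circle s) 0 1).cast (circle_zero S s).symm (circle_one s).symm)

theorem isOpen_circle_image {U : Set ℝ} (hU : IsOpen U) (h : U ⊆ Set.Ioo 0 1) (T : Set S) :
    IsOpen {x : Wedge S | ∃ s ∈ T, ∃ t ∈ U, x = circle s t} := by
  rw [← isQuotientMap_proj.isOpen_preimage]
  have e : proj ⁻¹' {x : Wedge S | ∃ s ∈ T, ∃ t ∈ U, x = circle s t} =
      {o : Petal S | ∃ s ∈ T, o = (some s : Option S)} ×ˢ U := by
    ext ⟨o, t⟩
    constructor
    · rintro ⟨s, hs, t', ht', e⟩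
      have h1 : circle s t' = proj (o, t) := e.symm
      rcases proj_eq_proj.1 h1 with e | ⟨h2, -⟩
      · obtain ⟨rfl, rfl⟩ := Prod.mk.inj e
        exact ⟨⟨s, hs, rfl⟩, ht'⟩
      · have h3 := h ht'
        rcases circle_eq_base.1 (proj_eq_base.2 h2 : circle s t' = base S) with h | h
        · exact absurd h (not_le.2 h3.1)
        · exact absurd h (not_le.2 h3.2)
    · rintro ⟨⟨s, hs, rfl⟩, ht⟩
      exact ⟨s, hs, t, ht, rfl⟩
  rw [e]
  exact (isOpen_discrete _).prod hU

theorem isOpen_ne_base : IsOpen {x : Wedge S | x ≠ base S} := by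
  convert isOpen_circle_image isOpen_Ioo le_rfl (Set.univ : Set S) using 1
  ext x
  constructor
  · intro hx
    obtain ⟨s, t, h0, h1, e⟩ := (eq_base_or_eq_circle x).resolve_left hx
    exact ⟨s, trivial, t, ⟨h0, h1⟩, e⟩
  · rintro ⟨s, -, t, ht, rfl⟩ h
    rcases circle_eq_base.1 h with h | h
    exacts [absurd h (not_le.2 ht.1), absurd h (not_le.2 ht.2)]

theorem isOpen_ne_circle {C : Set ℝ} (hC : IsClosed C) (h01 : C ⊆ Set.Ioo 0 1) :
    IsOpen {x : Wedge S | ∀ s, ∀ t ∈ C, x ≠ circle s t} := by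
  rw [← isQuotientMap_proj.isOpen_preimage]
  have e : proj ⁻¹' {x : Wedge S | ∀ s, ∀ t ∈ C, x ≠ circle s t} =
      {q : Petal S × ℝ | q.1 = (none : Option S)} ∪ {q : Petal S × ℝ | q.2 ∈ Cᶜ} := by
    ext ⟨o, t⟩
    constructor
    · intro h
      rcases o with - | s
      exacts [Or.inl rfl, Or.inr fun h2 => h s t h2 rfl]
    · intro h s t' ht' e
      have e' : circle s t' = proj (o, t) := e.symm
      rcases proj_eq_proj.1 e' with e | ⟨h2, -⟩
      · obtain ⟨rfl, rfl⟩ := Prod.mk.inj e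
        rcases h with h | h
        exacts [Option.some_ne_none s h, h ht']
      · rcases circle_eq_base.1 (proj_eq_base.2 h2 : circle s t' = base S) with h | h
        exacts [absurd h (not_le.2 (h01 ht').1), absurd h (not_le.2 (h01 ht').2)]
  rw [e]
  exact ((isOpen_discrete {o : Petal S | o = (none : Option S)}).preimage continuous_fst).union
    (hC.isOpen_compl.preimage continuous_snd)

theorem isOpen_ne_mid : IsOpen {x : Wedge S | ∀ s, x ≠ circle s (1 / 2)} := by
  convert isOpen_ne_circle (S := S) (isClosed_singleton (x := (1 / 2 : ℝ))) ?_ using 1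
  · simp
  · rintro _ rfl
    norm_num

/-! ### Coverings of a wedge of circles with prescribed monodromy -/

section Covering

variable {F : Type*} (k : S → Equiv.Perm F)

open Classical in
/-- The change of coordinates of the covering of a wedge of circles whose monodromy is given. -/
noncomputable def transition (x : Wedge S) : Equiv.Perm F :=
  -- The overlap of the charts consists of the two open halves of every circle. Twisting only the
  -- second half by `k s` creates the monodromy.
  if h : ∃ s, ∃ t ∈ Set.Ioo (1 / 2 : ℝ) 1, x = circle s t then k h.choose else 1

theorem transition_circle_of_gt {s : S} {t : ℝ} (h : 1 / 2 < t) (h1 : t < 1) :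
    transition k (circle s t) = k s := by
  have hex : ∃ s', ∃ t' ∈ Set.Ioo (1 / 2 : ℝ) 1, circle s t = circle s' t' := ⟨s, t, ⟨h, h1⟩, rfl⟩
  rw [transition, dif_pos hex]
  obtain ⟨t', -, e⟩ := hex.choose_spec
  rw [← (circle_inj e (by linarith) h1).1]

theorem transition_circle_of_lt {s : S} {t : ℝ} (h0 : 0 < t) (h : t < 1 / 2) :
    transition k (circle s t) = 1 := by
  rw [transition, dif_neg]
  rintro ⟨s', t', h', e⟩
  have := (circle_inj e h0 (by linarith)).2
  linarith [h'.1]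

/-- Being locally constant on the overlap is what makes the coordinate changes continuous for a
discrete fiber. -/
theorem eventually_transition_eq {x : Wedge S} (hx : x ≠ base S)
    (hx' : ∀ s, x ≠ circle s (1 / 2)) :
    ∀ᶠ y in nhds x, transition k y = transition k x := by
  obtain ⟨s, t, h0, h1, rfl⟩ := (eq_base_or_eq_circle x).resolve_left hx
  rcases lt_trichotomy t (1 / 2) with h | rfl | h
  · have hO := isOpen_circle_image (isOpen_Ioo (a := (0 : ℝ)) (b := 1 / 2))
      (Set.Ioo_subset_Ioo_right (by norm_num)) {s}
    filter_upwards [hO.mem_nhds ⟨s, rfl, t, ⟨h0, h⟩, rfl⟩]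
    rintro _ ⟨_, rfl, t', ht', rfl⟩
    rw [transition_circle_of_lt k h0 h, transition_circle_of_lt k ht'.1 ht'.2]
  · exact absurd rfl (hx' s)
  · have hO := isOpen_circle_image (isOpen_Ioo (a := (1 / 2 : ℝ)) (b := 1))
      (Set.Ioo_subset_Ioo_left (by norm_num)) {s}
    filter_upwards [hO.mem_nhds ⟨s, rfl, t, ⟨h, h1⟩, rfl⟩]
    rintro _ ⟨_, rfl, t', ht', rfl⟩
    rw [transition_circle_of_gt k h h1, transition_circle_of_gt k ht'.1 ht'.2]

/-- The chart domains of the covering of a wedge of circles. -/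
def chartDomain (S : Type*) : Bool → Set (Wedge S)
  | true => {x | ∀ s, x ≠ circle s (1 / 2)}
  | false => {x | x ≠ base S}

/-- The changes of coordinates between the charts. -/
noncomputable def coordPerm : Bool → Bool → Wedge S → Equiv.Perm F
  | true, false => transition k
  | false, true => fun x => (transition k x)⁻¹
  | _, _ => 1

variable [TopologicalSpace F] [DiscreteTopology F]

open Classical in
/-- The covering of a wedge of circles whose monodromy is given. -/
noncomputable def coveringCore : FiberBundleCore Bool (Wedge S) F where
  baseSet := chartDomain S
  isOpen_baseSet i := by
    cases i
    exacts [isOpen_ne_base, isOpen_ne_mid]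
  indexAt x := if x = base S then true else false
  mem_baseSet_at x := by
    by_cases h : x = base S
    · rw [if_pos h]
      intro s e
      have := circle_eq_base.1 (e.symm.trans h)
      norm_num at this
    · rwa [if_neg h]
  coordChange i j x := coordPerm k i j x
  coordChange_self i := by cases i <;> simp [coordPerm]
  continuousOn_coordChange i j := by
    have key : ∀ f : Wedge S → Equiv.Perm F, ∀ D : Set (Wedge S),
        (∀ x ∈ D, ∀ᶠ y in nhds x, f y = f x) →
        ContinuousOn (fun p : Wedge S × F => f p.1 p.2) (D ×ˢ Set.univ) := by
      rintro f D hf ⟨x, v⟩ ⟨hx, -⟩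
      have h1 : Continuous fun p : Wedge S × F => f x p.2 :=
        continuous_of_discreteTopology.comp continuous_snd
      refine (h1.continuousAt.congr ?_).continuousWithinAt
      filter_upwards [continuous_fst.continuousAt.eventually (hf x hx)] with p hp
      rw [hp]
    rcases i with - | - <;> rcases j with - | -
    · exact key (fun _ => 1) _ fun _ _ => Filter.Eventually.of_forall fun _ => rfl
    · refine key (fun x => (transition k x)⁻¹) _ fun x hx => ?_
      filter_upwards [eventually_transition_eq k hx.1 hx.2] with y hy
      rw [hy]
    · exact key (fun x => transition k x) _ fun x hx => eventually_transition_eq k hx.2 hx.1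
    · exact key (fun _ => 1) _ fun _ _ => Filter.Eventually.of_forall fun _ => rfl
  coordChange_comp i j l x _ v := by
    cases i <;> cases j <;> cases l <;> simp [coordPerm]

theorem isCoveringMap_coveringCore :
    IsCoveringMap (Bundle.TotalSpace.proj : (coveringCore k).TotalSpace → Wedge S) :=
  FiberBundle.isCoveringMap (F := F)

/-- A point of the fiber of the covering over the base point. -/
noncomputable def fiberPoint (v : F) :
    (Bundle.TotalSpace.proj : (coveringCore k).TotalSpace → Wedge S) ⁻¹' {base S} :=
  ⟨⟨base S, v⟩, rfl⟩

theorem fiberPoint_injective : Function.Injective (fiberPoint k) := by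
  intro v w h
  have h1 : (⟨base S, v⟩ : (coveringCore k).TotalSpace) = ⟨base S, w⟩ := congrArg Subtype.val h
  exact eq_of_heq (Bundle.TotalSpace.mk.inj h1).2

open Classical in
-- The lift is constant in the chart away from the base point. The formula changes at t = 1 because
-- the coordinate there is read in the chart around the base point.
theorem continuous_lift_circle (s : S) (v : F) :
    Continuous fun t : unitInterval =>
      (⟨circle s t, if t = 1 then (k s)⁻¹ v else v⟩ : (coveringCore k).TotalSpace) := by
  have hidx : ∀ t : unitInterval, (coveringCore k).indexAt (circle s t) =
      if t = 0 ∨ t = 1 then true else false := by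
    intro t
    change (if circle s t = base S then true else false) = _
    have : circle s t = base S ↔ t = 0 ∨ t = 1 := by
      rw [circle_eq_base]
      have h0 : (0 : ℝ) ≤ t := t.2.1
      have h1 : (t : ℝ) ≤ 1 := t.2.2
      constructor
      · rintro (h | h)
        · exact Or.inl (Subtype.ext (le_antisymm h h0))
        · exact Or.inr (Subtype.ext (le_antisymm h1 h))
      · rintro (rfl | rfl) <;> simp
    simp only [this]
  have key : ∀ (i : Bool) (t₀ : unitInterval) (w : F), (coveringCore k).indexAt (circle s t₀) = i →
      (∀ᶠ t : unitInterval in nhds t₀, (coveringCore k).coordChange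
        ((coveringCore k).indexAt (circle s t)) i (circle s t)
          (if t = 1 then (k s)⁻¹ v else v) = w) →
      ContinuousAt (fun t : unitInterval =>
        (⟨circle s t, if t = 1 then (k s)⁻¹ v else v⟩ : (coveringCore k).TotalSpace)) t₀ := by
    rintro _ t₀ w rfl h
    rw [FiberBundle.continuousAt_totalSpace (F := F)]
    refine ⟨((circle s).continuous.comp continuous_subtype_val).continuousAt, ?_⟩
    refine (continuousAt_const (y := w)).congr ?_
    filter_upwards [h] with t ht
    exact ht.symm
  have hpos : ∀ {t : unitInterval}, t ≠ 0 → (0 : ℝ) < t := fun {t} h =>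
    lt_of_le_of_ne t.2.1 fun e => h (Subtype.ext e.symm)
  have hlt : ∀ {t : unitInterval}, t ≠ 1 → (t : ℝ) < 1 := fun {t} h =>
    lt_of_le_of_ne t.2.2 fun e => h (Subtype.ext e)
  rw [continuous_iff_continuousAt]
  intro t₀
  by_cases h0 : t₀ = 0
  · subst h0
    refine key true 0 v (by rw [hidx]; simp) ?_
    have hn : {t : unitInterval | (t : ℝ) < 1 / 2} ∈ nhds (0 : unitInterval) :=
      (isOpen_lt continuous_subtype_val continuous_const).mem_nhds (by simp)
    filter_upwards [hn] with t ht
    have ht1 : t ≠ 1 := by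
      rintro rfl
      have : (1 : ℝ) < 1 / 2 := ht
      norm_num at this
    rw [hidx, if_neg ht1]
    by_cases ht0 : t = 0
    · simp [ht0, coveringCore, coordPerm]
    · rw [if_neg (by tauto)]
      change (transition k (circle s t))⁻¹ v = v
      rw [transition_circle_of_lt k (hpos ht0) ht]
      simp
  by_cases h1 : t₀ = 1
  · subst h1
    refine key true 1 ((k s)⁻¹ v) (by rw [hidx]; simp) ?_
    have hn : {t : unitInterval | 1 / 2 < (t : ℝ)} ∈ nhds (1 : unitInterval) :=
      (isOpen_lt continuous_const continuous_subtype_val).mem_nhds (by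
        change (1 / 2 : ℝ) < 1; norm_num)
    filter_upwards [hn] with t ht
    have ht0 : t ≠ 0 := by
      rintro rfl
      have : (1 / 2 : ℝ) < 0 := ht
      norm_num at this
    rw [hidx]
    by_cases ht1 : t = 1
    · simp [ht1, coveringCore, coordPerm]
    · rw [if_neg (by tauto), if_neg ht1]
      change (transition k (circle s t))⁻¹ v = _
      rw [transition_circle_of_gt k ht (hlt ht1)]
  · refine key false t₀ v (by rw [hidx]; simp [h0, h1]) ?_
    filter_upwards [isOpen_ne.mem_nhds h0, isOpen_ne.mem_nhds h1] with t ht0 ht1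
    rw [hidx, if_neg (by tauto), if_neg ht1]
    rfl

theorem monodromy_petal (s : S) (v : F) :
    (isCoveringMap_coveringCore k).monodromyPerm (base S) (petal s) (fiberPoint k v) =
      fiberPoint k ((k s)⁻¹ v) := by
  classical
  change (isCoveringMap_coveringCore k).monodromy (petal s) (fiberPoint k v) = _
  have hx : ∀ {x : Wedge S} (h : x = base S) (w : F),
      (⟨x, w⟩ : (coveringCore k).TotalSpace) = ⟨base S, w⟩ := by
    rintro _ rfl w
    rfl
  let L : Path (⟨base S, v⟩ : (coveringCore k).TotalSpace) ⟨base S, (k s)⁻¹ v⟩ :=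
    { toFun := _
      continuous_toFun := continuous_lift_circle k s v
      source' := by simpa using hx (circle_zero S s) v
      target' := by simpa using hx (circle_one s) ((k s)⁻¹ v) }
  refine (isCoveringMap_coveringCore k).monodromy_eq_of_map_eq (ex := fiberPoint k v)
    (ey := fiberPoint k ((k s)⁻¹ v)) (mk L) ?_
  let p : Path (0 : ℝ) 1 := ⟨⟨Subtype.val, continuous_subtype_val⟩, rfl, rfl⟩
  have h1 := mk_map_eq_seg (circle s) p
  change (mk L).map _ = Path.Homotopic.Quotient.cast
    ((seg (circle s) 0 1).cast (circle_zero S s).symm (circle_one s).symm) _ _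
  rw [← h1]
  rfl

/-- One turn acts by the inverse of `k s`, so inverse classes of the circles act by `k s`. -/
theorem monodromy_lift_petal (w : FreeGroup S) (v : F) :
    (isCoveringMap_coveringCore k).monodromyPerm (base S)
      (FreeGroup.lift (fun s => (petal s)⁻¹) w) (fiberPoint k v) =
      fiberPoint k (FreeGroup.lift k w v) := by
  have hof : ∀ s v, (isCoveringMap_coveringCore k).monodromyPerm (base S) ((petal s)⁻¹)
      (fiberPoint k v) = fiberPoint k (k s v) := fun s v => by
    rw [map_inv, Equiv.Perm.inv_eq_iff_eq, monodromy_petal]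
    simp
  induction w using FreeGroup.induction_on generalizing v with
  | C1 =>
    rw [_root_.map_one, _root_.map_one, _root_.map_one]
    rfl
  | of s => simpa using hof s v
  | inv_of s _ =>
    rw [_root_.map_inv, _root_.map_inv, _root_.map_inv, FreeGroup.lift_apply_of,
      FreeGroup.lift_apply_of, Equiv.Perm.inv_eq_iff_eq, hof]
    simp
  | mul w w' h h' =>
    rw [_root_.map_mul, _root_.map_mul, _root_.map_mul, Equiv.Perm.mul_apply, h', h,
      Equiv.Perm.mul_apply]

end Covering

/-- Take for monodromy the left regular representation: a word in the kernel then fixes 1, hence is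
trivial. -/
theorem lift_petal_injective :
    Function.Injective (FreeGroup.lift fun s : S => (petal s)⁻¹) := by
  rw [injective_iff_map_eq_one]
  intro w hw
  let _ : TopologicalSpace (FreeGroup S) := ⊥
  have : DiscreteTopology (FreeGroup S) := ⟨rfl⟩
  have h1 := monodromy_lift_petal (fun s : S => Equiv.mulLeft (FreeGroup.of s)) w 1
  rw [hw, _root_.map_one, Equiv.Perm.one_apply] at h1
  have h2 := fiberPoint_injective _ h1
  have h3 : FreeGroup.lift (fun s : S => Equiv.mulLeft (FreeGroup.of s)) =
      MulAction.toPermHom (FreeGroup S) (FreeGroup S) := FreeGroup.ext_hom _ _ fun s => by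
    ext v
    simp
  rw [h3] at h2
  simpa using h2.symm

end Wedge

/-! ### The circles generate the fundamental group of the wedge -/

namespace Wedge

open Path.Homotopic.Quotient

variable {S : Type*}

theorem line_zero (o : Petal S) : base S = line o 0 :=
  (proj_eq_base.2 (Or.inr (Or.inl le_rfl))).symm

/-- A path along a line, from the base point. -/
noncomputable def along (o : Petal S) (t : ℝ) {x : Wedge S} (h : line o t = x) :
    Path.Homotopic.Quotient (base S) x :=
  (seg (line o) 0 t).cast (line_zero o) h.symm

theorem along_trans_seg (o : Petal S) (t t' : ℝ) {x y : Wedge S} (h : line o t = x)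
    (h' : line o t' = y) :
    (along o t h).trans ((seg (line o) t t').cast h.symm h'.symm) = along o t' h' := by
  rw [along, cast_trans_cast, seg_trans, along]

/-- A path along a line that ends in the collapsed part is trivial, unless it crosses the whole of
(0, 1) on an actual circle, where it is one turn. -/
theorem along_mem (o : Petal S) (t : ℝ) (h : line o t = base S) :
    FundamentalGroup.fromPath (along o t h) ∈
      (FreeGroup.lift fun s : S => (petal s)⁻¹).range := by
  have hconst : ∀ (o' : Petal S) (s t : ℝ) (hs : base S = line o' s) (ht : base S = line o' t),
      (∀ u ∈ Set.uIcc s t, (o', u) ∈ collapsed S) →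
      (seg (line o') s t).cast hs ht = refl (base S) := fun o' s t hs ht hu =>
    cast_seg_eq_refl (fun u hu' => proj_eq_base.2 (hu u hu')) hs ht
  rcases proj_eq_base.1 h with h1 | h1 | h1
  · have e : along o t h = refl (base S) := hconst o 0 t _ _ fun u _ => Or.inl h1
    rw [e]
    exact one_mem _
  · have e : along o t h = refl (base S) := hconst o 0 t _ _ fun u hu =>
      Or.inr (Or.inl (by rw [Set.uIcc_of_ge h1] at hu; exact hu.2))
    rw [e]
    exact one_mem _
  · have h11 : line o 1 = base S := proj_eq_base.2 (Or.inr (Or.inr le_rfl))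
    have e : along o t h = along o 1 h11 := by
      rw [along, ← seg_trans _ 0 1 t, ← cast_trans_cast _ _ _ h11.symm,
        hconst o 1 t _ _ fun u hu =>
          Or.inr (Or.inr (by rw [Set.uIcc_of_le h1] at hu; exact hu.1)), trans_refl, along]
    rw [e]
    rcases o with - | s
    · have e : along (none : Option S) 1 h11 = refl (base S) :=
        hconst (none : Option S) 0 1 _ _ fun u _ => Or.inl rfl
      rw [e]
      exact one_mem _
    · refine ⟨(FreeGroup.of s)⁻¹, ?_⟩
      rw [_root_.map_inv, FreeGroup.lift_apply_of, inv_inv]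
      rfl

/-- The homotopy that contracts a neighborhood of the base point. -/
noncomputable def contraction : C(Wedge S × ℝ, Wedge S) where
  toFun q := Quotient.lift (s := setoid S)
    -- At time 1 the parameter is clamp(3t - 1), which sends t ≤ 1/3 and t ≥ 2/3 to the base point.
    -- Clamping the time allows it to range over all of ℝ.
    (fun z => proj (z.1, z.2 + max 0 (min 1 q.2) * (max 0 (min 1 (3 * z.2 - 1)) - z.2))) (by
      have h0 : 0 ≤ max 0 (min 1 q.2) := le_max_left _ _
      have h1 : max 0 (min 1 q.2) ≤ 1 := max_le zero_le_one (min_le_left _ _)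
      generalize max 0 (min 1 q.2) = u at h0 h1
      have key : ∀ z : Petal S × ℝ, z ∈ collapsed S →
          proj (z.1, z.2 + u * (max 0 (min 1 (3 * z.2 - 1)) - z.2)) = base S := by
        rintro ⟨o, t⟩ (h | h | h)
        · exact proj_eq_base.2 (Or.inl h)
        · dsimp only at h ⊢
          refine proj_eq_base.2 (Or.inr (Or.inl ?_))
          dsimp only
          rw [max_eq_left ((min_le_right _ _).trans (by linarith))]
          nlinarith
        · dsimp only at h ⊢
          refine proj_eq_base.2 (Or.inr (Or.inr ?_))
          dsimp only
          rw [min_eq_left (by linarith), max_eq_right zero_le_one]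
          nlinarith
      rintro z z' (rfl | ⟨h, h'⟩)
      · rfl
      · exact (key z h).trans (key z' h').symm) q.1
  continuous_toFun := by
    refine isQuotientMap_proj.continuous_lift_prod_left ?_
    refine continuous_proj.comp (f := fun p : (Petal S × ℝ) × ℝ => (p.1.1,
      p.1.2 + max 0 (min 1 p.2) * (max 0 (min 1 (3 * p.1.2 - 1)) - p.1.2))) ?_
    fun_prop

theorem contraction_line (o : Petal S) (t u : ℝ) : contraction (line o t, u) =
    line o (t + max 0 (min 1 u) * (max 0 (min 1 (3 * t - 1)) - t)) := rfl

theorem contraction_zero (x : Wedge S) : contraction (x, 0) = x := by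
  obtain ⟨⟨o, t⟩, rfl⟩ := proj_surjective x
  refine (contraction_line o t 0).trans ?_
  simp
  rfl

theorem contraction_one (o : Petal S) (t : ℝ) : contraction (line o t, 1) =
    line o (max 0 (min 1 (3 * t - 1))) := by
  rw [contraction_line]
  simp

/-- The homotopy moves a point inside its own line, so its track merely prolongs the path along that
line. -/
theorem track_contraction (o : Petal S) (t : ℝ) {x : Wedge S} (h : line o t = x)
    (hb : line o (max 0 (min 1 (3 * t - 1))) = base S) (hx : base S = contraction (x, 1)) :
    (along o t h).trans ((track contraction x).cast (contraction_zero x).symm hx) =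
      along o (max 0 (min 1 (3 * t - 1))) hb := by
  subst h
  let g : C(ℝ, ℝ) := ⟨fun u => t + max 0 (min 1 u) * (max 0 (min 1 (3 * t - 1)) - t), by fun_prop⟩
  have e0 : g 0 = t := by simp [g]
  have e1 : g 1 = max 0 (min 1 (3 * t - 1)) := by simp [g]
  have hseg : ∀ (a b : ℝ) (ha : a = t) (hb : b = max 0 (min 1 (3 * t - 1)))
      (h : line o t = line o a) (h' : base S = line o b),
      (seg (line o) a b).cast h h' = (seg (line o) t (max 0 (min 1 (3 * t - 1)))).cast rfl
        (by rw [h', hb]) := by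
    rintro _ _ rfl rfl h h'
    rfl
  rw [track_eq_seg contraction _ (line o) g fun u => contraction_line o t u,
    Path.Homotopic.Quotient.cast_cast, hseg _ _ e0 e1]
  exact along_trans_seg o t _ rfl hb

/-- The homotopy classes of paths from the base point that are composed of circles and of a path
along a line. -/
def Admissible (x : Wedge S) (d : Path.Homotopic.Quotient (base S) x) : Prop :=
  ∃ g : Path.Homotopic.Quotient (base S) (base S),
    FundamentalGroup.fromPath g ∈ (FreeGroup.lift fun s : S => (petal s)⁻¹).range ∧
    ∃ (o : Petal S) (t : ℝ) (h : line o t = x), d = g.trans (along o t h)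

/-- By subdivision a path may be assumed to stay near the base point or inside one open circle. Near
the base point the contraction closes it up; inside a circle it only changes the final parameter. -/
theorem Admissible.trans {x y : Wedge S} {d : Path.Homotopic.Quotient (base S) x}
    (hd : Admissible x d) (q : Path.Homotopic.Quotient x y) : Admissible y (d.trans q) := by
  let U : Option S → Set (Wedge S) := fun o => match o with
    | none => {x | ∀ s, ∀ t ∈ Set.Icc (1 / 3 : ℝ) (2 / 3), x ≠ circle s t}
    | some s => {x | ∃ s' ∈ ({s} : Set S), ∃ t ∈ Set.Ioo (0 : ℝ) 1, x = circle s' t}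
  refine induction_of_open_cover (U := U)
    (P := fun {x y} q => ∀ d, Admissible x d → Admissible y (d.trans q)) ?_ ?_ ?_ ?_ q d hd
  · rintro (- | s)
    · exact isOpen_ne_circle isClosed_Icc fun t ht =>
        ⟨by linarith [ht.1], by linarith [ht.2]⟩
    · exact isOpen_circle_image isOpen_Ioo le_rfl _
  · intro x
    rcases eq_base_or_eq_circle x with rfl | ⟨s, t, h0, h1, rfl⟩
    · refine ⟨none, fun s t ht h => ?_⟩
      rcases circle_eq_base.1 h.symm with h | h
      · linarith [ht.1]
      · linarith [ht.2]
    · exact ⟨some s, s, rfl, t, ⟨h0, h1⟩, rfl⟩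
  · intro x y z p q hp hq d hd
    rw [← trans_assoc]
    exact hq _ (hp d hd)
  · rintro (- | s) x y p hp d ⟨g, hg, o, c, h, rfl⟩
    · have hb : ∀ (o : Petal S) (t : ℝ) (a : unitInterval), line o t = p a →
          line o (max 0 (min 1 (3 * t - 1))) = base S := by
        intro o t a e
        rcases o with - | s
        · exact proj_eq_base.2 (Or.inl rfl)
        · have h1 : ¬ (1 / 3 ≤ t ∧ t ≤ 2 / 3) := fun ht => hp a s t ht e.symm
          refine proj_eq_base.2 (Or.inr ?_)
          by_cases h2 : t < 1 / 3
          · exact Or.inl (max_le le_rfl ((min_le_right _ _).trans (by linarith)))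
          · have : 2 / 3 < t := by
              by_contra h3
              exact h1 ⟨not_lt.1 h2, not_lt.1 h3⟩
            exact Or.inr (le_max_of_le_right (le_min le_rfl (by linarith)))
      have h1 : ∀ a, contraction (p a, 1) = base S := by
        intro a
        obtain ⟨⟨o, t⟩, e⟩ := proj_surjective (p a)
        rw [← e]
        exact (contraction_one o t).trans (hb o t a e)
      obtain ⟨⟨o', t'⟩, e'⟩ := proj_surjective y
      have hx : base S = contraction (x, 1) := by simpa using (h1 0).symm
      have hy : base S = contraction (y, 1) := by simpa using (h1 1).symm
      have hbx := hb o c 0 (h.trans p.source.symm)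
      have hby := hb o' t' 1 (Eq.trans e' p.target.symm)
      have hT := track_contraction o c h hbx hx
      have hT' := track_contraction o' t' e' hby hy
      -- The tail towards x, prolonged by the contraction, and the reverse of the one towards y are
      -- absorbed into the loop; the path along the line of y remains.
      refine ⟨(g.trans (along o _ hbx)).trans (along o' _ hby).symm, ?_, o', t', e', ?_⟩
      · have := mul_mem (inv_mem (along_mem o' _ hby)) (mul_mem (along_mem o _ hbx) hg)
        exact this
      · rw [eq_of_homotopy contraction contraction_zero p h1 hx hy, ← hT, ← hT']
        generalize (track contraction x).cast (contraction_zero x).symm hx = A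
        generalize (track contraction y).cast (contraction_zero y).symm hy = B
        generalize along o c h = C
        generalize along o' t' e' = D
        rw [symm_trans_eq, trans_assoc, trans_assoc, trans_assoc, trans_assoc, trans_assoc,
          symm_trans, trans_refl]
    · choose s' hs' t ht e using hp
      obtain rfl : s' = fun _ => s := funext hs'
      let f : Set.Ioo (0 : ℝ) 1 → Wedge S := fun t => circle s t
      have hf : Topology.IsOpenEmbedding f := by
        refine Topology.IsOpenEmbedding.of_continuous_injective_isOpenMap
          ((circle s).continuous.comp continuous_subtype_val) ?_ ?_
        · exact fun t t' h => Subtype.ext (circle_inj h t.2.1 t.2.2).2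
        · intro V hV
          convert isOpen_circle_image (S := S) (isOpen_Ioo.isOpenMap_subtype_val V hV)
            (by rintro _ ⟨t, -, rfl⟩; exact t.2) {s} using 1
          ext x
          constructor
          · rintro ⟨t, ht, rfl⟩
            exact ⟨s, rfl, t, ⟨t, ht, rfl⟩, rfl⟩
          · rintro ⟨_, rfl, _, ⟨t, ht, rfl⟩, rfl⟩
            exact ⟨t, ht, rfl⟩
      -- An open circle is embedded, so the parameter of a path inside it is continuous.
      have hcont : Continuous fun a => (⟨t a, ht a⟩ : Set.Ioo (0 : ℝ) 1) := by
        rw [hf.toIsInducing.continuous_iff]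
        exact p.continuous.congr e
      let τ : C(unitInterval, ℝ) := ⟨t, continuous_subtype_val.comp hcont⟩
      have hx : line (some s : Option S) (τ 0) = x := (e 0).symm.trans p.source
      have hy : line (some s : Option S) (τ 1) = y := (e 1).symm.trans p.target
      have h1 : circle s (τ 0) = proj (o, c) := hx.trans h.symm
      rcases proj_eq_proj.1 h1 with h2 | ⟨h2, -⟩
      · obtain ⟨rfl, rfl⟩ := Prod.mk.inj h2
        refine ⟨g, hg, (some s : Option S), τ 1, hy, ?_⟩
        rw [mk_eq_seg (circle s) p τ e, trans_assoc]
        exact congrArg _ (along_trans_seg (some s : Option S) (τ 0) (τ 1) hx hy)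
      · rcases circle_eq_base.1 (proj_eq_base.2 h2 : circle s (τ 0) = base S) with h | h
        exacts [absurd h (not_le.2 (ht 0).1), absurd h (not_le.2 (ht 0).2)]

theorem lift_petal_surjective :
    Function.Surjective (FreeGroup.lift fun s : S => (petal s)⁻¹) := by
  intro q
  have h0 : Admissible (base S) (refl (base S)) := by
    refine ⟨refl _, one_mem _, (none : Option S), 0, (line_zero _).symm, ?_⟩
    have e : along (none : Option S) 0 (line_zero _).symm = refl (base S) :=
      cast_seg_eq_refl (fun u _ => proj_eq_base.2 (Or.inl rfl)) _ _
    rw [e, trans_refl]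
  obtain ⟨g, hg, o, t, h, e⟩ := h0.trans q.toPath
  rw [refl_trans] at e
  have := mul_mem (along_mem o t h) hg
  have e' : q = FundamentalGroup.fromPath (along o t h) * FundamentalGroup.fromPath g := e
  rw [← e'] at this
  exact this

/-- Parameters outside (0, 1) stay at the base point, so overshooting the interval does not change
the class. -/
theorem petal_eq (s : S) {a b : ℝ} (ha : a ≤ 0) (hb : 1 ≤ b) :
    petal s = FundamentalGroup.fromPath ((seg (circle s) a b).cast
      (circle_eq_base.2 (Or.inl ha)).symm (circle_eq_base.2 (Or.inr hb)).symm) := by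
  have h1 : (seg (circle s) a 0).cast (circle_eq_base.2 (Or.inl ha)).symm (circle_zero S s).symm =
      refl (base S) := cast_seg_eq_refl (fun u hu => circle_eq_base.2 (Or.inl
        (by rw [Set.uIcc_of_le ha] at hu; exact hu.2))) _ _
  have h2 : (seg (circle s) 1 b).cast (circle_one s).symm (circle_eq_base.2 (Or.inr hb)).symm =
      refl (base S) := cast_seg_eq_refl (fun u hu => circle_eq_base.2 (Or.inr
        (by rw [Set.uIcc_of_le hb] at hu; exact hu.1))) _ _
  rw [← seg_trans _ a 0 b, ← seg_trans _ 0 1 b, ← cast_trans_cast _ _ _ (circle_zero S s).symm,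
    ← cast_trans_cast _ _ _ (circle_one s).symm, h1, h2, refl_trans, trans_refl, petal]

/-- The map from a wedge of circles that is given on each circle. -/
noncomputable def desc {X : Type*} [TopologicalSpace X] (F : S → C(ℝ, X)) (x : X)
    (h0 : ∀ s, F s 0 = x) (h1 : ∀ s, F s 1 = x) : C(Wedge S, X) where
  toFun := Quotient.lift (s := setoid S)
    (fun z => Option.rec x (fun s => F s (max 0 (min 1 z.2))) (show Option S from z.1)) (by
      have key : ∀ z : Petal S × ℝ, z ∈ collapsed S →
          (Option.rec x (fun s => F s (max 0 (min 1 z.2))) (show Option S from z.1) : X) = x := by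
        rintro ⟨- | s, t⟩ h
        · rfl
        · rcases h with h | h | h
          · exact absurd h (Option.some_ne_none s)
          · dsimp only at h ⊢
            rw [max_eq_left ((min_le_right _ _).trans h), h0]
          · dsimp only at h ⊢
            rw [min_eq_left h, max_eq_right zero_le_one, h1]
      rintro z z' (rfl | ⟨h, h'⟩)
      · rfl
      · exact (key z h).trans (key z' h').symm)
  continuous_toFun := by
    refine isQuotientMap_proj.continuous_iff.2 (continuous_prod_of_discrete_left.2 ?_)
    rintro (- | s)
    · exact continuous_const
    · exact (F s).continuous.comp (continuous_const.max (continuous_const.min continuous_id))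

theorem desc_base {X : Type*} [TopologicalSpace X] (F : S → C(ℝ, X)) (x : X)
    (h0 : ∀ s, F s 0 = x) (h1 : ∀ s, F s 1 = x) : desc F x h0 h1 (base S) = x := rfl

theorem desc_circle {X : Type*} [TopologicalSpace X] (F : S → C(ℝ, X)) (x : X)
    (h0 : ∀ s, F s 0 = x) (h1 : ∀ s, F s 1 = x) (s : S) {t : ℝ} (ht : t ∈ Set.Icc (0 : ℝ) 1) :
    desc F x h0 h1 (circle s t) = F s t := by
  change F s (max 0 (min 1 t)) = F s t
  rw [min_eq_right ht.2, max_eq_right ht.1]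

theorem map_desc_petal {X : Type*} [TopologicalSpace X] (F : S → C(ℝ, X)) (x : X)
    (h0 : ∀ s, F s 0 = x) (h1 : ∀ s, F s 1 = x) (s : S) :
    FundamentalGroup.mapOfEq (desc F x h0 h1) (desc_base F x h0 h1) (petal s) =
      FundamentalGroup.fromPath ((seg (F s) 0 1).cast (h0 s).symm (h1 s).symm) := by
  rw [FundamentalGroup.mapOfEq_apply]
  change (((seg (circle s) 0 1).cast _ _).map (desc F x h0 h1)).cast _ _ = _
  rw [Path.Homotopic.Quotient.map_cast, map_seg,
    seg_congr (f := (desc F x h0 h1).comp (circle s)) (g := F s) fun t ht =>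
      desc_circle F x h0 h1 s (by rwa [Set.uIcc_of_le zero_le_one] at ht)]
  rfl

end Wedge

namespace Path.Homotopic.Quotient

variable {X Y : Type*} [TopologicalSpace X] [TopologicalSpace Y]

/-- Two maps that are homotopic relative to a point have the same effect on loops at this point. -/
theorem map_eq_of_homotopy (K : C(X × ℝ, Y)) {f₀ f₁ : C(X, Y)} (h0 : ∀ z, K (z, 0) = f₀ z)
    (h1 : ∀ z, K (z, 1) = f₁ z) {x : X} {y : Y} (hx : ∀ u, K (x, u) = y) (hy : y = f₀ x)
    (hy' : y = f₁ x) (q : Path.Homotopic.Quotient x x) :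
    (q.map f₀).cast hy hy = (q.map f₁).cast hy' hy' := by
  have h := map_trans_track K q
  have ht : (track K x).cast (hx 0).symm (hx 1).symm = refl y := by
    rw [track_eq_seg K x (ContinuousMap.const ℝ y) (ContinuousMap.id ℝ) hx, seg_const]
    simp
  have e0 : ((prod q (refl 0)).map K).cast (hx 0).symm (hx 0).symm = (q.map f₀).cast hy hy := by
    induction q with | mk p => exact congrArg mk (Path.ext (funext fun t => h0 (p t)))
  have e1 : ((prod q (refl 1)).map K).cast (hx 1).symm (hx 1).symm = (q.map f₁).cast hy' hy' := by
    induction q with | mk p => exact congrArg mk (Path.ext (funext fun t => h1 (p t)))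
  have h2 := congrArg (fun q => q.cast (hx 0).symm (hx 1).symm) h
  rw [← cast_trans_cast _ _ _ (hx 0).symm, ← cast_trans_cast _ _ _ (hx 1).symm, e0, e1, ht,
    trans_refl, refl_trans] at h2
  exact h2

end Path.Homotopic.Quotient

/-! ### Concatenation of a sequence of curves -/

section Concat

variable {X : Type*} [TopologicalSpace X]

theorem locallyFinite_Icc_intCast : LocallyFinite fun m : ℤ => Set.Icc (m : ℝ) (m + 1) := by
  intro t
  refine ⟨Set.Ioo (t - 1) (t + 1), Ioo_mem_nhds (by linarith) (by linarith),
    (Set.finite_Icc ⌊t - 2⌋ ⌈t + 1⌉).subset ?_⟩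
  rintro m ⟨u, ⟨h1, h2⟩, h3, h4⟩
  constructor
  · exact (Int.cast_le (R := ℝ)).1 ((Int.floor_le _).trans (by linarith))
  · exact (Int.cast_le (R := ℝ)).1 (le_trans (by linarith) (Int.le_ceil _))

theorem floor_fract_eq (φ : ℤ → C(ℝ, X)) (h : ∀ m, φ m 1 = φ (m + 1) 0) (m : ℤ) {t : ℝ}
    (ht : t ∈ Set.Icc (m : ℝ) (m + 1)) : φ ⌊t⌋ (Int.fract t) = φ m (t - m) := by
  rcases ht.2.eq_or_lt with e | e
  · have h1 : t = ((m + 1 : ℤ) : ℝ) := by push_cast; exact e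
    rw [h1, Int.floor_intCast, Int.fract_intCast, ← h]
    congr 1
    push_cast
    ring
  · have h1 : ⌊t⌋ = m := Int.floor_eq_iff.2 ⟨ht.1, e⟩
    rw [Int.fract, h1]

/-- The curve that runs through the curves `φ m` successively, each on an interval of length one. -/
noncomputable def concat (φ : ℤ → C(ℝ, X)) (h : ∀ m, φ m 1 = φ (m + 1) 0) : C(ℝ, X) where
  toFun t := φ ⌊t⌋ (Int.fract t)
  continuous_toFun := by
    refine locallyFinite_Icc_intCast.continuous (Set.eq_univ_of_forall fun t => Set.mem_iUnion.2
      ⟨⌊t⌋, Int.floor_le t, (Int.lt_floor_add_one t).le⟩) (fun _ => isClosed_Icc) fun m => ?_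
    have : Continuous fun t : ℝ => φ m (t - m) := by fun_prop
    exact this.continuousOn.congr fun t ht => floor_fract_eq φ h m ht

theorem concat_apply (φ : ℤ → C(ℝ, X)) (h : ∀ m, φ m 1 = φ (m + 1) 0) (m : ℤ) {t : ℝ}
    (ht : t ∈ Set.Icc (0 : ℝ) 1) : concat φ h (m + t) = φ m t := by
  refine (floor_fract_eq φ h m ⟨by linarith [ht.1], by linarith [ht.2]⟩).trans ?_
  congr 1
  ring

end Concat

/-! ### Maps on the surface defined by gluing -/

namespace OrientedSurface

open Path.Homotopic.Quotient

variable {p n : ℕ}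

theorem continuous_polygonBoundary (p r : ℕ) : Continuous (polygonBoundary p r) := by
  refine Continuous.subtype_mk ?_ _
  fun_prop

theorem polygonBoundary_sub (p r : ℕ) (hr : 0 < r) (t : ℝ) :
    polygonBoundary p r (4 * p + 3 * r - t) = polygonBoundary p r (-t) := by
  refine Subtype.ext ?_
  change Complex.exp _ = Complex.exp _
  rw [Complex.exp_eq_exp_iff_exists_int]
  refine ⟨1, ?_⟩
  have h : ((4 * p + 3 * r : ℕ) : ℂ) ≠ 0 := Nat.cast_ne_zero.2 (by omega)
  push_cast at h ⊢
  field_simp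
  ring

/-- The interval has length 4p + 3n + 2, one less than the period. What is omitted is the last free
side, and the parameters in [-1, 0] describe the side before the vertex 0. -/
theorem polygonBoundary_injOn (p n : ℕ) : Set.InjOn (polygonBoundary p (n + 1))
    (Set.Icc (-1 : ℝ) (4 * p + 3 * n + 1)) := by
  intro t ht t' ht' h
  have h1 : Complex.exp _ = Complex.exp _ := congrArg Subtype.val h
  rw [Complex.exp_eq_exp_iff_exists_int] at h1
  obtain ⟨k, hk⟩ := h1
  have hN : (0 : ℝ) < ((4 * p + 3 * (n + 1) : ℕ) : ℝ) := Nat.cast_pos.2 (by omega)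
  have h2 : t - t' = k * ((4 * p + 3 * (n + 1) : ℕ) : ℝ) := by
    have h3 : ((2 * Real.pi * t / ((4 * p + 3 * (n + 1) : ℕ) : ℝ) : ℝ) : ℂ) =
        ((2 * Real.pi * t' / ((4 * p + 3 * (n + 1) : ℕ) : ℝ) + k * (2 * Real.pi) : ℝ) : ℂ) := by
      refine mul_right_cancel₀ Complex.I_ne_zero (hk.trans ?_)
      push_cast
      ring
    have h4 := Complex.ofReal_injective h3
    have := Real.pi_pos
    field_simp at h4
    linarith
  have hlt : |(k : ℝ)| < 1 := by
    have h3 : |t - t'| < ((4 * p + 3 * (n + 1) : ℕ) : ℝ) := by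
      rw [abs_lt]
      push_cast
      constructor <;> linarith [ht.1, ht.2, ht'.1, ht'.2]
    rw [h2, abs_mul, abs_of_pos hN] at h3
    exact (mul_lt_iff_lt_one_left hN).1 h3
  have hk0 : k = 0 := by
    rw [← Int.cast_abs] at hlt
    exact Int.abs_lt_one_iff.1 (by exact_mod_cast hlt)
  rw [hk0] at h2
  simp at h2
  linarith

/-- There is a retraction of the polygon onto the complement of one free side of its boundary. -/
theorem exists_retraction (p n : ℕ) : ∃ ρ : C(PolygonDisc, ℝ),
    (∀ z, ρ z ∈ Set.Icc (-1 : ℝ) (4 * p + 3 * n + 1)) ∧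
    ∀ t ∈ Set.Icc (-1 : ℝ) (4 * p + 3 * n + 1), ρ (polygonBoundary p (n + 1) t) = t := by
  let A := Set.Icc (-1 : ℝ) (4 * p + 3 * n + 1)
  have h01 : (-1 : ℝ) ≤ 4 * p + 3 * n + 1 := by
    have : (0 : ℝ) ≤ 4 * p + 3 * n + 1 := by positivity
    linarith
  let e : A → PolygonDisc := fun t => polygonBoundary p (n + 1) t
  have he : Topology.IsClosedEmbedding e :=
    ((continuous_polygonBoundary p (n + 1)).comp continuous_subtype_val).isClosedEmbedding
      fun t t' h => Subtype.ext (polygonBoundary_injOn p n t.2 t'.2 h)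
  -- Tietze extension of the inverse of the embedded arc; clamping then keeps its values in the
  -- interval.
  obtain ⟨ρ, hρ⟩ := ContinuousMap.exists_extension he
    (⟨Subtype.val, continuous_subtype_val⟩ : C(A, ℝ))
  refine ⟨⟨fun z => max (-1) (min (4 * p + 3 * n + 1) (ρ z)), by fun_prop⟩,
    fun z => ⟨le_max_left _ _, max_le h01 (min_le_left _ _)⟩, fun t ht => ?_⟩
  have h1 : ρ (polygonBoundary p (n + 1) t) = t := DFunLike.congr_fun hρ (⟨t, ht⟩ : A)
  change max (-1) (min _ (ρ _)) = t
  rw [h1, min_eq_right ht.2, max_eq_right ht.1]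

/-- The projection of the polygon onto the surface. -/
noncomputable def proj (p r : ℕ) : C(PolygonDisc, OrientedSurface p r) := ⟨Quot.mk _, continuous_quot_mk⟩

theorem isQuotientMap_proj (p r : ℕ) : Topology.IsQuotientMap (proj p r) := isQuotientMap_quot_mk

/-- The parametrized boundary of the polygon, in the surface. -/
noncomputable def boundary (p r : ℕ) : C(ℝ, OrientedSurface p r) := ⟨bd p r, continuous_bd p r⟩

/-- The map from the product of the surface and of a space that is given by a map from the product
of the polygon and of this space. -/
noncomputable def descProd {r : ℕ} {Y Z : Type*} [TopologicalSpace Y] [TopologicalSpace Z]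
    [LocallyCompactSpace Y] (k : C(PolygonDisc × Y, Z))
    (h : ∀ z z', SurfaceGluing p r z z' → ∀ y, k (z, y) = k (z', y)) :
    C(OrientedSurface p r × Y, Z) where
  toFun q := Quot.lift (fun z => k (z, q.2)) (fun z z' hz => h z z' hz q.2) q.1
  continuous_toFun := (isQuotientMap_proj p r).continuous_lift_prod_left k.continuous

/-- A family of functions of the boundary parameter, on the complement of the last free side, that is
compatible with the gluing. -/
structure Compatible (p n : ℕ) {Z : Type*} (G : ℝ → Z) : Prop where
  a : ∀ i : Fin p, ∀ t ∈ Set.Icc (0 : ℝ) 1, G (4 * (i : ℕ) + t) = G (4 * (i : ℕ) + 3 - t)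
  b : ∀ i : Fin p, ∀ t ∈ Set.Icc (0 : ℝ) 1, G (4 * (i : ℕ) + 1 + t) = G (4 * (i : ℕ) + 4 - t)
  c : ∀ j : Fin n, ∀ t ∈ Set.Icc (0 : ℝ) 1,
    G (4 * p + 3 * (j : ℕ) + t) = G (4 * p + 3 * (j : ℕ) + 3 - t)
  -- The two copies of the last arc lie at the two ends of the parameter interval, the second one
  -- shifted by a full period.
  last : ∀ t ∈ Set.Icc (0 : ℝ) 1, G (4 * p + 3 * n + t) = G (-t)

theorem Compatible.glue {Z : Type*} {G : ℝ → Z} (hG : Compatible p n G) {f : PolygonDisc → Z}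
    (hf : ∀ t ∈ Set.Icc (-1 : ℝ) (4 * p + 3 * n + 1), f (polygonBoundary p (n + 1) t) = G t)
    (z z' : PolygonDisc) (h : SurfaceGluing p (n + 1) z z') : f z = f z' := by
  have hn : (0 : ℝ) ≤ n := n.cast_nonneg
  rcases h with ⟨i, t, h0, h1⟩ | ⟨i, t, h0, h1⟩ | ⟨j, t, h0, h1⟩
  · have hi : ((i : ℕ) : ℝ) + 1 ≤ p := by exact_mod_cast i.2
    have hi0 : (0 : ℝ) ≤ (i : ℕ) := Nat.cast_nonneg _
    rw [hf _ ⟨by linarith, by linarith⟩, hf _ ⟨by linarith, by linarith⟩, hG.a i t ⟨h0, h1⟩]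
  · have hi : ((i : ℕ) : ℝ) + 1 ≤ p := by exact_mod_cast i.2
    have hi0 : (0 : ℝ) ≤ (i : ℕ) := Nat.cast_nonneg _
    rw [hf _ ⟨by linarith, by linarith⟩, hf _ ⟨by linarith, by linarith⟩, hG.b i t ⟨h0, h1⟩]
  · have hp : (0 : ℝ) ≤ p := p.cast_nonneg
    induction j using Fin.lastCases with
    | last =>
      have e := polygonBoundary_sub p (n + 1) n.succ_pos t
      have e' : (4 * p + 3 * ((Fin.last n : Fin (n + 1)) : ℕ) + 3 - t : ℝ) =
          4 * p + 3 * ((n + 1 : ℕ) : ℝ) - t := by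
        push_cast [Fin.val_last]
        ring
      rw [e', e, Fin.val_last, hf _ ⟨by linarith, by linarith⟩,
        hf _ ⟨by linarith, by linarith⟩, hG.last t ⟨h0, h1⟩]
    | cast j =>
      have hj : ((j : ℕ) : ℝ) + 1 ≤ n := by exact_mod_cast j.2
      have hj0 : (0 : ℝ) ≤ (j : ℕ) := Nat.cast_nonneg _
      rw [Fin.val_castSucc, hf _ ⟨by linarith, by linarith⟩, hf _ ⟨by linarith, by linarith⟩,
        hG.c j t ⟨h0, h1⟩]

theorem compatible_boundary (p n : ℕ) : Compatible p n (boundary p (n + 1)) where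
  a i t ht := Quot.sound (SurfaceGluing.a i t ht.1 ht.2)
  b i t ht := Quot.sound (SurfaceGluing.b i t ht.1 ht.2)
  c j t ht := Quot.sound (SurfaceGluing.c j.castSucc t ht.1 ht.2)
  last t ht := by
    have h1 : boundary p (n + 1) (4 * p + 3 * n + t) =
        boundary p (n + 1) (4 * p + 3 * n + 3 - t) :=
      Quot.sound (SurfaceGluing.c (Fin.last n) t ht.1 ht.2)
    have h2 := polygonBoundary_sub p (n + 1) n.succ_pos t
    rw [h1]
    refine Eq.trans ?_ (congrArg (proj p (n + 1)) h2)
    change proj p (n + 1) _ = _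
    congr 2
    push_cast
    ring

end OrientedSurface

namespace OrientedSurface

open Path.Homotopic.Quotient

variable {p n : ℕ}

/-! #### The collapse of the arcs that run from the base point to the boundary circles -/

theorem stretch_endpoints (m : ℤ) :
    (⟨fun w => m + max 0 (min 1 (3 * w - 1)), by fun_prop⟩ : C(ℝ, ℝ)) 1 =
      (⟨fun w => (m + 1 : ℤ) + max 0 (min 1 (3 * w - 1)), by fun_prop⟩ : C(ℝ, ℝ)) 0 := by
  change (m : ℝ) + max 0 (min 1 (3 * 1 - 1)) = (m + 1 : ℤ) + max 0 (min 1 (3 * 0 - 1))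
  norm_num

/-- The map that collapses the first and the last third of the intervals between two integers. -/
noncomputable def stretch : C(ℝ, ℝ) :=
  concat (fun j : ℤ => ⟨fun w => j + max 0 (min 1 (3 * w - 1)), by fun_prop⟩) stretch_endpoints

theorem stretch_apply (j : ℕ) {w : ℝ} (hw : w ∈ Set.Icc (0 : ℝ) 1) :
    stretch (j + w) = j + max 0 (min 1 (3 * w - 1)) := by
  refine Eq.trans ?_ ((concat_apply _ stretch_endpoints (j : ℤ) hw).trans ?_)
  · rw [stretch, Int.cast_natCast]
  · rw [ContinuousMap.coe_mk, Int.cast_natCast]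

/-- The map that collapses the sides which correspond to arcs from the base point to the boundary
circles. -/
noncomputable def collapse (p n : ℕ) : C(ℝ, ℝ) where
  -- Handle parameters are unchanged. In each boundary block of length 3 the outer units are crushed
  -- and the middle one is stretched over the whole block. Beyond both ends the function is
  -- constant.
  toFun t := min (max 0 t) (4 * p) + 3 * stretch (max 0 (min t (4 * p + 3 * n) - 4 * p) / 3)
  continuous_toFun := by fun_prop

theorem collapse_of_le {t : ℝ} (h : t ≤ 4 * p) : collapse p n t = max 0 t := by
  change min (max 0 t) (4 * p) + 3 * stretch (max 0 (min t (4 * p + 3 * n) - 4 * p) / 3) = _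
  have h1 := stretch_apply 0 (w := 0) (by simp)
  have h2 : min t (4 * p + 3 * n) - 4 * p ≤ 0 := by linarith [min_le_left t (4 * p + 3 * n : ℝ)]
  rw [max_eq_left h2, min_eq_left (max_le (by positivity) h)]
  norm_num at h1 ⊢
  exact h1

theorem collapse_add {j : ℕ} (hj : j < n) {t : ℝ} (ht : t ∈ Set.Icc (0 : ℝ) 3) :
    collapse p n (4 * p + 3 * j + t) = 4 * p + 3 * j + 3 * max 0 (min 1 (t - 1)) := by
  change min (max 0 (4 * p + 3 * j + t)) (4 * p) +
    3 * stretch (max 0 (min (4 * p + 3 * j + t) (4 * p + 3 * n) - 4 * p) / 3) = _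
  have h1 := stretch_apply j (w := t / 3) ⟨by linarith [ht.1], by linarith [ht.2]⟩
  have h2 : (j : ℝ) + 1 ≤ n := by exact_mod_cast hj
  have hp : (0 : ℝ) ≤ p := p.cast_nonneg
  have hj : (0 : ℝ) ≤ j := j.cast_nonneg
  have ht0 := ht.1
  have ht1 := ht.2
  rw [max_eq_right (by linarith), min_eq_right (by linarith), min_eq_left (by linarith),
    max_eq_right (by linarith),
    show (4 * p + 3 * j + t - 4 * p : ℝ) / 3 = j + t / 3 by ring, h1]
  ring_nf

theorem collapse_of_ge {t : ℝ} (h : 4 * p + 3 * n ≤ t) : collapse p n t = 4 * p + 3 * n := by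
  change min (max 0 t) (4 * p) + 3 * stretch (max 0 (min t (4 * p + 3 * n) - 4 * p) / 3) = _
  have h1 := stretch_apply n (w := 0) (by simp)
  have hp : (0 : ℝ) ≤ p := p.cast_nonneg
  have hn : (0 : ℝ) ≤ n := n.cast_nonneg
  rw [min_eq_right h, max_eq_right (by linarith : (0 : ℝ) ≤ t), min_eq_right (by linarith),
    max_eq_right (by linarith), show (4 * p + 3 * n - 4 * p : ℝ) / 3 = n + 0 by ring, h1]
  norm_num

/-! #### The word read on the boundary of the polygon -/

/-- The curves that correspond to the sides of the polygon. -/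
noncomputable def sideCurve {X : Type*} [TopologicalSpace X] (F : SurfaceBasis p n → C(ℝ, X))
    (x : X) (m : ℤ) : C(ℝ, X) :=
  if h : 0 ≤ m ∧ m < 4 * p then
    if m % 4 = 0 then F (Sum.inl (⟨(m / 4).toNat, by omega⟩, false))
    else if m % 4 = 1 then F (Sum.inl (⟨(m / 4).toNat, by omega⟩, true))
    else if m % 4 = 2 then
      (F (Sum.inl (⟨(m / 4).toNat, by omega⟩, false))).comp ⟨fun t => 1 - t, by fun_prop⟩
    else (F (Sum.inl (⟨(m / 4).toNat, by omega⟩, true))).comp ⟨fun t => 1 - t, by fun_prop⟩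
  else if h : 4 * p ≤ m ∧ m < 4 * p + 3 * n ∧ (m - 4 * p) % 3 = 1 then
    F (Sum.inr ⟨((m - 4 * p) / 3).toNat, by omega⟩)
  else ContinuousMap.const ℝ x

section SideCurve

variable {X : Type*} [TopologicalSpace X] (F : SurfaceBasis p n → C(ℝ, X)) (x : X)

theorem sideCurve_handle (i : Fin p) (l : ℕ) (hl : l < 4) : sideCurve F x (4 * (i : ℕ) + l) =
    if l = 0 then F (Sum.inl (i, false)) else if l = 1 then F (Sum.inl (i, true))
    else if l = 2 then (F (Sum.inl (i, false))).comp ⟨fun t => 1 - t, by fun_prop⟩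
    else (F (Sum.inl (i, true))).comp ⟨fun t => 1 - t, by fun_prop⟩ := by
  have hi := i.2
  have h : (0 : ℤ) ≤ 4 * (i : ℕ) + l ∧ (4 * (i : ℕ) + l : ℤ) < 4 * p := by omega
  have e : ∀ h', (⟨((4 * (i : ℕ) + l : ℤ) / 4).toNat, h'⟩ : Fin p) = i := fun h' =>
    Fin.ext (by change ((4 * (i : ℕ) + l : ℤ) / 4).toNat = _; omega)
  have e' : (4 * (i : ℕ) + l : ℤ) % 4 = l := by omega
  rw [sideCurve, dif_pos h]
  simp only [e, e']
  norm_cast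

theorem sideCurve_boundary (j : Fin n) : sideCurve F x (4 * p + 3 * (j : ℕ) + 1) =
    F (Sum.inr j) := by
  have hj := j.2
  rw [sideCurve, dif_neg (by omega), dif_pos (by omega)]
  congr 2
  exact Fin.ext (by change ((4 * p + 3 * (j : ℕ) + 1 - 4 * p : ℤ) / 3).toNat = _; omega)

theorem sideCurve_of_mod {m : ℤ} (h : 4 * p ≤ m) (h' : (m - 4 * p) % 3 ≠ 1) :
    sideCurve F x m = ContinuousMap.const ℝ x := by
  rw [sideCurve, dif_neg (by omega), dif_neg (by omega)]

theorem sideCurve_of_neg {m : ℤ} (h : m < 0) : sideCurve F x m = ContinuousMap.const ℝ x := by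
  rw [sideCurve, dif_neg (by omega), dif_neg (by omega)]

variable {F x}

theorem sideCurve_zero (h0 : ∀ s, F s 0 = x) (h1 : ∀ s, F s 1 = x) (m : ℤ) :
    sideCurve F x m 0 = x := by
  unfold sideCurve
  split_ifs <;> simp [h0, h1]

theorem sideCurve_one (h0 : ∀ s, F s 0 = x) (h1 : ∀ s, F s 1 = x) (m : ℤ) :
    sideCurve F x m 1 = x := by
  unfold sideCurve
  split_ifs <;> simp [h0, h1]

/-- The curve that runs through the curves that correspond to the sides of the polygon. -/
noncomputable def wordCurve (h0 : ∀ s, F s 0 = x) (h1 : ∀ s, F s 1 = x) : C(ℝ, X) :=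
  concat (sideCurve F x) fun m => by rw [sideCurve_one h0 h1, sideCurve_zero h0 h1]

theorem wordCurve_add (h0 : ∀ s, F s 0 = x) (h1 : ∀ s, F s 1 = x) (m : ℤ) {t : ℝ}
    (ht : t ∈ Set.Icc (0 : ℝ) 1) : wordCurve h0 h1 (m + t) = sideCurve F x m t :=
  concat_apply _ _ m ht

theorem wordCurve_handle (h0 : ∀ s, F s 0 = x) (h1 : ∀ s, F s 1 = x) {t : ℝ}
    (ht : t ∈ Set.Icc (0 : ℝ) 1) (i : Fin p) :
    wordCurve h0 h1 (4 * (i : ℕ) + t) = F (Sum.inl (i, false)) t ∧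
    wordCurve h0 h1 (4 * (i : ℕ) + 1 + t) = F (Sum.inl (i, true)) t ∧
    wordCurve h0 h1 (4 * (i : ℕ) + 3 - t) = F (Sum.inl (i, false)) t ∧
    wordCurve h0 h1 (4 * (i : ℕ) + 4 - t) = F (Sum.inl (i, true)) t := by
  have ht' : 1 - t ∈ Set.Icc (0 : ℝ) 1 := ⟨by linarith [ht.2], by linarith [ht.1]⟩
  have key : ∀ (l : ℕ), l < 4 → ∀ s : ℝ, s ∈ Set.Icc (0 : ℝ) 1 → ∀ u : ℝ, u = 4 * (i : ℕ) + l + s →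
      wordCurve h0 h1 u = sideCurve F x (4 * (i : ℕ) + l) s := by
    rintro l hl s hs _ rfl
    rw [← wordCurve_add h0 h1 _ hs]
    push_cast
    rfl
  refine ⟨?_, ?_, ?_, ?_⟩
  · rw [key 0 (by norm_num) t ht _ (by push_cast; ring), sideCurve_handle F x i 0 (by norm_num)]
    simp
  · rw [key 1 (by norm_num) t ht _ (by push_cast; ring), sideCurve_handle F x i 1 (by norm_num)]
    simp
  · rw [key 2 (by norm_num) _ ht' _ (by push_cast; ring), sideCurve_handle F x i 2 (by norm_num)]
    simp
  · rw [key 3 (by norm_num) _ ht' _ (by push_cast; ring), sideCurve_handle F x i 3 (by norm_num)]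
    simp

theorem wordCurve_boundary (h0 : ∀ s, F s 0 = x) (h1 : ∀ s, F s 1 = x) {t : ℝ}
    (ht : t ∈ Set.Icc (0 : ℝ) 1) (j : Fin n) :
    wordCurve h0 h1 (4 * p + 3 * (j : ℕ) + 1 + t) = F (Sum.inr j) t := by
  rw [← sideCurve_boundary F x, ← wordCurve_add h0 h1 _ ht]
  push_cast
  rfl

theorem wordCurve_arc (h0 : ∀ s, F s 0 = x) (h1 : ∀ s, F s 1 = x) {t : ℝ}
    (ht : t ∈ Set.Icc (0 : ℝ) 1) (j : ℕ) :
    wordCurve h0 h1 (4 * p + 3 * (j : ℕ) + t) = x ∧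
    wordCurve h0 h1 (4 * p + 3 * (j : ℕ) + 3 - t) = x := by
  have ht' : 1 - t ∈ Set.Icc (0 : ℝ) 1 := ⟨by linarith [ht.2], by linarith [ht.1]⟩
  constructor
  · have h := wordCurve_add h0 h1 (4 * p + 3 * j) ht
    rw [sideCurve_of_mod F x (by omega) (by omega)] at h
    push_cast at h
    exact h
  · have h := wordCurve_add h0 h1 (4 * p + 3 * j + 2) ht'
    rw [sideCurve_of_mod F x (by omega) (by omega)] at h
    push_cast at h
    rw [show (4 * p + 3 * j + 3 - t : ℝ) = 4 * p + 3 * j + 2 + (1 - t) by ring]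
    exact h

theorem wordCurve_neg (h0 : ∀ s, F s 0 = x) (h1 : ∀ s, F s 1 = x) {t : ℝ}
    (ht : t ∈ Set.Icc (0 : ℝ) 1) : wordCurve h0 h1 (-t) = x := by
  have h := wordCurve_add h0 h1 (-1) (t := 1 - t) ⟨by linarith [ht.2], by linarith [ht.1]⟩
  rw [sideCurve_of_neg F x (by omega)] at h
  push_cast at h
  rw [show -t = -1 + (1 - t) by ring]
  exact h

theorem compatible_wordCurve (h0 : ∀ s, F s 0 = x) (h1 : ∀ s, F s 1 = x) :
    Compatible p n (wordCurve h0 h1) where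
  a i _ ht := (wordCurve_handle h0 h1 ht i).1.trans (wordCurve_handle h0 h1 ht i).2.2.1.symm
  b i _ ht := (wordCurve_handle h0 h1 ht i).2.1.trans (wordCurve_handle h0 h1 ht i).2.2.2.symm
  c j _ ht := (wordCurve_arc h0 h1 ht j).1.trans (wordCurve_arc h0 h1 ht j).2.symm
  last _ ht := (wordCurve_arc h0 h1 ht n).1.trans (wordCurve_neg h0 h1 ht).symm

/-- The sides of the polygon cover the complement of the last free side. -/
theorem side_cases {t : ℝ} (ht : t ∈ Set.Icc (-1 : ℝ) (4 * p + 3 * n + 1)) :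
    ∃ s ∈ Set.Icc (0 : ℝ) 1,
      (∃ i : Fin p, t = 4 * (i : ℕ) + s ∨ t = 4 * (i : ℕ) + 1 + s ∨ t = 4 * (i : ℕ) + 3 - s ∨
        t = 4 * (i : ℕ) + 4 - s) ∨
      (∃ j : Fin n, t = 4 * p + 3 * (j : ℕ) + s ∨ t = 4 * p + 3 * (j : ℕ) + 1 + s ∨
        t = 4 * p + 3 * (j : ℕ) + 3 - s) ∨
      t = 4 * p + 3 * n + s ∨ t = -s := by
  by_cases h : t < 0
  · exact ⟨-t, ⟨by linarith, by linarith [ht.1]⟩, Or.inr (Or.inr (Or.inr (by ring)))⟩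
  by_cases h' : t < 4 * p
  · have h1 := Nat.floor_le (a := t / 4) (by linarith)
    have h2 := Nat.lt_floor_add_one (t / 4)
    have h3 : ⌊t / 4⌋₊ < p := by
      have : (⌊t / 4⌋₊ : ℝ) < p := by linarith
      exact_mod_cast this
    set k := ⌊t / 4⌋₊
    by_cases c1 : t ≤ 4 * k + 1
    · exact ⟨t - 4 * k, ⟨by linarith, by linarith⟩, Or.inl ⟨⟨k, h3⟩, Or.inl (by simp)⟩⟩
    by_cases c2 : t ≤ 4 * k + 2
    · exact ⟨t - 4 * k - 1, ⟨by linarith, by linarith⟩, Or.inl ⟨⟨k, h3⟩, Or.inr (Or.inl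
        (by simp))⟩⟩
    by_cases c3 : t ≤ 4 * k + 3
    · exact ⟨4 * k + 3 - t, ⟨by linarith, by linarith⟩, Or.inl ⟨⟨k, h3⟩, Or.inr (Or.inr (Or.inl
        (by simp)))⟩⟩
    · exact ⟨4 * k + 4 - t, ⟨by linarith, by linarith⟩, Or.inl ⟨⟨k, h3⟩, Or.inr (Or.inr (Or.inr
        (by simp)))⟩⟩
  by_cases h'' : t < 4 * p + 3 * n
  · have h1 := Nat.floor_le (a := (t - 4 * p) / 3) (by linarith)
    have h2 := Nat.lt_floor_add_one ((t - 4 * p) / 3)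
    have h3 : ⌊(t - 4 * p) / 3⌋₊ < n := by
      have : (⌊(t - 4 * p) / 3⌋₊ : ℝ) < n := by linarith
      exact_mod_cast this
    set k := ⌊(t - 4 * p) / 3⌋₊
    by_cases c1 : t ≤ 4 * p + 3 * k + 1
    · exact ⟨t - 4 * p - 3 * k, ⟨by linarith, by linarith⟩, Or.inr (Or.inl ⟨⟨k, h3⟩, Or.inl
        (by ring)⟩)⟩
    by_cases c2 : t ≤ 4 * p + 3 * k + 2
    · exact ⟨t - 4 * p - 3 * k - 1, ⟨by linarith, by linarith⟩, Or.inr (Or.inl ⟨⟨k, h3⟩,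
        Or.inr (Or.inl (by ring))⟩)⟩
    · exact ⟨4 * p + 3 * k + 3 - t, ⟨by linarith, by linarith⟩, Or.inr (Or.inl ⟨⟨k, h3⟩,
        Or.inr (Or.inr (by ring))⟩)⟩
  · exact ⟨t - 4 * p - 3 * n, ⟨by linarith, by linarith [ht.2]⟩, Or.inr (Or.inr (Or.inl (by ring)))⟩

end SideCurve

end OrientedSurface

/-! ### Homotopy between the surface and the wedge of circles -/

namespace OrientedSurface

open Path.Homotopic.Quotient

variable {p n : ℕ}

/-- The curves on the surface that correspond to the free basis of its fundamental group. -/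
noncomputable def basisCurve (p n : ℕ) : SurfaceBasis p n → C(ℝ, OrientedSurface p (n + 1))
  | Sum.inl (i, false) => (boundary p (n + 1)).comp ⟨fun t => 4 * (i : ℕ) + t, by fun_prop⟩
  | Sum.inl (i, true) => (boundary p (n + 1)).comp ⟨fun t => 4 * (i : ℕ) + 1 + t, by fun_prop⟩
  | Sum.inr j => (boundary p (n + 1)).comp ⟨fun t => 4 * p + 3 * (j : ℕ) + 3 * t, by fun_prop⟩

theorem boundary_four_mul (i : ℕ) (hi : i ≤ p) :
    boundary p (n + 1) (4 * i) = basePoint p (n + 1) := bd_four_mul p (n + 1) i hi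

theorem boundary_four_mul_add (j : ℕ) (hj : j ≤ n + 1) :
    boundary p (n + 1) (4 * p + 3 * j) = basePoint p (n + 1) := bd_four_mul_add p (n + 1) j hj

theorem boundary_four_mul_add_three (i : Fin p) :
    boundary p (n + 1) (4 * (i : ℕ) + 3) = basePoint p (n + 1) := by
  have h := (compatible_boundary p n).a i 0 (by simp)
  rw [add_zero, sub_zero] at h
  rw [← h, boundary_four_mul i i.2.le]

theorem boundary_four_mul_add_two (i : Fin p) :
    boundary p (n + 1) (4 * (i : ℕ) + 2) = basePoint p (n + 1) := by
  have h := (compatible_boundary p n).b i 1 (by simp)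
  rw [show (4 * (i : ℕ) + 1 + 1 : ℝ) = 4 * (i : ℕ) + 2 by ring,
    show (4 * (i : ℕ) + 4 - 1 : ℝ) = 4 * (i : ℕ) + 3 by ring, boundary_four_mul_add_three] at h
  exact h

theorem boundary_four_mul_add_one (i : Fin p) :
    boundary p (n + 1) (4 * (i : ℕ) + 1) = basePoint p (n + 1) := by
  have h := (compatible_boundary p n).a i 1 (by simp)
  rw [show (4 * (i : ℕ) + 3 - 1 : ℝ) = 4 * (i : ℕ) + 2 by ring, boundary_four_mul_add_two] at h
  exact h

theorem basisCurve_zero (s : SurfaceBasis p n) : basisCurve p n s 0 = basePoint p (n + 1) := by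
  rcases s with ⟨i, - | -⟩ | j
  · change boundary p (n + 1) (4 * (i : ℕ) + 0) = _
    rw [add_zero, boundary_four_mul i i.2.le]
  · change boundary p (n + 1) (4 * (i : ℕ) + 1 + 0) = _
    rw [add_zero, boundary_four_mul_add_one]
  · change boundary p (n + 1) (4 * p + 3 * (j : ℕ) + 3 * 0) = _
    rw [mul_zero, add_zero, boundary_four_mul_add j (by omega)]

theorem basisCurve_one (s : SurfaceBasis p n) : basisCurve p n s 1 = basePoint p (n + 1) := by
  rcases s with ⟨i, - | -⟩ | j
  · exact boundary_four_mul_add_one i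
  · change boundary p (n + 1) (4 * (i : ℕ) + 1 + 1) = _
    rw [show (4 * (i : ℕ) + 1 + 1 : ℝ) = 4 * (i : ℕ) + 2 by ring, boundary_four_mul_add_two]
  · change boundary p (n + 1) (4 * p + 3 * (j : ℕ) + 3 * 1) = _
    have h := boundary_four_mul_add (p := p) (n := n) (j + 1) (by omega)
    rw [← h]
    congr 1
    push_cast
    ring

/-- The map from a wedge of circles to the surface. -/
noncomputable def ofWedge (p n : ℕ) : C(Wedge (SurfaceBasis p n), OrientedSurface p (n + 1)) :=
  Wedge.desc (basisCurve p n) (basePoint p (n + 1)) basisCurve_zero basisCurve_one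

/-- The word read on the boundary of the polygon, as a curve in a wedge of circles. -/
noncomputable def wedgeCurve (p n : ℕ) : C(ℝ, Wedge (SurfaceBasis p n)) :=
  wordCurve (Wedge.circle_zero (SurfaceBasis p n)) Wedge.circle_one

/-- Checked side by side: crushed arcs go to the base point, and a free side goes to the full loop
around the arc and the boundary circle. -/
theorem ofWedge_wedgeCurve {t : ℝ} (ht : t ∈ Set.Icc (-1 : ℝ) (4 * p + 3 * n + 1)) :
    ofWedge p n (wedgeCurve p n t) = boundary p (n + 1) (collapse p n t) := by
  have hc : ∀ s t, t ∈ Set.Icc (0 : ℝ) 1 →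
      ofWedge p n (Wedge.circle s t) = basisCurve p n s t := fun s t ht =>
    Wedge.desc_circle _ _ _ _ s ht
  have hb : ofWedge p n (Wedge.base _) = basePoint p (n + 1) := rfl
  obtain ⟨s, hs, ⟨i, h⟩ | ⟨j, h⟩ | h⟩ := side_cases ht
  · have hi : ((i : ℕ) : ℝ) + 1 ≤ p := by exact_mod_cast i.2
    have hi0 : (0 : ℝ) ≤ (i : ℕ) := Nat.cast_nonneg _
    have hs0 := hs.1
    have hs1 := hs.2
    obtain ⟨w1, w2, w3, w4⟩ := wordCurve_handle (Wedge.circle_zero (SurfaceBasis p n))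
      Wedge.circle_one hs i
    have hm : collapse p n t = t := by
      rw [collapse_of_le, max_eq_right] <;> rcases h with rfl | rfl | rfl | rfl <;> linarith
    rw [hm, wedgeCurve]
    rcases h with rfl | rfl | rfl | rfl
    · rw [w1, hc _ _ hs]
      rfl
    · rw [w2, hc _ _ hs]
      rfl
    · rw [w3, hc _ _ hs, ← (compatible_boundary p n).a i s hs]
      rfl
    · rw [w4, hc _ _ hs, ← (compatible_boundary p n).b i s hs]
      rfl
  · have hs0 := hs.1
    have hs1 := hs.2
    obtain ⟨w1, w2⟩ := wordCurve_arc (p := p) (n := n) (Wedge.circle_zero (SurfaceBasis p n))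
      Wedge.circle_one hs j
    rw [wedgeCurve]
    rcases h with rfl | rfl | rfl
    · rw [w1, collapse_add j.2 ⟨hs0, by linarith⟩, min_eq_right (by linarith),
        max_eq_left (by linarith), mul_zero, add_zero, boundary_four_mul_add j (by omega), hb]
    · rw [wordCurve_boundary _ _ hs, hc _ _ hs, add_assoc (4 * p + 3 * (j : ℕ) : ℝ),
        collapse_add j.2 ⟨by linarith, by linarith⟩, add_sub_cancel_left, min_eq_right hs1,
        max_eq_right hs0]
      rfl
    · rw [w2, add_sub_assoc, collapse_add j.2 ⟨by linarith, by linarith⟩,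
        min_eq_left (by linarith), max_eq_right zero_le_one, hb,
        ← boundary_four_mul_add (p := p) (n := n) (j + 1) (by omega)]
      congr 1
      push_cast
      ring
  · have hs0 := hs.1
    have hp : (0 : ℝ) ≤ p := p.cast_nonneg
    rw [wedgeCurve]
    rcases h with rfl | rfl
    · rw [(wordCurve_arc _ _ hs n).1, collapse_of_ge (by linarith), hb,
        boundary_four_mul_add n (by omega)]
    · rw [wordCurve_neg _ _ hs, collapse_of_le (by linarith), max_eq_left (by linarith), hb]
      rfl

section Retraction

variable (ρ : C(PolygonDisc, ℝ))
  (hρ : ∀ t ∈ Set.Icc (-1 : ℝ) (4 * p + 3 * n + 1), ρ (polygonBoundary p (n + 1) t) = t)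

/-- The map on the surface that is given by a curve which is compatible with the gluing. -/
noncomputable def descArc {Z : Type*} [TopologicalSpace Z] (G : C(ℝ, Z)) (hG : Compatible p n G) :
    C(OrientedSurface p (n + 1), Z) where
  toFun := Quot.lift (fun z => G (ρ z)) (hG.glue fun t ht => by rw [hρ t ht])
  continuous_toFun := continuous_quot_lift _ (G.comp ρ).continuous

theorem descArc_boundary {Z : Type*} [TopologicalSpace Z] (G : C(ℝ, Z)) (hG : Compatible p n G)
    {t : ℝ} (ht : t ∈ Set.Icc (-1 : ℝ) (4 * p + 3 * n + 1)) :
    descArc ρ hρ G hG (boundary p (n + 1) t) = G t :=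
  congrArg G (hρ t ht)

variable (p n) in
/-- The homotopy along straight lines from the identity of the polygon to the retraction onto a
part of the boundary. -/
noncomputable def discHomotopy : C(PolygonDisc × ℝ, PolygonDisc) where
  toFun q := ⟨(1 - max 0 (min 1 q.2)) • q.1.1 +
    max 0 (min 1 q.2) • (polygonBoundary p (n + 1) (ρ q.1)).1, by
      have h := (convex_closedBall (0 : ℂ) 1) (x := q.1.1) (by simpa using q.1.2)
        (y := (polygonBoundary p (n + 1) (ρ q.1)).1)
        (by simpa using (polygonBoundary p (n + 1) (ρ q.1)).2)
        (a := 1 - max 0 (min 1 q.2)) (b := max 0 (min 1 q.2))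
        (by linarith [max_le zero_le_one (min_le_left (1 : ℝ) q.2)]) (le_max_left _ _) (by ring)
      simpa using h⟩
  continuous_toFun := by
    refine Continuous.subtype_mk ?_ _
    have h1 : Continuous fun q : PolygonDisc × ℝ => (polygonBoundary p (n + 1) (ρ q.1)).1 :=
      continuous_subtype_val.comp
        ((continuous_polygonBoundary p (n + 1)).comp (ρ.continuous.comp continuous_fst))
    fun_prop

theorem discHomotopy_zero (z : PolygonDisc) : discHomotopy p n ρ (z, 0) = z := by
  refine Subtype.ext ?_
  simp [discHomotopy]

theorem discHomotopy_one (z : PolygonDisc) :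
    discHomotopy p n ρ (z, 1) = polygonBoundary p (n + 1) (ρ z) := by
  refine Subtype.ext ?_
  simp [discHomotopy]

theorem discHomotopy_boundary
    (hρ : ∀ t ∈ Set.Icc (-1 : ℝ) (4 * p + 3 * n + 1), ρ (polygonBoundary p (n + 1) t) = t)
    {t : ℝ} (ht : t ∈ Set.Icc (-1 : ℝ) (4 * p + 3 * n + 1)) (u : ℝ) :
    discHomotopy p n ρ (polygonBoundary p (n + 1) t, u) = polygonBoundary p (n + 1) t := by
  refine Subtype.ext ?_
  simp only [discHomotopy, ContinuousMap.coe_mk]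
  rw [hρ t ht, ← add_smul]
  simp

/-- The homotopy from the identity to the retraction of the surface onto the image of the complement
of the last free side. -/
noncomputable def retractionHomotopy :
    C(OrientedSurface p (n + 1) × ℝ, OrientedSurface p (n + 1)) :=
  descProd ((proj p (n + 1)).comp (discHomotopy p n ρ)) fun z z' h u =>
    (compatible_boundary p n).glue (f := fun z => proj p (n + 1) (discHomotopy p n ρ (z, u)))
      (fun _ ht => congrArg (proj p (n + 1)) (discHomotopy_boundary ρ hρ ht u)) z z' h

/-- The two copies of an arc shrink symmetrically: parameter t becomes (1 - u)t on one and the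
mirror image on the other, so the gluing is respected at every time. -/
theorem compatible_collapse {u : ℝ} (hu : u ∈ Set.Icc (0 : ℝ) 1) : Compatible p n fun t =>
    boundary p (n + 1) ((1 - u) * t + u * collapse p n t) where
  a i t ht := by
    have hi : ((i : ℕ) : ℝ) + 1 ≤ p := by exact_mod_cast i.2
    have hi0 : (0 : ℝ) ≤ (i : ℕ) := Nat.cast_nonneg _
    have ht0 := ht.1
    have ht1 := ht.2
    rw [collapse_of_le (by linarith), collapse_of_le (by linarith), max_eq_right (by linarith),
      max_eq_right (by linarith), ← add_mul, ← add_mul, sub_add_cancel, one_mul, one_mul]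
    exact (compatible_boundary p n).a i t ht
  b i t ht := by
    have hi : ((i : ℕ) : ℝ) + 1 ≤ p := by exact_mod_cast i.2
    have hi0 : (0 : ℝ) ≤ (i : ℕ) := Nat.cast_nonneg _
    have ht0 := ht.1
    have ht1 := ht.2
    rw [collapse_of_le (by linarith), collapse_of_le (by linarith), max_eq_right (by linarith),
      max_eq_right (by linarith), ← add_mul, ← add_mul, sub_add_cancel, one_mul, one_mul]
    exact (compatible_boundary p n).b i t ht
  c j t ht := by
    have ht0 := ht.1
    have ht1 := ht.2
    rw [collapse_add j.2 ⟨ht0, by linarith⟩, add_sub_assoc,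
      collapse_add j.2 ⟨by linarith, by linarith⟩, min_eq_right (by linarith),
      max_eq_left (by linarith), min_eq_left (by linarith), max_eq_right zero_le_one]
    convert (compatible_boundary p n).c j ((1 - u) * t)
      ⟨mul_nonneg (by linarith [hu.2]) ht0, by nlinarith [hu.1, hu.2]⟩ using 2 <;> ring
  last t ht := by
    have ht0 := ht.1
    have hp : (0 : ℝ) ≤ p := p.cast_nonneg
    rw [collapse_of_ge (by linarith), collapse_of_le (by linarith), max_eq_left (by linarith)]
    convert (compatible_boundary p n).last ((1 - u) * t)
      ⟨mul_nonneg (by linarith [hu.2]) ht0, by nlinarith [hu.1, hu.2, ht.2]⟩ using 2 <;> ring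

/-- The homotopy that collapses the arcs from the base point to the boundary circles. -/
noncomputable def collapseHomotopy :
    C(OrientedSurface p (n + 1) × ℝ, OrientedSurface p (n + 1)) :=
  descProd ((boundary p (n + 1)).comp
      (⟨fun q => (1 - max 0 (min 1 q.2)) * ρ q.1 + max 0 (min 1 q.2) * collapse p n (ρ q.1),
        by fun_prop⟩ : C(PolygonDisc × ℝ, ℝ))) fun z z' h u =>
    (compatible_collapse ⟨le_max_left _ _, max_le zero_le_one (min_le_left 1 u)⟩).glue
      (f := fun z => boundary p (n + 1) ((1 - max 0 (min 1 u)) * ρ z +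
        max 0 (min 1 u) * collapse p n (ρ z)))
      (fun t ht => by rw [hρ t ht]) z z' h

/-- The map from the surface to a wedge of circles. -/
noncomputable def toWedge : C(OrientedSurface p (n + 1), Wedge (SurfaceBasis p n)) :=
  descArc ρ hρ (wedgeCurve p n) (compatible_wordCurve _ _)

theorem toWedge_basePoint : toWedge ρ hρ (basePoint p (n + 1)) = Wedge.base _ := by
  have hz : (0 : ℝ) ∈ Set.Icc (-1 : ℝ) (4 * p + 3 * n + 1) := ⟨by norm_num, by positivity⟩
  refine (descArc_boundary ρ hρ _ _ hz).trans ?_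
  have := wordCurve_neg (Wedge.circle_zero (SurfaceBasis p n)) Wedge.circle_one (t := 0) (by simp)
  rwa [neg_zero] at this

/-- Two homotopies fixing the base point are chained: the identity to the retraction of the polygon
onto the arc, then the retraction to its composition with the collapse, which factors through the
wedge. -/
theorem cast_map_toWedge_ofWedge (hρ' : ∀ z, ρ z ∈ Set.Icc (-1 : ℝ) (4 * p + 3 * n + 1))
    (q : Path.Homotopic.Quotient (basePoint p (n + 1)) (basePoint p (n + 1))) :
    q = ((q.map (toWedge ρ hρ)).cast (toWedge_basePoint ρ hρ).symm
      (toWedge_basePoint ρ hρ).symm).map (ofWedge p n) := by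
  have hz : (0 : ℝ) ∈ Set.Icc (-1 : ℝ) (4 * p + 3 * n + 1) := ⟨by norm_num, by positivity⟩
  have hρ0 : ρ (polygonBoundary p (n + 1) 0) = 0 := hρ 0 hz
  have hc0 : collapse p n 0 = 0 := by
    rw [collapse_of_le (by positivity), max_self]
  let φ := descArc ρ hρ (boundary p (n + 1)) (compatible_boundary p n)
  have hφ : basePoint p (n + 1) = φ (basePoint p (n + 1)) :=
    (descArc_boundary ρ hρ (boundary p (n + 1)) (compatible_boundary p n) hz).symm
  have h1 := map_eq_of_homotopy (retractionHomotopy ρ hρ) (x := basePoint p (n + 1))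
    (y := basePoint p (n + 1)) (f₀ := ContinuousMap.id _) (f₁ := φ)
    (fun z => by
      obtain ⟨z, rfl⟩ := (isQuotientMap_proj p (n + 1)).surjective z
      exact congrArg (proj p (n + 1)) (discHomotopy_zero ρ z))
    (fun z => by
      obtain ⟨z, rfl⟩ := (isQuotientMap_proj p (n + 1)).surjective z
      exact congrArg (proj p (n + 1)) (discHomotopy_one ρ z))
    (fun u => congrArg (proj p (n + 1)) (discHomotopy_boundary ρ hρ hz u)) rfl hφ q
  have h2 := map_eq_of_homotopy (collapseHomotopy ρ hρ) (x := basePoint p (n + 1))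
    (y := basePoint p (n + 1)) (f₀ := φ)
    (f₁ := (ofWedge p n).comp (toWedge ρ hρ))
    (fun z => by
      obtain ⟨z, rfl⟩ := (isQuotientMap_proj p (n + 1)).surjective z
      change boundary p (n + 1) ((1 - max 0 (min 1 0)) * ρ z +
        max 0 (min 1 0) * collapse p n (ρ z)) = boundary p (n + 1) (ρ z)
      simp)
    (fun z => by
      obtain ⟨z, rfl⟩ := (isQuotientMap_proj p (n + 1)).surjective z
      change boundary p (n + 1) ((1 - max 0 (min 1 1)) * ρ z +
        max 0 (min 1 1) * collapse p n (ρ z)) = ofWedge p n (wedgeCurve p n (ρ z))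
      rw [ofWedge_wedgeCurve (hρ' z)]
      simp)
    (fun u => by
      change boundary p (n + 1) ((1 - max 0 (min 1 u)) * ρ (polygonBoundary p (n + 1) 0) +
        max 0 (min 1 u) * collapse p n (ρ (polygonBoundary p (n + 1) 0))) = basePoint p (n + 1)
      rw [hρ0, hc0, mul_zero, mul_zero, add_zero]
      rfl) hφ (by
      change _ = ofWedge p n (toWedge ρ hρ (basePoint p (n + 1)))
      rw [toWedge_basePoint]
      rfl) q
  have h3 : (q.map (ContinuousMap.id _)).cast rfl rfl = q := by
    induction q with | mk p => rfl
  have h4 := h3.symm.trans (h1.trans h2)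
  rw [map_comp] at h4
  rw [Path.Homotopic.Quotient.map_cast]
  exact h4

end Retraction

end OrientedSurface

namespace OrientedSurface

open Path.Homotopic.Quotient

variable {p n : ℕ}

/-! #### The fundamental group of the surface -/

/-- The classes of the loops that correspond to the free basis of the fundamental group. -/
noncomputable def basisClass (s : SurfaceBasis p n) :
    FundamentalGroup (OrientedSurface p (n + 1)) (basePoint p (n + 1)) :=
  FundamentalGroup.fromPath
    ((seg (basisCurve p n s) 0 1).cast (basisCurve_zero s).symm (basisCurve_one s).symm)

/-- The class of a part of the boundary of the polygon whose end points are sent to the base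
point. -/
noncomputable def arcClass (s t : ℝ) (hs : boundary p (n + 1) s = basePoint p (n + 1))
    (ht : boundary p (n + 1) t = basePoint p (n + 1)) :
    FundamentalGroup (OrientedSurface p (n + 1)) (basePoint p (n + 1)) :=
  FundamentalGroup.fromPath ((seg (boundary p (n + 1)) s t).cast hs.symm ht.symm)

/-- In the fundamental group the right factor is travelled first. This is why the isomorphisms with
free groups use inverse classes: those multiply in the order of the path. -/
theorem arcClass_mul {s t u : ℝ} (hs : boundary p (n + 1) s = basePoint p (n + 1))
    (ht : boundary p (n + 1) t = basePoint p (n + 1))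
    (hu : boundary p (n + 1) u = basePoint p (n + 1)) :
    arcClass t u ht hu * arcClass s t hs ht = arcClass s u hs hu := by
  change FundamentalGroup.fromPath (((seg (boundary p (n + 1)) s t).cast hs.symm ht.symm).trans
    ((seg (boundary p (n + 1)) t u).cast ht.symm hu.symm)) = _
  rw [cast_trans_cast, seg_trans]
  rfl

theorem arcClass_inv {s t : ℝ} (hs : boundary p (n + 1) s = basePoint p (n + 1))
    (ht : boundary p (n + 1) t = basePoint p (n + 1)) :
    (arcClass s t hs ht)⁻¹ = arcClass t s ht hs := by
  change FundamentalGroup.fromPath ((seg (boundary p (n + 1)) s t).cast hs.symm ht.symm).symm = _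
  rw [symm_cast, seg_symm]
  rfl

theorem arcClass_self {s : ℝ} (hs : boundary p (n + 1) s = basePoint p (n + 1)) :
    arcClass s s hs hs = 1 :=
  mul_eq_left.1 (arcClass_mul hs hs hs)

theorem arcClass_congr {s t s' t' : ℝ} (hs : boundary p (n + 1) s = basePoint p (n + 1))
    (ht : boundary p (n + 1) t = basePoint p (n + 1)) (es : s = s') (et : t = t') :
    arcClass s t hs ht = arcClass s' t' (es ▸ hs) (et ▸ ht) := by
  subst es et
  rfl

theorem basisClass_eq_arcClass (s : SurfaceBasis p n) (g : C(ℝ, ℝ)) {a b : ℝ} (ha : g 0 = a)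
    (hb : g 1 = b) (h : ∀ u ∈ Set.Icc (0 : ℝ) 1, basisCurve p n s u = boundary p (n + 1) (g u)) :
    basisClass s = arcClass a b
      (by rw [← ha, ← h 0 (by simp), basisCurve_zero])
      (by rw [← hb, ← h 1 (by simp), basisCurve_one]) := by
  subst ha hb
  rw [basisClass, seg_congr (g := (boundary p (n + 1)).comp g)
    (by rwa [Set.uIcc_of_le zero_le_one]), seg_comp]
  rfl

theorem basisClass_handle (i : Fin p) :
    basisClass (n := n) (Sum.inl (i, false)) = arcClass (4 * (i : ℕ)) (4 * (i : ℕ) + 1)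
      (boundary_four_mul i i.2.le) (boundary_four_mul_add_one i) ∧
    basisClass (n := n) (Sum.inl (i, true)) = arcClass (4 * (i : ℕ) + 1) (4 * (i : ℕ) + 2)
      (boundary_four_mul_add_one i) (boundary_four_mul_add_two i) ∧
    basisClass (n := n) (Sum.inl (i, false)) = arcClass (4 * (i : ℕ) + 3) (4 * (i : ℕ) + 2)
      (boundary_four_mul_add_three i) (boundary_four_mul_add_two i) ∧
    basisClass (n := n) (Sum.inl (i, true)) = arcClass (4 * ((i + 1 : ℕ) : ℝ)) (4 * (i : ℕ) + 3)
      (boundary_four_mul _ i.2) (boundary_four_mul_add_three i) := by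
  refine ⟨basisClass_eq_arcClass _ ⟨fun t => 4 * (i : ℕ) + t, by fun_prop⟩ ?_ ?_ ?_,
    basisClass_eq_arcClass _ ⟨fun t => 4 * (i : ℕ) + 1 + t, by fun_prop⟩ ?_ ?_ ?_,
    basisClass_eq_arcClass _ ⟨fun t => 4 * (i : ℕ) + 3 - t, by fun_prop⟩ ?_ ?_ ?_,
    basisClass_eq_arcClass _ ⟨fun t => 4 * (i : ℕ) + 4 - t, by fun_prop⟩ ?_ ?_ ?_⟩
  · exact add_zero _
  · rfl
  · exact fun _ _ => rfl
  · exact add_zero _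
  · change 4 * ((i : ℕ) : ℝ) + 1 + 1 = 4 * (i : ℕ) + 2
    ring
  · exact fun _ _ => rfl
  · exact sub_zero _
  · change 4 * ((i : ℕ) : ℝ) + 3 - 1 = 4 * (i : ℕ) + 2
    ring
  · exact fun u hu => (compatible_boundary p n).a i u hu
  · change 4 * ((i : ℕ) : ℝ) + 4 - 0 = 4 * ((i + 1 : ℕ) : ℝ)
    push_cast
    ring
  · change 4 * ((i : ℕ) : ℝ) + 4 - 1 = 4 * (i : ℕ) + 3
    ring
  · exact fun u hu => (compatible_boundary p n).b i u hu

theorem fromPath_boundaryLoop (j : Fin (n + 1)) :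
    FundamentalGroup.fromPath (mk (boundaryLoop p (n + 1) j)) =
      arcClass (4 * p + 3 * (j : ℕ)) (4 * p + 3 * ((j + 1 : ℕ) : ℝ))
        (boundary_four_mul_add j j.2.le) (boundary_four_mul_add (j + 1) j.2) := by
  have h := mk_eq_seg (boundary p (n + 1)) (boundaryLoop p (n + 1) j)
    ⟨fun t => 4 * p + 3 * (j : ℕ) + 3 * (t : ℝ), by fun_prop⟩ fun _ => rfl
  refine (congrArg FundamentalGroup.fromPath h).trans (arcClass_congr ?_ ?_ ?_ ?_)
  · simpa using boundary_four_mul_add (j : ℕ) j.2.le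
  · have h := boundary_four_mul_add (p := p) (n := n) (j + 1) j.2
    rw [← h]
    congr 1
    simp
    ring
  · simp
  · simp
    ring

theorem basisClass_boundary (j : Fin n) :
    basisClass (p := p) (Sum.inr j) = FundamentalGroup.fromPath
      (mk (boundaryLoop p (n + 1) j.castSucc)) := by
  rw [fromPath_boundaryLoop]
  refine basisClass_eq_arcClass _ ⟨fun t => 4 * p + 3 * (j : ℕ) + 3 * t, by fun_prop⟩ ?_ ?_ ?_
  · simp
  · simp
    ring
  · exact fun _ _ => rfl

/-- Each handle contributes its four sides in order. -/
theorem inv_arcClass_handles (k : ℕ) (hk : k ≤ p) :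
    (arcClass (4 * (0 : ℕ)) (4 * k) (boundary_four_mul 0 p.zero_le)
      (boundary_four_mul (n := n) k hk))⁻¹ =
    (List.ofFn fun i : Fin k => (basisClass (Sum.inl (Fin.castLE hk i, false)))⁻¹ *
      (basisClass (Sum.inl (Fin.castLE hk i, true)))⁻¹ *
      ((basisClass (Sum.inl (Fin.castLE hk i, false)))⁻¹)⁻¹ *
      ((basisClass (Sum.inl (Fin.castLE hk i, true)))⁻¹)⁻¹).prod := by
  induction k with
  | zero => rw [List.ofFn_zero, List.prod_nil, arcClass_self, inv_one]
  | succ k ih =>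
    rw [List.ofFn_succ', List.concat_eq_append, List.prod_append, List.prod_singleton]
    have h1 := ih (by omega)
    have e : ∀ i : Fin k, Fin.castLE hk i.castSucc = Fin.castLE (by omega) i := fun i => rfl
    simp only [e]
    rw [← h1]
    obtain ⟨b1, b2, b3, b4⟩ := basisClass_handle (n := n) ⟨k, hk⟩
    have e' : Fin.castLE hk (Fin.last k) = ⟨k, hk⟩ := rfl
    rw [e', inv_inv, inv_inv]
    dsimp only at b1 b2 b3 b4
    -- The first occurrences of the two classes are read on sides 0 and 1 of the handle, the others
    -- on the glued copies 2 and 3, so that consecutive arcs compose.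
    nth_rw 1 [b1]
    nth_rw 1 [b2]
    rw [b3, b4]
    simp only [arcClass_inv, arcClass_mul]

theorem inv_arcClass_boundary (k : ℕ) (hk : k ≤ n + 1) :
    (arcClass (4 * (p : ℝ)) (4 * p + 3 * k) (boundary_four_mul p le_rfl)
      (boundary_four_mul_add k hk))⁻¹ =
    (List.ofFn fun j : Fin k => (FundamentalGroup.fromPath
      (mk (boundaryLoop p (n + 1) (Fin.castLE hk j))))⁻¹).prod := by
  induction k with
  | zero =>
    rw [List.ofFn_zero, List.prod_nil, arcClass_congr (s' := 4 * p) (t' := 4 * p) _ _ rfl (by simp),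
      arcClass_self, inv_one]
  | succ k ih =>
    rw [List.ofFn_succ', List.concat_eq_append, List.prod_append, List.prod_singleton]
    have h1 := ih (by omega)
    have e : ∀ i : Fin k, Fin.castLE hk i.castSucc = Fin.castLE (by omega) i := fun i => rfl
    have e' : Fin.castLE hk (Fin.last k) = ⟨k, hk⟩ := rfl
    simp only [e]
    rw [← h1, e', fromPath_boundaryLoop, arcClass_inv, arcClass_inv, arcClass_inv]
    exact (arcClass_mul _ _ _).symm

/-- The boundary of the polygon is a loop in a contractible disc: this is the one relation of the
surface. -/
theorem arcClass_full : arcClass (4 * (0 : ℕ)) (4 * p + 3 * (n + 1 : ℕ))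
    (boundary_four_mul (p := p) (n := n) 0 p.zero_le) (boundary_four_mul_add (n + 1) le_rfl) = 1 := by
  have : ContractibleSpace PolygonDisc := by
    have h := (convex_closedBall (0 : ℂ) 1).contractibleSpace ⟨0, by simp⟩
    have e : Metric.closedBall (0 : ℂ) 1 = {z : ℂ | ‖z‖ ≤ 1} := by
      ext z
      simp
    rw [e] at h
    exact h
  have : SimplyConnectedSpace PolygonDisc := inferInstance
  let P : C(ℝ, PolygonDisc) := ⟨_, continuous_polygonBoundary p (n + 1)⟩
  have h0 : P (4 * (0 : ℕ)) = P (4 * p + 3 * (n + 1 : ℕ)) := by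
    have := polygonBoundary_sub p (n + 1) n.succ_pos 0
    rw [neg_zero, sub_zero] at this
    change polygonBoundary _ _ _ = polygonBoundary _ _ _
    rw [this, Nat.cast_zero, mul_zero]
  have h1 : (seg P (4 * (0 : ℕ)) (4 * p + 3 * (n + 1 : ℕ))).cast rfl h0 =
      Path.Homotopic.Quotient.refl _ := by
    generalize (seg P (4 * (0 : ℕ)) (4 * p + 3 * (n + 1 : ℕ))).cast rfl h0 = q
    induction q with | mk q => ?_
    exact Path.Homotopic.Quotient.eq.2 (SimplyConnectedSpace.paths_homotopic _ _)
  have h2 := congrArg (fun q => (q.map (proj p (n + 1))).cast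
    (boundary_four_mul (p := p) (n := n) 0 p.zero_le).symm
    (boundary_four_mul (p := p) (n := n) 0 p.zero_le).symm) h1
  rw [Path.Homotopic.Quotient.map_cast, map_seg] at h2
  refine Eq.trans h2 ?_
  exact cast_refl (boundary_four_mul (p := p) (n := n) 0 p.zero_le).symm _

theorem ofWedge_base : ofWedge p n (Wedge.base _) = basePoint p (n + 1) := rfl

/-- Handle curves go to the circles with the same parameter. A boundary loop goes to its circle with
parameter 3u - 1, since its outer thirds run along the crushed arcs. -/
theorem mapOfEq_toWedge_basisClass (ρ : C(PolygonDisc, ℝ))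
    (hρ : ∀ t ∈ Set.Icc (-1 : ℝ) (4 * p + 3 * n + 1), ρ (polygonBoundary p (n + 1) t) = t)
    (s : SurfaceBasis p n) :
    FundamentalGroup.mapOfEq (toWedge ρ hρ) (toWedge_basePoint ρ hρ) (basisClass s) =
      Wedge.petal s := by
  have hb : ∀ t : ℝ, t ∈ Set.Icc (-1 : ℝ) (4 * p + 3 * n + 1) →
      toWedge ρ hρ (boundary p (n + 1) t) = wedgeCurve p n t := fun t ht =>
    descArc_boundary ρ hρ _ _ ht
  have hn : (0 : ℝ) ≤ n := n.cast_nonneg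
  have hp : (0 : ℝ) ≤ p := p.cast_nonneg
  obtain ⟨g, hg0, hg1, hg⟩ : ∃ g : C(ℝ, ℝ), g 0 ≤ 0 ∧ 1 ≤ g 1 ∧
      ∀ u ∈ Set.Icc (0 : ℝ) 1, toWedge ρ hρ (basisCurve p n s u) = Wedge.circle s (g u) := by
    rcases s with ⟨i, - | -⟩ | j
    · have hi : ((i : ℕ) : ℝ) + 1 ≤ p := by exact_mod_cast i.2
      have hi0 : (0 : ℝ) ≤ (i : ℕ) := Nat.cast_nonneg _
      refine ⟨ContinuousMap.id ℝ, le_rfl, le_rfl, fun u hu => ?_⟩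
      refine (hb (4 * (i : ℕ) + u) ⟨by linarith [hu.1], by linarith [hu.2]⟩).trans ?_
      exact (wordCurve_handle _ _ hu i).1
    · have hi : ((i : ℕ) : ℝ) + 1 ≤ p := by exact_mod_cast i.2
      have hi0 : (0 : ℝ) ≤ (i : ℕ) := Nat.cast_nonneg _
      refine ⟨ContinuousMap.id ℝ, le_rfl, le_rfl, fun u hu => ?_⟩
      refine (hb (4 * (i : ℕ) + 1 + u) ⟨by linarith [hu.1], by linarith [hu.2]⟩).trans ?_
      exact (wordCurve_handle _ _ hu i).2.1
    · have hj : ((j : ℕ) : ℝ) + 1 ≤ n := by exact_mod_cast j.2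
      have hj0 : (0 : ℝ) ≤ (j : ℕ) := Nat.cast_nonneg _
      refine ⟨⟨fun u => 3 * u - 1, by fun_prop⟩, by norm_num, by norm_num, fun u hu => ?_⟩
      refine (hb (4 * p + 3 * (j : ℕ) + 3 * u)
        ⟨by linarith [hu.1], by linarith [hu.2]⟩).trans ?_
      change wedgeCurve p n _ = Wedge.circle (Sum.inr j) (3 * u - 1)
      by_cases c1 : 3 * u ≤ 1
      · rw [Wedge.circle_eq_base.2 (Or.inl (by linarith))]
        exact (wordCurve_arc _ _ ⟨by linarith [hu.1], c1⟩ j).1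
      by_cases c2 : 3 * u ≤ 2
      · have h := wordCurve_boundary (p := p) (Wedge.circle_zero (SurfaceBasis p n))
          Wedge.circle_one (t := 3 * u - 1) ⟨by linarith, by linarith⟩ j
        rw [← h]
        congr 1
        ring
      · rw [Wedge.circle_eq_base.2 (Or.inr (by linarith))]
        have h := (wordCurve_arc (p := p) (Wedge.circle_zero (SurfaceBasis p n))
          Wedge.circle_one (t := 3 - 3 * u) ⟨by linarith [hu.2], by linarith⟩ j).2
        refine Eq.trans ?_ h
        congr 1
        ring
  rw [FundamentalGroup.mapOfEq_apply, Wedge.petal_eq s hg0 hg1]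
  change (((seg (basisCurve p n s) 0 1).cast _ _).map (toWedge ρ hρ)).cast _ _ = _
  rw [Path.Homotopic.Quotient.map_cast, map_seg,
    seg_congr (g := (Wedge.circle s).comp g) (by rwa [Set.uIcc_of_le zero_le_one]), seg_comp]
  rfl

/-- Injectivity is inherited from the wedge through the map to it. Surjectivity holds because every
loop comes back from the wedge, where the circles generate. -/
theorem lift_basisClass_bijective :
    Function.Bijective (FreeGroup.lift fun s : SurfaceBasis p n => (basisClass s)⁻¹) := by
  obtain ⟨ρ, hρ', hρ⟩ := exists_retraction p n
  have hf : FreeGroup.lift (fun s : SurfaceBasis p n => (basisClass s)⁻¹) =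
      (FundamentalGroup.mapOfEq (ofWedge p n) ofWedge_base).comp
        (FreeGroup.lift fun s => (Wedge.petal s)⁻¹) := FreeGroup.ext_hom _ _ fun s => by
    rw [MonoidHom.comp_apply, FreeGroup.lift_apply_of, FreeGroup.lift_apply_of, _root_.map_inv]
    exact congrArg (·⁻¹) (Wedge.map_desc_petal _ _ _ _ s).symm
  have hg : (FundamentalGroup.mapOfEq (toWedge ρ hρ) (toWedge_basePoint ρ hρ)).comp
      (FreeGroup.lift fun s => (basisClass s)⁻¹) = FreeGroup.lift fun s => (Wedge.petal s)⁻¹ :=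
    FreeGroup.ext_hom _ _ fun s => by
    rw [MonoidHom.comp_apply, FreeGroup.lift_apply_of, FreeGroup.lift_apply_of, _root_.map_inv,
      mapOfEq_toWedge_basisClass]
  constructor
  · refine Function.Injective.of_comp
      (f := FundamentalGroup.mapOfEq (toWedge ρ hρ) (toWedge_basePoint ρ hρ)) ?_
    rw [← MonoidHom.coe_comp, hg]
    exact Wedge.lift_petal_injective
  · intro q
    obtain ⟨w, hw⟩ := Wedge.lift_petal_surjective
      (FundamentalGroup.mapOfEq (toWedge ρ hρ) (toWedge_basePoint ρ hρ) q)
    refine ⟨w, ?_⟩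
    rw [hf, MonoidHom.comp_apply, hw, FundamentalGroup.mapOfEq_apply,
      FundamentalGroup.mapOfEq_apply]
    exact (Path.Homotopic.Quotient.cast_rfl_rfl _).trans
      (cast_map_toWedge_ofWedge ρ hρ hρ' q).symm

variable (p n) in
/-- The fundamental group of the surface is free. -/
noncomputable def freeGroupEquiv : FreeGroup (SurfaceBasis p n) ≃*
    FundamentalGroup (OrientedSurface p (n + 1)) (basePoint p (n + 1)) :=
  MulEquiv.ofBijective _ lift_basisClass_bijective

theorem freeGroupEquiv_of (s : SurfaceBasis p n) :
    freeGroupEquiv p n (FreeGroup.of s) = (basisClass s)⁻¹ :=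
  FreeGroup.lift_apply_of (f := fun s : SurfaceBasis p n => (basisClass s)⁻¹)

/-- For the last component, the arcs of the handles and of the other boundary loops compose to the
boundary of the polygon minus its last three sides, hence to the inverse of the last boundary loop.
-/
theorem freeGroupEquiv_boundaryWord (j : Fin (n + 1)) :
    freeGroupEquiv p n (SurfaceBasis.boundaryWord p n j) =
      (FundamentalGroup.fromPath (mk (boundaryLoop p (n + 1) j)))⁻¹ := by
  induction j using Fin.lastCases with
  | cast j => rw [SurfaceBasis.boundaryWord_castSucc, freeGroupEquiv_of, basisClass_boundary]
  | last =>
    have h1 : freeGroupEquiv p n (SurfaceBasis.handleWord (FreeGroup.of ∘ Sum.inl)) =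
        (arcClass (4 * (0 : ℕ)) (4 * p) (boundary_four_mul 0 p.zero_le)
          (boundary_four_mul p le_rfl))⁻¹ := by
      refine (SurfaceBasis.map_handleWord (freeGroupEquiv p n).toMonoidHom _).trans ?_
      rw [inv_arcClass_handles p le_rfl]
      rw [SurfaceBasis.handleWord]
      congr 2
      funext i
      simp only [Function.comp_apply, MulEquiv.toMonoidHom_eq_coe, MonoidHom.coe_coe,
        freeGroupEquiv_of]
      rfl
    have h2 : freeGroupEquiv p n (List.ofFn fun j : Fin n => FreeGroup.of (Sum.inr j)).prod =
        (arcClass (4 * (p : ℝ)) (4 * p + 3 * n) (boundary_four_mul p le_rfl)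
          (boundary_four_mul_add n n.le_succ))⁻¹ := by
      rw [inv_arcClass_boundary n n.le_succ, map_list_prod, List.map_ofFn]
      congr 2
      funext j
      rw [Function.comp_apply, freeGroupEquiv_of, basisClass_boundary]
      rfl
    rw [SurfaceBasis.boundaryWord_last, _root_.map_inv, _root_.map_mul, h1, h2,
      fromPath_boundaryLoop, ← mul_inv_rev, inv_inv, arcClass_mul]
    refine eq_inv_of_mul_eq_one_right ?_
    exact (arcClass_mul _ _ _).trans arcClass_full

end OrientedSurface

/-! ### Change of base point and conclusion -/

namespace OrientedSurface

open Path.Homotopic.Quotient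

/-- A homeomorphism induces an isomorphism of fundamental groups. -/
noncomputable def _root_.Homeomorph.fundamentalGroupMulEquiv {X Y : Type*} [TopologicalSpace X]
    [TopologicalSpace Y] (h : X ≃ₜ Y) (x : X) :
    FundamentalGroup X x ≃* FundamentalGroup Y (h x) where
  toFun := FundamentalGroup.map ⟨h, h.continuous⟩ x
  invFun := FundamentalGroup.mapOfEq ⟨h.symm, h.symm.continuous⟩ (h.symm_apply_apply x)
  left_inv q := by
    rw [FundamentalGroup.mapOfEq_apply]
    obtain ⟨p, rfl⟩ := mk_surjective q
    exact congrArg mk (Path.ext (funext fun t => h.symm_apply_apply (p t)))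
  right_inv q := by
    rw [FundamentalGroup.mapOfEq_apply]
    obtain ⟨p, rfl⟩ := mk_surjective q
    exact congrArg mk (Path.ext (funext fun t => h.apply_symm_apply (p t)))
  map_mul' := _root_.map_mul _

variable {p n : ℕ} {M : Type*} [TopologicalSpace M]

/-- The isomorphism between the fundamental groups of two homeomorphic spaces that is given by a
change of base points. -/
noncomputable def changeBase (h : OrientedSurface p (n + 1) ≃ₜ M) {x : M}
    (γ : Path x (h (basePoint p (n + 1)))) :
    FundamentalGroup (OrientedSurface p (n + 1)) (basePoint p (n + 1)) ≃* FundamentalGroup M x :=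
  (h.fundamentalGroupMulEquiv _).trans
    (FundamentalGroup.fundamentalGroupMulEquivOfPath γ.symm)

theorem changeBase_boundaryLoop (h : OrientedSurface p (n + 1) ≃ₜ M) {x : M}
    (γ : Path x (h (basePoint p (n + 1)))) (j : Fin (n + 1)) :
    changeBase h γ (FundamentalGroup.fromPath (mk (boundaryLoop p (n + 1) j))) =
      boundaryClass h γ j := by
  change FundamentalGroup.fromPath (mk (γ.symm.symm.trans
    (((boundaryLoop p (n + 1) j).map h.continuous).trans γ.symm))) = _
  rw [Path.symm_symm]
  rfl

end OrientedSurface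

theorem mainTheorem9 (p r : ℕ) (hr : 0 < r) {M : Type*} [TopologicalSpace M]
    (h : OrientedSurface p r ≃ₜ M) (x : M)
    (γ : Path x (h (OrientedSurface.basePoint p r))) :
    Nonempty (FundamentalGroup M x ≃* FreeGroup (Fin (2 * p + r - 1))) ∧
    (1 ≤ p → Function.Injective (FreeGroup.lift (boundaryClass h γ))) ∧
    IsMeasureFreeFactor (Subgroup.closure (Set.range (boundaryClass h γ))) := by
  obtain ⟨n, rfl⟩ : ∃ n, r = n + 1 := ⟨r - 1, by omega⟩
  let e := (OrientedSurface.freeGroupEquiv p n).trans (OrientedSurface.changeBase h γ)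
  have he : ∀ j, e (SurfaceBasis.boundaryWord p n j) = (boundaryClass h γ j)⁻¹ := fun j => by
    rw [MulEquiv.trans_apply, OrientedSurface.freeGroupEquiv_boundaryWord, _root_.map_inv,
      OrientedSurface.changeBase_boundaryLoop]
  refine ⟨⟨e.symm.trans (FreeGroup.freeGroupCongr (Fintype.equivFinOfCardEq ?_))⟩, fun hp => ?_, ?_⟩
  · simp only [Fintype.card_sum, Fintype.card_prod, Fintype.card_fin, Fintype.card_bool]
    omega
  -- The isomorphism sends boundary words to inverses of the boundary classes; the involution that
  -- inverts each generator compensates for this.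
  · let ι : FreeGroup (Fin (n + 1)) →* FreeGroup (Fin (n + 1)) :=
      FreeGroup.lift fun j => (FreeGroup.of j)⁻¹
    have hι : ι.comp ι = MonoidHom.id _ := FreeGroup.ext_hom _ _ fun j => by simp [ι]
    have hιi : Function.Injective ι :=
      Function.LeftInverse.injective (g := ι) fun w => DFunLike.congr_fun hι w
    have key : FreeGroup.lift (boundaryClass h γ) =
        (e.toMonoidHom.comp (FreeGroup.lift (SurfaceBasis.boundaryWord p n))).comp ι :=
      FreeGroup.ext_hom _ _ fun j => by
        have h1 : (e.toMonoidHom.comp (FreeGroup.lift (SurfaceBasis.boundaryWord p n)))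
            (FreeGroup.of j) = (boundaryClass h γ j)⁻¹ := by
          rw [MonoidHom.comp_apply, FreeGroup.lift_apply_of]
          exact he j
        rw [MonoidHom.comp_apply, FreeGroup.lift_apply_of, FreeGroup.lift_apply_of,
          _root_.map_inv, h1, inv_inv]
    rw [key]
    exact (e.injective.comp (SurfaceBasis.lift_boundaryWord_injective hp)).comp hιi
  · have h1 := SurfaceBasis.isMeasureFreeFactor_closure_boundaryWord (p := p) (n := n)
    have h2 := h1.map e
    have h3 : e.toMonoidHom '' Set.range (SurfaceBasis.boundaryWord p n) =
        (Set.range (boundaryClass h γ))⁻¹ := by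
      rw [← Set.range_comp, Set.inv_range]
      exact congrArg Set.range (funext he)
    rwa [MonoidHom.map_closure, h3, Subgroup.closure_inv] at h2
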